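/- Let $(M,g)$ be a connected smooth finite-dimensional pseudo-Riemannian manifold, and let $G$ be a Lie group with Lie algebra $\mathfrak g$ acting smoothly on $M$ by isometries of $g$. Fix a basis $e_a$ of $\mathfrak g$ with structure constants $[e_a,e_b]=C_{ab}^c e_c$, and let $\xi_a$ be the Killing vector fields $\xi_a(x)=\frac{d}{dt}\big|_{t=0}\exp(te_a)^{-1}\cdot x$ that generate the action. Let $F$ be a smooth closed $G$-invariant 2-form on $M$, and let $m>0$ and $\varepsilon\in\mathbb R$. (i) Every point of $M$ has a connected open neighbourhood $U$ on which there are a smooth 1-form $A$ with $dA=F$ and smooth functions $\chi_a$ with $d\chi_a=-i_{\xi_a}F=-F(\xi_a,\cdot)$. (ii) Let $U\subseteq M$ be any nonempty connected open set, and let $A$ and $\chi_a$ be such a 1-form and such functions on $U$. With $\nabla$ the Levi-Civita connection of $g$ and $\nabla^{(\varepsilon)}_i=\nabla_i-i\varepsilon A_i$, consider the following linear operators on $C^\infty(U,\mathbb C)$: the Klein--Gordon--Fock operator in the field $F$, $\hat H^{(\varepsilon)}=g^{ij}\nabla^{(\varepsilon)}_i\nabla^{(\varepsilon)}_j+m^2$,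 and $$\hat\xi^{(\varepsilon)}_0=i\varepsilon,\qquad \hat\xi^{(\varepsilon)}_a=\xi_a^i\nabla^{(\varepsilon)}_i+i\varepsilon\chi_a,\qquad a=1,\dots,\dim\mathfrak g.$$ Then $\hat H^{(\varepsilon)}$ commutes with $\hat\xi^{(\varepsilon)}_0$ and with every $\hat\xi^{(\varepsilon)}_a$. The functions $\Omega_{ab}=F(\xi_a,\xi_b)-C_{ab}^c\chi_c$ are constant on $U$ and are the components of a real 2-cocycle $\Omega$ of $\mathfrak g$ (with trivial coefficients). Let $\tilde{\mathfrak g}=\mathfrak g\oplus_\Omega\mathbb R e_0$ be the one-dimensional central extension of $\mathfrak g$ defined by $\Omega$, with $[e_a,e_b]=C_{ab}^c e_c+\Omega_{ab}e_0$ and $e_0$ central. The real-linear map $e_0\mapsto\hat\xi^{(\varepsilon)}_0$, $e_a\mapsto\hat\xi^{(\varepsilon)}_a$ is a homomorphism of Lie algebras from $\tilde{\mathfrak g}$ onto the real span of the operators $\hat\xi^{(\varepsilon)}_0,\hat\xi^{(\varepsilon)}_1,\dots,\hat\xi^{(\varepsilon)}_{\dim\mathfrak g}$ with the commutator bracket.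 If $\varepsilon\neq0$ and only a discrete subgroup of $G$ acts trivially on $M$ (in particular, if the action is effective), then this map is injective, so these operators are a basis of a Lie algebra of operators isomorphic to $\tilde{\mathfrak g}$. -/

import Mathlib

open scoped Manifold ContDiff
open Bundle

/- The Lie bracket of operators is the commutator. -/
attribute [local instance 100] LieRing.ofAssociativeRing

noncomputable section

/-- A smooth Lie group over `ℝ` is a Lie group of the class that Mathlib asks for in order to put
the Lie algebra structure on `GroupLieAlgebra`. -/
instance instLieGroupMinSmoothnessReal {E : Type*} [NormedAddCommGroup E] [NormedSpace ℝ E]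
    {G : Type*} [TopologicalSpace G] [ChartedSpace E G] [Group G] [LieGroup 𝓘(ℝ, E) ∞ G] :
    LieGroup 𝓘(ℝ, E) (minSmoothness ℝ 3) G := by
  rw [minSmoothness_of_isRCLikeNormedField]
  infer_instance

namespace KGF

variable {E : Type*} [NormedAddCommGroup E] [NormedSpace ℝ E]
  {M : Type*} [TopologicalSpace M] [ChartedSpace E M]

/-- Vector fields on `M` (no regularity). -/
abbrev VField (E : Type*) [NormedAddCommGroup E] [NormedSpace ℝ E]
    (M : Type*) [TopologicalSpace M] [ChartedSpace E M] : Type _ :=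
  (x : M) → TangentSpace 𝓘(ℝ, E) x

/-- Fields of covectors on `M` (no regularity). -/
abbrev Covector (E : Type*) [NormedAddCommGroup E] [NormedSpace ℝ E]
    (M : Type*) [TopologicalSpace M] [ChartedSpace E M] : Type _ :=
  (x : M) → TangentSpace 𝓘(ℝ, E) x →L[ℝ] ℝ

/-- Fields of bilinear forms on the tangent spaces of `M` (no regularity). -/
abbrev Bilin (E : Type*) [NormedAddCommGroup E] [NormedSpace ℝ E]
    (M : Type*) [TopologicalSpace M] [ChartedSpace E M] : Type _ :=
  (x : M) → TangentSpace 𝓘(ℝ, E) x →L[ℝ] TangentSpace 𝓘(ℝ, E) x →L[ℝ] ℝ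

/-- Differentiability of a vector field at a point. -/
def VField.DiffAt [IsManifold 𝓘(ℝ, E) ∞ M] (X : VField E M) (x : M) : Prop :=
  MDifferentiableAt 𝓘(ℝ, E) (𝓘(ℝ, E).prod 𝓘(ℝ, E))
    (fun y : M ↦ TotalSpace.mk' E (E := fun z : M ↦ TangentSpace 𝓘(ℝ, E) z) y (X y)) x

/-- Smoothness of a field of covectors on a set. -/
def Covector.SmoothOn [IsManifold 𝓘(ℝ, E) ∞ M] (A : Covector E M) (U : Set M) : Prop :=
  ContMDiffOn 𝓘(ℝ, E) (𝓘(ℝ, E).prod 𝓘(ℝ, E →L[ℝ] ℝ)) ∞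
    (fun y : M ↦ TotalSpace.mk' (E →L[ℝ] ℝ)
      (E := fun z : M ↦ TangentSpace 𝓘(ℝ, E) z →L[ℝ] Bundle.Trivial M ℝ z) y (A y)) U

/-- Smoothness of a field of bilinear forms. -/
def Bilin.Smooth [IsManifold 𝓘(ℝ, E) ∞ M] (B : Bilin E M) : Prop :=
  ContMDiff 𝓘(ℝ, E) (𝓘(ℝ, E).prod 𝓘(ℝ, E →L[ℝ] E →L[ℝ] ℝ)) ∞
    (fun y : M ↦ TotalSpace.mk' (E →L[ℝ] E →L[ℝ] ℝ)
      (E := fun z : M ↦ TangentSpace 𝓘(ℝ, E) z →L[ℝ] TangentSpace 𝓘(ℝ, E) z →L[ℝ]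
        Bundle.Trivial M ℝ z) y (B y))

/-- The field `B` of bilinear forms is invariant under the map `f`, i.e. `f^* B = B`. -/
def Bilin.InvariantUnder (B : Bilin E M) (f : M → M) : Prop :=
  ∀ (x : M) (v w : TangentSpace 𝓘(ℝ, E) x),
    B (f x) (mfderiv 𝓘(ℝ, E) 𝓘(ℝ, E) f x v) (mfderiv 𝓘(ℝ, E) 𝓘(ℝ, E) f x w) = B x v w

/-- A smooth pseudo-Riemannian metric, of arbitrary signature. -/
structure PseudoRiemannianMetric (E : Type*) [NormedAddCommGroup E] [NormedSpace ℝ E]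
    (M : Type*) [TopologicalSpace M] [ChartedSpace E M] [IsManifold 𝓘(ℝ, E) ∞ M] where
  /-- the bilinear form on each tangent space -/
  val : Bilin E M
  symm : ∀ (x : M) (v w : TangentSpace 𝓘(ℝ, E) x), val x v w = val x w v
  nondegenerate : ∀ (x : M) (v : TangentSpace 𝓘(ℝ, E) x), (∀ w, val x v w = 0) → v = 0
  smooth : val.Smooth

/-! ### Exterior derivatives -/

/-- `(dA)(X, Y) = X(A(Y)) - Y(A(X)) - A([X, Y])`. -/
def extDerivOne (A : Covector E M) (X Y : VField E M) (x : M) : ℝ :=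
  mvfderiv 𝓘(ℝ, E) (fun y ↦ A y (Y y)) x (X x)
    - mvfderiv 𝓘(ℝ, E) (fun y ↦ A y (X y)) x (Y x)
    - A x (VectorField.mlieBracket 𝓘(ℝ, E) X Y x)

/-- `(dF)(X, Y, Z) = X(F(Y,Z)) - Y(F(X,Z)) + Z(F(X,Y)) - F([X,Y],Z) + F([X,Z],Y) - F([Y,Z],X)`. -/
def extDerivTwo (F : Bilin E M) (X Y Z : VField E M) (x : M) : ℝ :=
  mvfderiv 𝓘(ℝ, E) (fun y ↦ F y (Y y) (Z y)) x (X x)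
    - mvfderiv 𝓘(ℝ, E) (fun y ↦ F y (X y) (Z y)) x (Y x)
    + mvfderiv 𝓘(ℝ, E) (fun y ↦ F y (X y) (Y y)) x (Z x)
    - F x (VectorField.mlieBracket 𝓘(ℝ, E) X Y x) (Z x)
    + F x (VectorField.mlieBracket 𝓘(ℝ, E) X Z x) (Y x)
    - F x (VectorField.mlieBracket 𝓘(ℝ, E) Y Z x) (X x)

/-- `F` is a smooth closed differential 2-form on `M`. -/
structure IsClosedTwoForm [IsManifold 𝓘(ℝ, E) ∞ M] (F : Bilin E M) : Prop where
  smooth : F.Smooth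
  alternating : ∀ (x : M) (v : TangentSpace 𝓘(ℝ, E) x), F x v v = 0
  closed : ∀ (x : M) (X Y Z : VField E M), X.DiffAt x → Y.DiffAt x → Z.DiffAt x →
    extDerivTwo F X Y Z x = 0

/-- `A` is a smooth vector potential of `F` on `U`: `dA = F` on `U`. -/
structure IsPotentialOn [IsManifold 𝓘(ℝ, E) ∞ M] (F : Bilin E M) (A : Covector E M)
    (U : Set M) : Prop where
  smooth : A.SmoothOn U
  extDeriv_eq : ∀ x ∈ U, ∀ X Y : VField E M, X.DiffAt x → Y.DiffAt x →
    extDerivOne A X Y x = F x (X x) (Y x)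

/-- `χ` is a smooth function on `U` with `dχ = - i_ξ F` on `U`, where `i_ξ F = F(ξ, ·)`. -/
structure IsMomentOn (F : Bilin E M) (ξ : VField E M) (χ : M → ℝ) (U : Set M) : Prop where
  smooth : ContMDiffOn 𝓘(ℝ, E) 𝓘(ℝ, ℝ) ∞ χ U
  deriv_eq : ∀ x ∈ U, ∀ v : TangentSpace 𝓘(ℝ, E) x, mvfderiv 𝓘(ℝ, E) χ x v = - F x (ξ x) v

/-! ### The generators of a group action -/

/-- The generator of the action of `G` on `M` given by an element `v` of the Lie algebra of `G`:
the vector field `ξ_v(x) = d/dt (exp(t v)⁻¹ • x)` at `t = 0`, that is, the generator of the right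
action `x · h = h⁻¹ • x`. With this (usual) sign, `v ↦ ξ_v` respects Lie brackets. -/
def generator {EG : Type*} [NormedAddCommGroup EG] [NormedSpace ℝ EG]
    {G : Type*} [TopologicalSpace G] [ChartedSpace EG G] [Group G] [MulAction G M]
    (v : GroupLieAlgebra 𝓘(ℝ, EG) G) : VField E M := fun x ↦
  ((mfderiv 𝓘(ℝ, EG) 𝓘(ℝ, E) (fun h : G ↦ h⁻¹ • x) 1 v :
    TangentSpace 𝓘(ℝ, E) ((1 : G)⁻¹ • x)) : E)

/-! ### The Levi-Civita connection -/

/-- A vector field extending the tangent vector `v` at `x`, with constant coefficients in the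
distinguished chart at `x` (arbitrary outside that chart; only its germ at `x` is used). -/
def extend [IsManifold 𝓘(ℝ, E) ∞ M] {x : M} (v : TangentSpace 𝓘(ℝ, E) x) : VField E M :=
  FiberBundle.extend E (E := fun z : M ↦ TangentSpace 𝓘(ℝ, E) z) v

/-- The Koszul expression, equal to `2 g(∇_X Y, Z)` for the Levi-Civita connection `∇`. -/
def koszul (g : Bilin E M) (X Y Z : VField E M) (x : M) : ℝ :=
  mvfderiv 𝓘(ℝ, E) (fun y ↦ g y (Y y) (Z y)) x (X x)
    + mvfderiv 𝓘(ℝ, E) (fun y ↦ g y (X y) (Z y)) x (Y x)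
    - mvfderiv 𝓘(ℝ, E) (fun y ↦ g y (X y) (Y y)) x (Z x)
    + g x (VectorField.mlieBracket 𝓘(ℝ, E) X Y x) (Z x)
    - g x (VectorField.mlieBracket 𝓘(ℝ, E) X Z x) (Y x)
    - g x (VectorField.mlieBracket 𝓘(ℝ, E) Y Z x) (X x)

variable [FiniteDimensional ℝ E] [IsManifold 𝓘(ℝ, E) ∞ M]

/-- A basis of the tangent space at `x`. -/
def tangentBasis (x : M) :
    Module.Basis (Fin (Module.finrank ℝ E)) ℝ (TangentSpace 𝓘(ℝ, E) x) :=
  (Module.finBasis ℝ E : Module.Basis (Fin (Module.finrank ℝ E)) ℝ E)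

/-- The contravariant components `g^{ij}` of the metric at `x`: the inverse of the matrix `g_{ij}`
in the basis `tangentBasis x`. -/
def PseudoRiemannianMetric.inv (g : PseudoRiemannianMetric E M) (x : M) :
    Matrix (Fin (Module.finrank ℝ E)) (Fin (Module.finrank ℝ E)) ℝ :=
  (Matrix.of fun i j ↦ g.val x (tangentBasis x i) (tangentBasis x j))⁻¹

/-- The covariant derivative `∇_v Y` at `x` for the Levi-Civita connection of `g`: the vector
determined by `g(∇_v Y, w) = koszul(v, Y, w) / 2` for all `w`. -/
def PseudoRiemannianMetric.nabla (g : PseudoRiemannianMetric E M) (Y : VField E M) (x : M)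
    (v : TangentSpace 𝓘(ℝ, E) x) : TangentSpace 𝓘(ℝ, E) x :=
  ∑ i, ∑ j, (g.inv x i j * (koszul g.val (extend v) Y (extend (tangentBasis x i)) x / 2)) •
    tangentBasis x j

/-! ### The operators -/

/-- The covariant derivative shifted by the field, on scalars: `∇^(ε)_v φ = dφ(v) - i ε A(v) φ`. -/
def shiftedDeriv (ε : ℝ) (A : Covector E M) (φ : M → ℂ) (x : M)
    (v : TangentSpace 𝓘(ℝ, E) x) : ℂ :=
  mvfderiv 𝓘(ℝ, E) φ x v - Complex.I * (ε : ℂ) * (A x v : ℂ) * φ x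

/-- The covariant derivative shifted by the field, on complex covector fields `α`:
`(∇^(ε)_v α)(w) = v(α(W)) - α(∇_v W) - i ε A(v) α(w)`, where `W` is a vector field extending `w`. -/
def shiftedDerivCovector (g : PseudoRiemannianMetric E M) (ε : ℝ) (A : Covector E M)
    (α : (x : M) → TangentSpace 𝓘(ℝ, E) x → ℂ) (x : M) (v w : TangentSpace 𝓘(ℝ, E) x) : ℂ :=
  mvfderiv 𝓘(ℝ, E) (fun y ↦ α y ((extend w : VField E M) y)) x v
    - α x (g.nabla (extend w) x v)
    - Complex.I * (ε : ℂ) * (A x v : ℂ) * α x w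

/-- The Klein-Gordon-Fock operator in the external field with potential `A`:
`H^(ε) φ = g^{ij} ∇^(ε)_i ∇^(ε)_j φ + m² φ`. -/
def kgf (g : PseudoRiemannianMetric E M) (m ε : ℝ) (A : Covector E M) (φ : M → ℂ) (x : M) : ℂ :=
  (∑ i, ∑ j, (g.inv x i j : ℂ) *
    shiftedDerivCovector g ε A (shiftedDeriv ε A φ) x (tangentBasis x i) (tangentBasis x j))
  + (m : ℂ) ^ 2 * φ x

/-- The operator `ξ^i ∇^(ε)_i + i ε χ`. -/
def symOp (ε : ℝ) (A : Covector E M) (ξ : VField E M) (χ : M → ℝ) (φ : M → ℂ) (x : M) : ℂ :=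
  shiftedDeriv ε A φ x (ξ x) + Complex.I * (ε : ℂ) * (χ x : ℂ) * φ x

/-- The space `C^∞(U, ℂ)` of smooth complex functions on the open set `U`, realized as functions
on `M` by extending them by zero outside `U`. -/
def SmoothFun (E : Type*) [NormedAddCommGroup E] [NormedSpace ℝ E]
    {M : Type*} [TopologicalSpace M] [ChartedSpace E M] (U : Set M) : Submodule ℂ (M → ℂ) where
  carrier := {φ | ContMDiffOn 𝓘(ℝ, E) 𝓘(ℝ, ℂ) ∞ φ U ∧ ∀ x ∉ U, φ x = 0}
  add_mem' := fun {φ ψ} hφ hψ ↦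
    ⟨hφ.1.add hψ.1, fun x hx ↦ by simp [hφ.2 x hx, hψ.2 x hx]⟩
  zero_mem' := ⟨contMDiffOn_const, fun _ _ ↦ rfl⟩
  smul_mem' := fun c φ hφ ↦
    ⟨((c • ContinuousLinearMap.id ℝ ℂ).contMDiff).comp_contMDiffOn hφ.1, fun x hx ↦ by simp [hφ.2 x hx]⟩

/-- The operator `T` on `C^∞(U, ℂ)` is given by the expression `D` at every point of `U`. -/
def IsGivenBy {U : Set M} (T : Module.End ℂ (SmoothFun E U)) (D : (M → ℂ) → M → ℂ) : Prop :=
  ∀ φ : SmoothFun E U, ∀ x ∈ U, (T φ : M → ℂ) x = D (φ : M → ℂ) x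

end KGF

end

/-! Put `b = iε(A(ξ) - χ)`, so that the symmetry operator reads `φ ↦ dφ(ξ) - bφ`. Cartan's formula
with `dA = F` and `dχ = -i_ξ F` gives `L_ξ A = d(A(ξ)) + i_ξ F = d(A(ξ) - χ)`. Along the flow of `ξ`
the potential therefore changes only by a gauge transformation, and `b` compensates it
(`isGauge_gaugeFun`). The shifted Lie derivative `L_ξ - b` then commutes with each ingredient of the
Klein-Gordon-Fock operator: with the shifted gradient by the gauge relation (`grad_lieFun`), with
the shifted covariant derivative of covectors because a Killing field preserves the Christoffel
symbols (`lie_christoffel`, `covDeriv_lieCovector`), and with the contraction because it preserves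
the inverse metric (`fderiv_trace`). Together these give `Flat.kgf_lieFun`.

The commutator of two symmetry operators has `[ξ_v, ξ_w] = ξ_[v,w]` as first order part, and the
curvature contributes `iεF(ξ_v, ξ_w)`. It differs from the operator of `[v, w]` by `iε` times `Ω(v,
w) = F(ξ_v, ξ_w) - χ_[v,w]`. Both terms of `Ω` have differential `-i_{ξ_[v,w]} F`, so `Ω` is
constant on the connected set `U`. The cocycle identity is closedness and invariance of `F` for the
first term, and the Jacobi identity for the second.

For injectivity, a kernel element makes the operator of some `v` a scalar; test functions vanishing
at a point then force `ξ_v = 0` on `U`. A Killing field satisfies a linear ODE for its 1-jet along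
segments, so `ξ_v = 0` on the connected manifold `M`. A local integral curve of the left-invariant
field of `v` through `1` then acts trivially, and discreteness makes it constant, so `v = 0`.

Locally, `A` comes from the Poincaré homotopy formula on a coordinate ball, and `χ_a` is a primitive
of the closed form `-i_{ξ_a} F`. All calculations take place in a chart; a dictionary identifies the
intrinsic objects with their coordinate expressions. -/

noncomputable section

set_option maxSynthPendingDepth 3
set_option linter.unusedSectionVars false

/-! ### Linear algebra: Gram matrices, raising indices, traces -/

namespace KGF.Flat

open Module

variable {E : Type*} [NormedAddCommGroup E] [NormedSpace ℝ E] [FiniteDimensional ℝ E]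

/-- The Gram matrix of a bilinear form in the standard basis. -/
def gram (B : E →L[ℝ] E →L[ℝ] ℝ) : Matrix (Fin (finrank ℝ E)) (Fin (finrank ℝ E)) ℝ :=
  Matrix.of fun i j ↦ B (finBasis ℝ E i) (finBasis ℝ E j)

/-- A left null vector of the Gram matrix is the coefficient vector of an element orthogonal to
everything. -/
lemma isUnit_det_gram {B : E →L[ℝ] E →L[ℝ] ℝ} (hB : ∀ v, (∀ w, B v w = 0) → v = 0) :
    IsUnit (gram B).det := by
  rw [isUnit_iff_ne_zero]
  intro h
  obtain ⟨v, hv, hv0⟩ := Matrix.exists_vecMul_eq_zero_iff.2 h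
  apply hv
  have key : ∑ i, v i • finBasis ℝ E i = 0 := by
    apply hB
    intro w
    have : (B (∑ i, v i • finBasis ℝ E i)).toLinearMap = 0 := by
      apply (finBasis ℝ E).ext
      intro j
      have := congrFun hv0 j
      simpa [Matrix.vecMul, dotProduct, gram] using this
    exact LinearMap.congr_fun this w
  funext i
  have := congrArg (fun u ↦ (finBasis ℝ E).repr u i) key
  simpa [Finsupp.single_apply] using this

/-- Raising an index: the inverse Gram matrix produces the vector that represents the form `l`. On
basis vectors this is `G⁻¹ G = 1`, and with this order of indices no symmetry of `B` is needed. -/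
lemma sum_inv_gram_smul {B : E →L[ℝ] E →L[ℝ] ℝ} (hB : ∀ v, (∀ w, B v w = 0) → v = 0)
    (l : E →ₗ[ℝ] ℝ) (z : E) :
    B (∑ i, ∑ j, ((gram B)⁻¹ i j * l (finBasis ℝ E i)) • finBasis ℝ E j) z = l z := by
  have h1 : (gram B)⁻¹ * gram B = 1 := Matrix.nonsing_inv_mul _ (isUnit_det_gram hB)
  have : (B (∑ i, ∑ j, ((gram B)⁻¹ i j * l (finBasis ℝ E i)) • finBasis ℝ E j)).toLinearMap
      = l := by
    apply (finBasis ℝ E).ext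
    intro k
    have h2 : ∀ i, ∑ j, (gram B)⁻¹ i j * B (finBasis ℝ E j) (finBasis ℝ E k)
        = (1 : Matrix (Fin (finrank ℝ E)) (Fin (finrank ℝ E)) ℝ) i k := by
      intro i; rw [← h1]; rfl
    simp only [ContinuousLinearMap.coe_coe, map_sum, map_smul, FunLike.coe_sum,
      Finset.sum_apply, FunLike.coe_smul, Pi.smul_apply, smul_eq_mul]
    calc _ = ∑ i, l (finBasis ℝ E i) *
          ∑ j, (gram B)⁻¹ i j * B (finBasis ℝ E j) (finBasis ℝ E k) := by
          refine Finset.sum_congr rfl fun i _ ↦ ?_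
          rw [Finset.mul_sum]
          refine Finset.sum_congr rfl fun j _ ↦ ?_
          ring
      _ = _ := by simp [h2, Matrix.one_apply]
  exact LinearMap.congr_fun this z

/-- The trace of a complex bilinear form with respect to a real nondegenerate one. -/
def trace (B : E →L[ℝ] E →L[ℝ] ℝ) (T : E → E → ℂ) : ℂ :=
  ∑ i, ∑ j, (((gram B)⁻¹ i j : ℝ) : ℂ) * T (finBasis ℝ E i) (finBasis ℝ E j)

lemma trace_eq_matrix (B : E →L[ℝ] E →L[ℝ] ℝ) (T : E → E → ℂ) :
    trace B T = Matrix.trace (((gram B)⁻¹).map Complex.ofReal *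
      (Matrix.of fun i j ↦ T (finBasis ℝ E i) (finBasis ℝ E j)).transpose) := by
  simp [trace, Matrix.trace, Matrix.mul_apply]

/-- The trace does not depend on the basis. -/
lemma trace_comp (B : E →L[ℝ] E →L[ℝ] ℝ) (T : E →ₗ[ℝ] E →ₗ[ℝ] ℂ) (P : E ≃L[ℝ] E) :
    trace (B.bilinearComp (P : E →L[ℝ] E) (P : E →L[ℝ] E)) (fun v w ↦ T (P v) (P w))
      = trace B (fun v w ↦ T v w) := by
  set b := finBasis ℝ E
  set Q := LinearMap.toMatrix b b (P : E →L[ℝ] E).toLinearMap with hQ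
  have hP : ∀ i, P (b i) = ∑ k, Q k i • b k := by
    intro i
    rw [← b.sum_repr (P (b i))]
    refine Finset.sum_congr rfl fun k _ ↦ ?_
    simp [hQ, LinearMap.toMatrix_apply]
  have hQu : IsUnit Q.det := by
    have h : LinearMap.toMatrix b b (P.symm : E →L[ℝ] E).toLinearMap * Q = 1 := by
      rw [hQ, ← LinearMap.toMatrix_comp]
      convert LinearMap.toMatrix_id b
      ext v; simp
    have := congrArg Matrix.det h
    rw [Matrix.det_mul, Matrix.det_one] at this
    exact IsUnit.of_mul_eq_one_right _ this
  have hG : gram (B.bilinearComp (P : E →L[ℝ] E) (P : E →L[ℝ] E))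
      = Q.transpose * gram B * Q := by
    ext i j
    simp only [gram, Matrix.of_apply, ContinuousLinearMap.bilinearComp_apply,
      ContinuousLinearEquiv.coe_coe, Matrix.mul_apply, Matrix.transpose_apply]
    change B (P (b i)) (P (b j)) = _
    rw [hP i, hP j]
    simp only [map_sum, map_smul, FunLike.coe_sum, Finset.sum_apply,
      FunLike.coe_smul, Pi.smul_apply, smul_eq_mul, Finset.mul_sum, Finset.sum_mul]
    refine Finset.sum_congr rfl fun k _ ↦ Finset.sum_congr rfl fun l _ ↦ ?_
    ring
  have hT : (Matrix.of fun i j ↦ T (P (b i)) (P (b j)))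
      = (Q.map Complex.ofReal).transpose * (Matrix.of fun i j ↦ T (b i) (b j))
        * Q.map Complex.ofReal := by
    ext i j
    simp only [Matrix.of_apply, Matrix.mul_apply, Matrix.transpose_apply, Matrix.map_apply]
    rw [hP i, hP j]
    simp only [map_sum, map_smul, LinearMap.coe_sum, Finset.sum_apply, LinearMap.smul_apply,
      Complex.real_smul, Finset.mul_sum, Finset.sum_mul]
    refine Finset.sum_congr rfl fun k _ ↦ Finset.sum_congr rfl fun l _ ↦ ?_
    ring
  -- With `Q` the matrix of `P`, the Gram matrix becomes `QᵀGQ` and the matrix of `T` becomes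
  -- `QᵀTQ`. In the trace `Q⁻ᵀQᵀ` cancels directly, and `Q⁻¹` meets `Q` by cyclicity.
  rw [trace_eq_matrix, trace_eq_matrix]
  change Matrix.trace (_ * (Matrix.of fun i j ↦ T (P (b i)) (P (b j))).transpose) = _
  rw [hT, hG, Matrix.mul_inv_rev, Matrix.mul_inv_rev]
  have hm : ∀ X Y : Matrix (Fin (finrank ℝ E)) (Fin (finrank ℝ E)) ℝ,
      (X * Y).map Complex.ofReal = X.map Complex.ofReal * Y.map Complex.ofReal :=
    fun X Y ↦ Matrix.map_mul (f := Complex.ofRealHom)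
  have h1 : (Q.transpose)⁻¹.map Complex.ofReal * (Q.map Complex.ofReal).transpose = 1 := by
    rw [← Matrix.transpose_map, ← hm, Matrix.nonsing_inv_mul _ (by rwa [Matrix.det_transpose])]
    ext i j; simp [Matrix.one_apply]; split_ifs <;> simp
  have h2 : Q.map Complex.ofReal * (Q⁻¹).map Complex.ofReal = 1 := by
    rw [← hm, Matrix.mul_nonsing_inv _ hQu]
    ext i j; simp [Matrix.one_apply]; split_ifs <;> simp
  rw [hm, hm]
  simp only [Matrix.transpose_mul, Matrix.transpose_transpose]
  set M := (Matrix.of fun i j ↦ T (b i) (b j)).transpose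
  set Qc := Q.map Complex.ofReal
  calc _ = Matrix.trace ((Q⁻¹).map Complex.ofReal * ((gram B)⁻¹.map Complex.ofReal *
        (((Q.transpose)⁻¹.map Complex.ofReal * Qc.transpose) * (M * Qc)))) := by
        simp only [Matrix.mul_assoc]
    _ = _ := by
      rw [h1, Matrix.one_mul, Matrix.trace_mul_comm]
      simp only [Matrix.mul_assoc]
      rw [h2, Matrix.mul_one]

end KGF.Flat

/-! ### Christoffel symbols and Killing fields in coordinates -/

namespace KGF.Flat

open Module Filter
open scoped Topology

variable {E : Type*} [NormedAddCommGroup E] [NormedSpace ℝ E]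

lemma two_le_infty : (2 : ℕ∞ω) ≤ ∞ :=
  show ((2 : ℕ∞) : ℕ∞ω) ≤ ((⊤ : ℕ∞) : ℕ∞ω) from WithTop.coe_le_coe.2 le_top

lemma _root_.ContDiffAt.fderiv_infty {F : Type*} [NormedAddCommGroup F] [NormedSpace ℝ F]
    {f : E → F} {y : E} (hf : ContDiffAt ℝ ∞ f y) : ContDiffAt ℝ ∞ (fderiv ℝ f) y :=
  hf.fderiv_right (m := ∞) (by simp)

lemma _root_.ContDiffAt.hasFDerivAt_infty {F : Type*} [NormedAddCommGroup F] [NormedSpace ℝ F]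
    {f : E → F} {y : E} (hf : ContDiffAt ℝ ∞ f y) : HasFDerivAt f (fderiv ℝ f y) y :=
  (hf.differentiableAt (by simp)).hasFDerivAt

lemma _root_.ContDiffAt.fderiv_fderiv_symm {F : Type*} [NormedAddCommGroup F] [NormedSpace ℝ F]
    {f : E → F} {y : E} (hf : ContDiffAt ℝ ∞ f y) (u v : E) :
    fderiv ℝ (fderiv ℝ f) y u v = fderiv ℝ (fderiv ℝ f) y v u :=
  hf.isSymmSndFDerivAt (by simp only [minSmoothness_of_isRCLikeNormedField]; exact two_le_infty) u v

/-- The Lie derivative of a field of bilinear forms. -/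
def lieBilin (B : E → E →L[ℝ] E →L[ℝ] ℝ) (ξ : E → E) (y v w : E) : ℝ :=
  fderiv ℝ B y (ξ y) v w + B y (fderiv ℝ ξ y v) w + B y v (fderiv ℝ ξ y w)

/-- The equation `L_ξ B = 0` holds on a neighbourhood, so the product rule may be applied to it once
more, in the direction `u`. Three permuted instances yield `lie_christoffel`. -/
lemma fderiv_lieBilin_eq_zero {B : E → E →L[ℝ] E →L[ℝ] ℝ} {ξ : E → E} {y : E}
    (hB : ContDiffAt ℝ ∞ B y) (hξ : ContDiffAt ℝ ∞ ξ y)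
    (h : ∀ᶠ z in 𝓝 y, ∀ v w, lieBilin B ξ z v w = 0) (u v w : E) :
    fderiv ℝ (fderiv ℝ B) y u (ξ y) v w + fderiv ℝ B y (fderiv ℝ ξ y u) v w
      + fderiv ℝ B y u (fderiv ℝ ξ y v) w + B y (fderiv ℝ (fderiv ℝ ξ) y u v) w
      + fderiv ℝ B y u v (fderiv ℝ ξ y w) + B y v (fderiv ℝ (fderiv ℝ ξ) y u w) = 0 := by
  have h1 := ((hB.fderiv_infty.hasFDerivAt_infty.clm_apply hξ.hasFDerivAt_infty).clm_apply
    (hasFDerivAt_const v y)).clm_apply (hasFDerivAt_const w y)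
  have h2 := (hB.hasFDerivAt_infty.clm_apply
    (hξ.fderiv_infty.hasFDerivAt_infty.clm_apply (hasFDerivAt_const v y))).clm_apply
    (hasFDerivAt_const w y)
  have h3 := (hB.hasFDerivAt_infty.clm_apply (hasFDerivAt_const v y)).clm_apply
    (hξ.fderiv_infty.hasFDerivAt_infty.clm_apply (hasFDerivAt_const w y))
  have h4 := (h1.add h2).add h3
  have h5 : HasFDerivAt (fun _ : E ↦ (0 : ℝ)) (0 : E →L[ℝ] ℝ) y := hasFDerivAt_const _ _
  have h6 := (h5.congr_of_eventuallyEq (h.mono fun z hz ↦ hz v w)).unique h4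
  have h7 := DFunLike.congr_fun h6 u
  simp at h7
  linarith

/-- The Koszul combination `dB(v, w, z) + dB(w, v, z) - dB(z, v, w)`. -/
def koszulOf (dB : E →L[ℝ] E →L[ℝ] E →L[ℝ] ℝ) (v w z : E) : ℝ :=
  dB v w z + dB w v z - dB z v w

lemma koszulOf_add_left (dB : E →L[ℝ] E →L[ℝ] E →L[ℝ] ℝ) (v v' w z : E) :
    koszulOf dB (v + v') w z = koszulOf dB v w z + koszulOf dB v' w z := by
  simp only [koszulOf, map_add, add_apply]; ring

lemma koszulOf_smul_left (dB : E →L[ℝ] E →L[ℝ] E →L[ℝ] ℝ) (c : ℝ) (v w z : E) :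
    koszulOf dB (c • v) w z = c * koszulOf dB v w z := by
  simp only [koszulOf, map_smul, smul_apply, smul_eq_mul]; ring

lemma koszulOf_add_mid (dB : E →L[ℝ] E →L[ℝ] E →L[ℝ] ℝ) (v w w' z : E) :
    koszulOf dB v (w + w') z = koszulOf dB v w z + koszulOf dB v w' z := by
  simp only [koszulOf, map_add, add_apply]; ring

lemma koszulOf_smul_mid (dB : E →L[ℝ] E →L[ℝ] E →L[ℝ] ℝ) (c : ℝ) (v w z : E) :
    koszulOf dB v (c • w) z = c * koszulOf dB v w z := by
  simp only [koszulOf, map_smul, smul_apply, smul_eq_mul]; ring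

/-- The Koszul combination as a linear form in its last argument. -/
def koszulLin (dB : E →L[ℝ] E →L[ℝ] E →L[ℝ] ℝ) (v w : E) : E →ₗ[ℝ] ℝ where
  toFun z := koszulOf dB v w z / 2
  map_add' z z' := by simp only [koszulOf, map_add, add_apply]; ring
  map_smul' c z := by
    simp only [koszulOf, map_smul, smul_apply, smul_eq_mul, RingHom.id_apply]; ring

variable [FiniteDimensional ℝ E]

/-- The Christoffel symbols of a field of bilinear forms. -/
def christoffel (g : E → E →L[ℝ] E →L[ℝ] ℝ) (y : E) : E →L[ℝ] E →L[ℝ] E :=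
  LinearMap.toContinuousBilinearMap (LinearMap.mk₂ ℝ
    (fun v w ↦ ∑ i, ∑ j, ((gram (g y))⁻¹ i j *
      koszulLin (fderiv ℝ g y) v w (finBasis ℝ E i)) • finBasis ℝ E j)
    (fun v v' w ↦ by
      simp only [← Finset.sum_add_distrib, ← add_smul]
      refine Finset.sum_congr rfl fun i _ ↦ Finset.sum_congr rfl fun j _ ↦ ?_
      simp only [koszulLin, LinearMap.coe_mk, AddHom.coe_mk, koszulOf_add_left]
      congr 1; ring)
    (fun c v w ↦ by
      simp only [Finset.smul_sum, smul_smul]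
      refine Finset.sum_congr rfl fun i _ ↦ Finset.sum_congr rfl fun j _ ↦ ?_
      simp only [koszulLin, LinearMap.coe_mk, AddHom.coe_mk, koszulOf_smul_left]
      congr 1; ring)
    (fun v w w' ↦ by
      simp only [← Finset.sum_add_distrib, ← add_smul]
      refine Finset.sum_congr rfl fun i _ ↦ Finset.sum_congr rfl fun j _ ↦ ?_
      simp only [koszulLin, LinearMap.coe_mk, AddHom.coe_mk, koszulOf_add_mid]
      congr 1; ring)
    (fun c v w ↦ by
      simp only [Finset.smul_sum, smul_smul]
      refine Finset.sum_congr rfl fun i _ ↦ Finset.sum_congr rfl fun j _ ↦ ?_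
      simp only [koszulLin, LinearMap.coe_mk, AddHom.coe_mk, koszulOf_smul_mid]
      congr 1; ring))

lemma christoffel_apply (g : E → E →L[ℝ] E →L[ℝ] ℝ) (y v w : E) :
    christoffel g y v w = ∑ i, ∑ j, ((gram (g y))⁻¹ i j *
      koszulLin (fderiv ℝ g y) v w (finBasis ℝ E i)) • finBasis ℝ E j := rfl

/-- Lowering the index gives the Christoffel symbols of the first kind. With nondegeneracy this
characterizes `christoffel`, so identities for it can be proved without the inverse matrix. -/
lemma inner_christoffel {g : E → E →L[ℝ] E →L[ℝ] ℝ} {y : E}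
    (hnd : ∀ v, (∀ w, g y v w = 0) → v = 0) (v w z : E) :
    g y (christoffel g y v w) z
      = (fderiv ℝ g y v w z + fderiv ℝ g y w v z - fderiv ℝ g y z v w) / 2 := by
  rw [christoffel_apply]
  exact sum_inv_gram_smul hnd (koszulLin (fderiv ℝ g y) v w) z

/-- In finite dimension an operator is a finite sum of rank one operators built from its values on a
basis. -/
lemma contDiffAt_clm_of_apply {D F : Type*} [NormedAddCommGroup D] [NormedSpace ℝ D]
    [NormedAddCommGroup F] [NormedSpace ℝ F]
    {f : D → E →L[ℝ] F} {y : D} (h : ∀ v, ContDiffAt ℝ ∞ (fun z ↦ f z v) y) :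
    ContDiffAt ℝ ∞ f y := by
  have key : f = fun z ↦ ∑ i, ContinuousLinearMap.smulRightL ℝ E F
      (LinearMap.toContinuousLinearMap ((finBasis ℝ E).coord i)) (f z (finBasis ℝ E i)) := by
    funext z
    ext v
    conv_lhs => rw [← (finBasis ℝ E).sum_repr v, map_sum]
    simp
  rw [key]
  exact ContDiffAt.sum fun i _ ↦ (ContinuousLinearMap.contDiff _).contDiffAt.comp y (h _)

/-- Cramer's rule: the entries of the inverse are determinants, hence polynomials in the entries of
`g`, divided by a determinant that does not vanish at `y`. -/
lemma contDiffAt_gram_inv {g : E → E →L[ℝ] E →L[ℝ] ℝ} {y : E} (hg : ContDiffAt ℝ ∞ g y)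
    (hnd : ∀ v, (∀ w, g y v w = 0) → v = 0) (i j) :
    ContDiffAt ℝ ∞ (fun z ↦ (gram (g z))⁻¹ i j) y := by
  have hent : ∀ k l, ContDiffAt ℝ ∞ (fun z ↦ gram (g z) k l) y := fun k l ↦
    (hg.clm_apply contDiffAt_const).clm_apply contDiffAt_const
  have hdet : ∀ M : E → Matrix (Fin (finrank ℝ E)) (Fin (finrank ℝ E)) ℝ,
      (∀ k l, ContDiffAt ℝ ∞ (fun z ↦ M z k l) y) → ContDiffAt ℝ ∞ (fun z ↦ (M z).det) y := by
    intro M hM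
    simp only [Matrix.det_apply]
    exact ContDiffAt.sum fun σ _ ↦ ContDiffAt.const_smul _ (contDiffAt_prod fun k _ ↦ hM _ _)
  have h1 := hdet _ hent
  simp only [Matrix.inv_def, Matrix.smul_apply, Ring.inverse_eq_inv', smul_eq_mul]
  refine (h1.inv (isUnit_det_gram hnd).ne_zero).mul ?_
  simp only [Matrix.adjugate_apply]
  refine hdet _ fun k l ↦ ?_
  by_cases h : k = j
  · subst h; simpa using contDiffAt_const
  · simpa [Matrix.updateRow_ne h] using hent k l

lemma contDiffAt_christoffel {g : E → E →L[ℝ] E →L[ℝ] ℝ} {y : E} (hg : ContDiffAt ℝ ∞ g y)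
    (hnd : ∀ v, (∀ w, g y v w = 0) → v = 0) : ContDiffAt ℝ ∞ (christoffel g) y := by
  refine contDiffAt_clm_of_apply fun v ↦ contDiffAt_clm_of_apply fun w ↦ ?_
  have hd := hg.fderiv_infty
  have h3 : ∀ a b c : E, ContDiffAt ℝ ∞ (fun z ↦ fderiv ℝ g z a b c) y := fun a b c ↦
    ((hd.clm_apply contDiffAt_const).clm_apply contDiffAt_const).clm_apply contDiffAt_const
  simp only [christoffel_apply, koszulLin, koszulOf, LinearMap.coe_mk, AddHom.coe_mk]
  refine ContDiffAt.sum fun i _ ↦ ContDiffAt.sum fun j _ ↦ ContDiffAt.smul ?_ contDiffAt_const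
  exact (contDiffAt_gram_inv hg hnd i j).mul
    ((((h3 _ _ _).add (h3 _ _ _)).sub (h3 _ _ _)).div_const _)

/-- The Christoffel symbols are invariant under a Killing field. -/
lemma lie_christoffel {g : E → E →L[ℝ] E →L[ℝ] ℝ} {ξ : E → E} {y : E}
    (hg : ContDiffAt ℝ ∞ g y) (hξ : ContDiffAt ℝ ∞ ξ y)
    (hsymm : ∀ᶠ z in 𝓝 y, ∀ v w, g z v w = g z w v)
    (hnd : ∀ᶠ z in 𝓝 y, ∀ v, (∀ w, g z v w = 0) → v = 0)
    (h : ∀ᶠ z in 𝓝 y, ∀ v w, lieBilin g ξ z v w = 0) (v w : E) :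
    fderiv ℝ (christoffel g) y (ξ y) v w + christoffel g y (fderiv ℝ ξ y v) w
      + christoffel g y v (fderiv ℝ ξ y w) - fderiv ℝ ξ y (christoffel g y v w)
      + fderiv ℝ (fderiv ℝ ξ) y v w = 0 := by
  -- By nondegeneracy it suffices to pair the expression with an arbitrary `z`. The relation
  -- `inner_christoffel` holds near `y`; `hL` and `hR` differentiate its two sides, to be evaluated
  -- along `ξ`.
  apply hnd.self_of_nhds
  intro z
  have hnd0 := hnd.self_of_nhds
  have hΓ := (contDiffAt_christoffel hg hnd0).hasFDerivAt_infty
  have hL := (hg.hasFDerivAt_infty.clm_apply ((hΓ.clm_apply (hasFDerivAt_const v y)).clm_apply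
    (hasFDerivAt_const w y))).clm_apply (hasFDerivAt_const z y)
  have hd := hg.fderiv_infty.hasFDerivAt_infty
  have h3 : ∀ a b c : E, HasFDerivAt (fun z ↦ fderiv ℝ g z a b c) _ y := fun a b c ↦
    ((hd.clm_apply (hasFDerivAt_const a y)).clm_apply (hasFDerivAt_const b y)).clm_apply
      (hasFDerivAt_const c y)
  have hR := (((h3 v w z).add (h3 w v z)).sub (h3 z v w)).mul_const (2⁻¹ : ℝ)
  have h4 := (hR.congr_of_eventuallyEq (hnd.mono fun x hx ↦ by
    simp only [inner_christoffel hx, Pi.add_apply, Pi.sub_apply, div_eq_mul_inv])).unique hL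
  have h5 := DFunLike.congr_fun h4 (ξ y)
  simp at h5
  -- `k1` removes the derivative of `g` along `ξ` on the left side. `k2`, `k3`, `k4` are the
  -- differentiated Killing equation with the arguments of the three Koszul terms; once second
  -- derivatives are put in a common order, `k2 + k3 - k4` leaves only the pairing of `∂∂ξ(v, w)`
  -- with `z` among the second derivatives of `ξ`.
  have k1 := h.self_of_nhds (christoffel g y v w) z
  simp only [lieBilin] at k1
  have k2 := fderiv_lieBilin_eq_zero hg hξ h v w z
  have k3 := fderiv_lieBilin_eq_zero hg hξ h w v z
  have k4 := fderiv_lieBilin_eq_zero hg hξ h z v w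
  rw [hg.fderiv_fderiv_symm v] at k2
  rw [hg.fderiv_fderiv_symm w, hξ.fderiv_fderiv_symm w v] at k3
  rw [hg.fderiv_fderiv_symm z, hξ.fderiv_fderiv_symm z v, hξ.fderiv_fderiv_symm z w] at k4
  simp only [map_add, map_sub, add_apply, sub_apply, inner_christoffel hnd0] at k1 k2 k3 k4 h5 ⊢
  have s := hsymm.self_of_nhds
  rw [s v (fderiv ℝ (fderiv ℝ ξ) y w z)] at k4
  rw [s w (fderiv ℝ (fderiv ℝ ξ) y v z)] at k2
  rw [s v (fderiv ℝ (fderiv ℝ ξ) y w z)] at k3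
  linarith

end KGF.Flat

/-! ### Shifted derivatives and the commutation with the wave operator, in coordinates -/

namespace KGF.Flat

open Module Filter
open scoped Topology

variable {E : Type*} [NormedAddCommGroup E] [NormedSpace ℝ E]

/-- The covariant derivative of a function, shifted by a complex covector field. -/
def grad (a : E → E →L[ℝ] ℂ) (φ : E → ℂ) (y : E) : E →L[ℝ] ℂ :=
  fderiv ℝ φ y - φ y • a y

/-- The Lie derivative of a complex covector field, shifted by a function. -/
def lieCovector (ξ : E → E) (b : E → ℂ) (α : E → E →L[ℝ] ℂ) (y : E) : E →L[ℝ] ℂ :=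
  fderiv ℝ α y (ξ y) + (α y).comp (fderiv ℝ ξ y) - b y • α y

/-- The derivative of a function along a vector field, shifted by a function. -/
def lieFun (ξ : E → E) (b : E → ℂ) (φ : E → ℂ) (y : E) : ℂ :=
  fderiv ℝ φ y (ξ y) - b y * φ y

/-- The derivative of the function `b` is the Lie derivative of the covector field `a`. -/
def IsGauge (ξ : E → E) (a : E → E →L[ℝ] ℂ) (b : E → ℂ) (y : E) : Prop :=
  ∀ v, fderiv ℝ b y v = fderiv ℝ a y (ξ y) v + a y (fderiv ℝ ξ y v)

lemma contDiffAt_grad {a : E → E →L[ℝ] ℂ} {φ : E → ℂ} {y : E} (ha : ContDiffAt ℝ ∞ a y)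
    (hφ : ContDiffAt ℝ ∞ φ y) : ContDiffAt ℝ ∞ (grad a φ) y :=
  hφ.fderiv_infty.sub (hφ.smul ha)

lemma contDiffAt_lieFun {ξ : E → E} {b φ : E → ℂ} {y : E} (hξ : ContDiffAt ℝ ∞ ξ y)
    (hb : ContDiffAt ℝ ∞ b y) (hφ : ContDiffAt ℝ ∞ φ y) : ContDiffAt ℝ ∞ (lieFun ξ b φ) y :=
  (hφ.fderiv_infty.clm_apply hξ).sub (hb.mul hφ)

/-- The second derivatives of `φ` agree by symmetry, and the remaining discrepancy is `φ · (L_ξ a -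
db)`, which the gauge relation kills. -/
lemma grad_lieFun {ξ : E → E} {a : E → E →L[ℝ] ℂ} {b φ : E → ℂ} {y : E}
    (hξ : ContDiffAt ℝ ∞ ξ y) (ha : ContDiffAt ℝ ∞ a y) (hb : ContDiffAt ℝ ∞ b y)
    (hφ : ContDiffAt ℝ ∞ φ y) (hab : IsGauge ξ a b y) :
    grad a (lieFun ξ b φ) y = lieCovector ξ b (grad a φ) y := by
  have h1 : HasFDerivAt (lieFun ξ b φ) _ y :=
    (hφ.fderiv_infty.hasFDerivAt_infty.clm_apply hξ.hasFDerivAt_infty).sub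
      (hb.hasFDerivAt_infty.mul hφ.hasFDerivAt_infty)
  have h2 : HasFDerivAt (grad a φ) _ y :=
    hφ.fderiv_infty.hasFDerivAt_infty.sub (hφ.hasFDerivAt_infty.smul ha.hasFDerivAt_infty)
  ext v
  rw [grad, lieCovector, h1.fderiv, h2.fderiv]
  have h3 := hab v
  have h4 := hφ.fderiv_fderiv_symm v (ξ y)
  simp [grad, lieFun]
  linear_combination h4 - φ y * h3

variable [FiniteDimensional ℝ E]

/-- The covariant derivative of a complex covector field, shifted by a complex covector field. -/
def covDeriv (g : E → E →L[ℝ] E →L[ℝ] ℝ) (a α : E → E →L[ℝ] ℂ) (y : E) : E →L[ℝ] E →L[ℝ] ℂ :=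
  fderiv ℝ α y - (ContinuousLinearMap.compL ℝ E E ℂ (α y)).comp (christoffel g y)
    - (a y).smulRight (α y)

lemma covDeriv_apply (g : E → E →L[ℝ] E →L[ℝ] ℝ) (a α : E → E →L[ℝ] ℂ) (y v w : E) :
    covDeriv g a α y v w = fderiv ℝ α y v w - α y (christoffel g y v w) - a y v * α y w := by
  simp [covDeriv]

/-- The analogue of `grad_lieFun` one order higher. Besides the gauge relation and the symmetry of
second derivatives, the only new discrepancy is `α` applied to the Lie derivative of the connection,
which is zero by `lie_christoffel`. -/
lemma covDeriv_lieCovector {g : E → E →L[ℝ] E →L[ℝ] ℝ} {ξ : E → E} {a α : E → E →L[ℝ] ℂ}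
    {b : E → ℂ} {y : E} (hg : ContDiffAt ℝ ∞ g y)
    (hsymm : ∀ᶠ z in 𝓝 y, ∀ v w, g z v w = g z w v)
    (hnd : ∀ᶠ z in 𝓝 y, ∀ v, (∀ w, g z v w = 0) → v = 0)
    (h : ∀ᶠ z in 𝓝 y, ∀ v w, lieBilin g ξ z v w = 0)
    (hξ : ContDiffAt ℝ ∞ ξ y) (ha : ContDiffAt ℝ ∞ a y) (hb : ContDiffAt ℝ ∞ b y)
    (hα : ContDiffAt ℝ ∞ α y) (hab : IsGauge ξ a b y) (v w : E) :
    covDeriv g a (lieCovector ξ b α) y v w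
      = fderiv ℝ (fun z ↦ covDeriv g a α z v w) y (ξ y)
        + covDeriv g a α y (fderiv ℝ ξ y v) w + covDeriv g a α y v (fderiv ℝ ξ y w)
        - b y * covDeriv g a α y v w := by
  have h1 : HasFDerivAt (lieCovector ξ b α) _ y :=
    ((hα.fderiv_infty.hasFDerivAt_infty.clm_apply hξ.hasFDerivAt_infty).add
      (hα.hasFDerivAt_infty.clm_comp hξ.fderiv_infty.hasFDerivAt_infty)).sub
      (hb.hasFDerivAt_infty.smul hα.hasFDerivAt_infty)
  have hΓ := (contDiffAt_christoffel hg hnd.self_of_nhds).hasFDerivAt_infty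
  have cst : ∀ u : E, HasFDerivAt (fun _ : E ↦ u) (0 : E →L[ℝ] E) y := fun u ↦ hasFDerivAt_const u y
  have h2 : HasFDerivAt (fun z ↦ fderiv ℝ α z v w - α z (christoffel g z v w) - a z v * α z w)
      _ y :=
    (((hα.fderiv_infty.hasFDerivAt_infty.clm_apply (cst v)).clm_apply (cst w)).sub
      (hα.hasFDerivAt_infty.clm_apply ((hΓ.clm_apply (cst v)).clm_apply (cst w)))).sub
      ((ha.hasFDerivAt_infty.clm_apply (cst v)).mul (hα.hasFDerivAt_infty.clm_apply (cst w)))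
  simp only [covDeriv_apply]
  rw [h2.fderiv, h1.fderiv]
  have h3 := hab v
  have h4 := congrArg (fun L ↦ L w) (hα.fderiv_fderiv_symm v (ξ y))
  have h5 := congrArg (α y) (lie_christoffel hg hξ hsymm hnd h v w)
  simp only [map_add, map_sub, map_zero] at h5
  simp [lieCovector]
  linear_combination h4 - α y w * h3 + h5

lemma apply_eq_sum {F : Type*} [NormedAddCommGroup F] [NormedSpace ℝ F] (L : E →L[ℝ] F) (u : E) :
    L u = ∑ i, (finBasis ℝ E).repr u i • L (finBasis ℝ E i) := by
  conv_lhs => rw [← (finBasis ℝ E).sum_repr u, map_sum]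
  simp only [map_smul]

/-- With `Q` the Jacobian matrix of `ξ`, the Killing equation says that the derivative of the Gram
matrix `G` along `ξ` is `-(QᵀG + GQ)`. Differentiating `G⁻¹G = 1` turns this into `G⁻¹Qᵀ + QG⁻¹` for
the inverse. -/
lemma fderiv_gram_inv {g : E → E →L[ℝ] E →L[ℝ] ℝ} {ξ : E → E} {y : E}
    (hg : ContDiffAt ℝ ∞ g y) (hnd : ∀ᶠ z in 𝓝 y, ∀ v, (∀ w, g z v w = 0) → v = 0)
    (h : ∀ v w, lieBilin g ξ y v w = 0) (i j) :
    fderiv ℝ (fun z ↦ (gram (g z))⁻¹ i j) y (ξ y) =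
      ∑ k, ((gram (g y))⁻¹ i k * (finBasis ℝ E).repr (fderiv ℝ ξ y (finBasis ℝ E k)) j
        + (finBasis ℝ E).repr (fderiv ℝ ξ y (finBasis ℝ E k)) i * (gram (g y))⁻¹ k j) := by
  set Q : Matrix (Fin (finrank ℝ E)) (Fin (finrank ℝ E)) ℝ :=
    Matrix.of fun i k ↦ (finBasis ℝ E).repr (fderiv ℝ ξ y (finBasis ℝ E k)) i with hQ
  set D : Matrix (Fin (finrank ℝ E)) (Fin (finrank ℝ E)) ℝ :=
    Matrix.of fun i j ↦ fderiv ℝ (fun z ↦ (gram (g z))⁻¹ i j) y (ξ y) with hD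
  have hdet := isUnit_det_gram hnd.self_of_nhds
  have hi := fun i j ↦ (contDiffAt_gram_inv hg hnd.self_of_nhds i j).hasFDerivAt_infty
  have hG : ∀ k l, HasFDerivAt (fun z ↦ gram (g z) k l) _ y := fun k l ↦
    (hg.hasFDerivAt_infty.clm_apply (hasFDerivAt_const (finBasis ℝ E k) y)).clm_apply
      (hasFDerivAt_const (finBasis ℝ E l) y)
  have hdG : ∀ k l, fderiv ℝ g y (ξ y) (finBasis ℝ E k) (finBasis ℝ E l) = -((Q.transpose * gram (g y)) k l
      + (gram (g y) * Q) k l) := by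
    intro k l
    have h0 := h (finBasis ℝ E k) (finBasis ℝ E l)
    have e1 : g y (fderiv ℝ ξ y (finBasis ℝ E k)) (finBasis ℝ E l) = (Q.transpose * gram (g y)) k l := by
      have := congrArg (fun L ↦ L (finBasis ℝ E l))
        (apply_eq_sum (g y) (fderiv ℝ ξ y (finBasis ℝ E k)))
      simp only [FunLike.coe_sum, Finset.sum_apply, smul_apply, smul_eq_mul] at this
      exact this
    have e2 : g y (finBasis ℝ E k) (fderiv ℝ ξ y (finBasis ℝ E l)) = (gram (g y) * Q) k l := by
      rw [apply_eq_sum (g y (finBasis ℝ E k)), Matrix.mul_apply]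
      exact Finset.sum_congr rfl fun i _ ↦ mul_comm _ _
    rw [lieBilin, e1, e2] at h0
    linarith
  have key : D * gram (g y) = (gram (g y))⁻¹ * (Q.transpose * gram (g y) + gram (g y) * Q) := by
    ext i l
    have h1 : HasFDerivAt (fun z ↦ ∑ k, (gram (g z))⁻¹ i k * gram (g z) k l) _ y :=
      HasFDerivAt.fun_sum fun k _ ↦ (hi i k).mul (hG k l)
    have h2 : HasFDerivAt (fun _ : E ↦ (1 : Matrix (Fin (finrank ℝ E)) (Fin (finrank ℝ E)) ℝ) i l)
      (0 : E →L[ℝ] ℝ) y := hasFDerivAt_const _ _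
    have h3 := (h2.congr_of_eventuallyEq (hnd.mono fun z hz ↦ by
      rw [← Matrix.nonsing_inv_mul _ (isUnit_det_gram hz)]; rfl)).unique h1
    have h4 := DFunLike.congr_fun h3 (ξ y)
    simp only [zero_apply, FunLike.coe_sum, Finset.sum_apply, add_apply, smul_apply, smul_eq_mul,
      ContinuousLinearMap.comp_apply, ContinuousLinearMap.flip_apply, map_zero, zero_add] at h4
    have e1 : (D * gram (g y)) i l = ∑ k, D i k * gram (g y) k l := rfl
    have e2 : ((gram (g y))⁻¹ * (Q.transpose * gram (g y) + gram (g y) * Q)) i l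
        = ∑ k, (gram (g y))⁻¹ i k * ((Q.transpose * gram (g y)) k l + (gram (g y) * Q) k l) := rfl
    have e3 : ∀ k, fderiv ℝ (fun z ↦ (gram (g z))⁻¹ i k) y (ξ y) = D i k := fun k ↦ rfl
    rw [e1, e2, ← sub_eq_zero, ← Finset.sum_sub_distrib, h4]
    refine Finset.sum_congr rfl fun k _ ↦ ?_
    rw [hdG, e3]
    ring
  have key2 : D = (gram (g y))⁻¹ * Q.transpose + Q * (gram (g y))⁻¹ := by
    have := congrArg (· * (gram (g y))⁻¹) key
    simp only [Matrix.mul_assoc, Matrix.mul_add, Matrix.add_mul] at this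
    rw [Matrix.mul_nonsing_inv _ hdet, Matrix.mul_one, Matrix.mul_one,
      ← Matrix.mul_assoc _ (gram (g y)), Matrix.nonsing_inv_mul _ hdet, Matrix.one_mul] at this
    exact this
  have := congrFun (congrFun key2 i) j
  rw [Matrix.add_apply, Matrix.mul_apply, Matrix.mul_apply, ← Finset.sum_add_distrib] at this
  exact this

/-- Contraction with the inverse metric commutes with the Lie derivative along a Killing field. -/
lemma fderiv_trace {g : E → E →L[ℝ] E →L[ℝ] ℝ} {ξ : E → E} {T : E → E →L[ℝ] E →L[ℝ] ℂ} {y : E}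
    (hg : ContDiffAt ℝ ∞ g y) (hnd : ∀ᶠ z in 𝓝 y, ∀ v, (∀ w, g z v w = 0) → v = 0)
    (h : ∀ v w, lieBilin g ξ y v w = 0) (hT : ContDiffAt ℝ ∞ T y) :
    fderiv ℝ (fun z ↦ trace (g z) (fun v w ↦ T z v w)) y (ξ y) =
      trace (g y) (fun v w ↦ fderiv ℝ (fun z ↦ T z v w) y (ξ y)
        + T y (fderiv ℝ ξ y v) w + T y v (fderiv ℝ ξ y w)) := by
  have hi := fun i j ↦ (contDiffAt_gram_inv hg hnd.self_of_nhds i j).hasFDerivAt_infty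
  have hic : ∀ i j, HasFDerivAt (fun z ↦ (((gram (g z))⁻¹ i j : ℝ) : ℂ)) _ y := fun i j ↦
    Complex.ofRealCLM.hasFDerivAt.comp y (hi i j)
  have hTij : ∀ i j, HasFDerivAt (fun z ↦ T z (finBasis ℝ E i) (finBasis ℝ E j))
      (fderiv ℝ (fun z ↦ T z (finBasis ℝ E i) (finBasis ℝ E j)) y) y := fun i j ↦
    ((hT.clm_apply contDiffAt_const).clm_apply contDiffAt_const).hasFDerivAt_infty
  have h1 : HasFDerivAt (fun z ↦ trace (g z) (fun v w ↦ T z v w)) _ y :=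
    HasFDerivAt.fun_sum fun i _ ↦ HasFDerivAt.fun_sum fun j _ ↦ (hic i j).mul (hTij i j)
  rw [h1.fderiv]
  simp only [FunLike.coe_sum, Finset.sum_apply, add_apply, smul_apply, smul_eq_mul,
    ContinuousLinearMap.comp_apply, Complex.ofRealCLM_apply, fderiv_gram_inv hg hnd h]
  have e1 : ∀ k j, T y (fderiv ℝ ξ y (finBasis ℝ E k)) (finBasis ℝ E j)
      = ∑ i, ((finBasis ℝ E).repr (fderiv ℝ ξ y (finBasis ℝ E k)) i : ℂ) * T y (finBasis ℝ E i) (finBasis ℝ E j) := by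
    intro k j
    have := congrArg (fun L ↦ L (finBasis ℝ E j))
      (apply_eq_sum (T y) (fderiv ℝ ξ y (finBasis ℝ E k)))
    simpa using this
  have e2 : ∀ i k, T y (finBasis ℝ E i) (fderiv ℝ ξ y (finBasis ℝ E k))
      = ∑ j, ((finBasis ℝ E).repr (fderiv ℝ ξ y (finBasis ℝ E k)) j : ℂ) * T y (finBasis ℝ E i) (finBasis ℝ E j) := by
    intro i k
    rw [apply_eq_sum (T y (finBasis ℝ E i))]
    simp
  -- Expanding `∂ξ` in the basis, the two terms from the derivative of the inverse metric become the
  -- two terms with `∂ξ` inserted into `T`, up to renaming summation indices.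
  simp only [trace, mul_add, Finset.sum_add_distrib, e1, e2, Finset.mul_sum,
    Complex.ofReal_sum, Complex.ofReal_mul, Complex.ofReal_add]
  rw [add_assoc]
  congr 1
  rw [add_comm]
  congr 1
  · have : ∀ f : Fin (finrank ℝ E) → Fin (finrank ℝ E) → Fin (finrank ℝ E) → ℂ,
        ∑ i, ∑ j, ∑ k, f i j k = ∑ k, ∑ j, ∑ i, f i j k := by
      intro f
      rw [Finset.sum_comm]
      rw [Finset.sum_congr rfl fun j _ ↦ Finset.sum_comm, Finset.sum_comm]
    rw [this]
    refine Finset.sum_congr rfl fun k _ ↦ Finset.sum_congr rfl fun j _ ↦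
      Finset.sum_congr rfl fun i _ ↦ ?_
    ring
  · refine Finset.sum_congr rfl fun i _ ↦ ?_
    rw [Finset.sum_comm]
    refine Finset.sum_congr rfl fun k _ ↦ Finset.sum_congr rfl fun j _ ↦ ?_
    ring

/-- The Klein-Gordon-Fock operator in coordinates. -/
def kgf (g : E → E →L[ℝ] E →L[ℝ] ℝ) (m : ℝ) (a : E → E →L[ℝ] ℂ) (φ : E → ℂ) (y : E) : ℂ :=
  trace (g y) (fun v w ↦ covDeriv g a (grad a φ) y v w) + (m : ℂ) ^ 2 * φ y

lemma contDiffAt_covDeriv {g : E → E →L[ℝ] E →L[ℝ] ℝ} {a α : E → E →L[ℝ] ℂ} {y : E}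
    (hg : ContDiffAt ℝ ∞ g y) (hnd : ∀ v, (∀ w, g y v w = 0) → v = 0)
    (ha : ContDiffAt ℝ ∞ a y) (hα : ContDiffAt ℝ ∞ α y) :
    ContDiffAt ℝ ∞ (covDeriv g a α) y := by
  refine contDiffAt_clm_of_apply fun v ↦ contDiffAt_clm_of_apply fun w ↦ ?_
  simp only [covDeriv_apply]
  exact (((hα.fderiv_infty.clm_apply contDiffAt_const).clm_apply contDiffAt_const).sub
    (hα.clm_apply (((contDiffAt_christoffel hg hnd).clm_apply contDiffAt_const).clm_apply
      contDiffAt_const))).sub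
    ((ha.clm_apply contDiffAt_const).mul (hα.clm_apply contDiffAt_const))

lemma contDiffAt_trace {g : E → E →L[ℝ] E →L[ℝ] ℝ} {T : E → E →L[ℝ] E →L[ℝ] ℂ} {y : E}
    (hg : ContDiffAt ℝ ∞ g y) (hnd : ∀ v, (∀ w, g y v w = 0) → v = 0)
    (hT : ContDiffAt ℝ ∞ T y) :
    ContDiffAt ℝ ∞ (fun z ↦ trace (g z) (fun v w ↦ T z v w)) y :=
  ContDiffAt.sum fun i _ ↦ ContDiffAt.sum fun j _ ↦
    (Complex.ofRealCLM.contDiff.contDiffAt.comp y (contDiffAt_gram_inv hg hnd i j)).mul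
      ((hT.clm_apply contDiffAt_const).clm_apply contDiffAt_const)

lemma contDiffAt_kgf {g : E → E →L[ℝ] E →L[ℝ] ℝ} {m : ℝ} {a : E → E →L[ℝ] ℂ} {φ : E → ℂ} {y : E}
    (hg : ContDiffAt ℝ ∞ g y) (hnd : ∀ v, (∀ w, g y v w = 0) → v = 0)
    (ha : ContDiffAt ℝ ∞ a y) (hφ : ContDiffAt ℝ ∞ φ y) : ContDiffAt ℝ ∞ (kgf g m a φ) y :=
  (contDiffAt_trace hg hnd (contDiffAt_covDeriv hg hnd ha (contDiffAt_grad ha hφ))).add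
    (contDiffAt_const.mul hφ)

/-- Locality: only the germ of `φ` at `y` matters. It allows the inner operator of a composition to
be replaced by an expression valid merely near `y`. -/
lemma kgf_congr {g : E → E →L[ℝ] E →L[ℝ] ℝ} {m : ℝ} {a : E → E →L[ℝ] ℂ} {φ ψ : E → ℂ} {y : E}
    (h : φ =ᶠ[𝓝 y] ψ) : kgf g m a φ y = kgf g m a ψ y := by
  have h1 : grad a φ =ᶠ[𝓝 y] grad a ψ := by
    filter_upwards [h.eventuallyEq_nhds] with z hz
    rw [grad, grad, hz.fderiv_eq, hz.eq_of_nhds]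
  simp only [kgf, covDeriv, h1.fderiv_eq, h1.eq_of_nhds, h.eq_of_nhds]

/-- In coordinates, the Klein-Gordon-Fock operator commutes with the symmetry operators. -/
theorem kgf_lieFun {g : E → E →L[ℝ] E →L[ℝ] ℝ} {m : ℝ} {ξ : E → E} {a : E → E →L[ℝ] ℂ}
    {b φ : E → ℂ} {y : E}
    (hg : ContDiffAt ℝ ∞ g y)
    (hsymm : ∀ᶠ z in 𝓝 y, ∀ v w, g z v w = g z w v)
    (hnd : ∀ᶠ z in 𝓝 y, ∀ v, (∀ w, g z v w = 0) → v = 0)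
    (h : ∀ᶠ z in 𝓝 y, ∀ v w, lieBilin g ξ z v w = 0)
    (hξ : ∀ᶠ z in 𝓝 y, ContDiffAt ℝ ∞ ξ z) (ha : ∀ᶠ z in 𝓝 y, ContDiffAt ℝ ∞ a z)
    (hb : ∀ᶠ z in 𝓝 y, ContDiffAt ℝ ∞ b z) (hφ : ∀ᶠ z in 𝓝 y, ContDiffAt ℝ ∞ φ z)
    (hab : ∀ᶠ z in 𝓝 y, IsGauge ξ a b z) :
    kgf g m a (lieFun ξ b φ) y = lieFun ξ b (kgf g m a φ) y := by
  -- The intertwining relation for the gradient is needed on a neighbourhood, since the covariant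
  -- derivative differentiates it again.
  have h1 : grad a (lieFun ξ b φ) =ᶠ[𝓝 y] lieCovector ξ b (grad a φ) := by
    filter_upwards [hξ, ha, hb, hφ, hab] with z h1 h2 h3 h4 h5 using grad_lieFun h1 h2 h3 h4 h5
  have ha0 := ha.self_of_nhds
  have hφ0 := hφ.self_of_nhds
  have hα := contDiffAt_grad ha0 hφ0
  have hT := contDiffAt_covDeriv hg hnd.self_of_nhds ha0 hα
  have h2 : ∀ v w, covDeriv g a (grad a (lieFun ξ b φ)) y v w
      = covDeriv g a (lieCovector ξ b (grad a φ)) y v w := by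
    intro v w
    simp only [covDeriv, h1.fderiv_eq, h1.eq_of_nhds]
  have h3 := (contDiffAt_trace hg hnd.self_of_nhds hT).hasFDerivAt_infty
  have h4 : HasFDerivAt (kgf g m a φ) _ y := h3.add (hφ0.hasFDerivAt_infty.const_mul ((m : ℂ) ^ 2))
  simp only [lieFun]
  rw [h4.fderiv]
  simp only [kgf, h2, covDeriv_lieCovector hg hsymm hnd h hξ.self_of_nhds ha0 hb.self_of_nhds hα
    hab.self_of_nhds, add_apply, fderiv_trace hg hnd h.self_of_nhds hT, lieFun, smul_apply,
    smul_eq_mul]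
  simp only [trace, mul_add, mul_sub, Finset.sum_sub_distrib, Finset.sum_add_distrib,
    Finset.mul_sum]
  have : ∀ i j, (((gram (g y))⁻¹ i j : ℝ) : ℂ) * (b y * covDeriv g a (grad a φ) y
      (finBasis ℝ E i) (finBasis ℝ E j)) = b y * ((((gram (g y))⁻¹ i j : ℝ) : ℂ) *
        covDeriv g a (grad a φ) y (finBasis ℝ E i) (finBasis ℝ E j)) := fun i j ↦ by ring
  simp only [this]
  ring

end KGF.Flat

/-! ### Charts: derivatives, vector fields and brackets in coordinates -/

namespace KGF

open Module Filter Flat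
open scoped Topology

variable {E : Type*} [NormedAddCommGroup E] [NormedSpace ℝ E]
  {M : Type*} [TopologicalSpace M] [ChartedSpace E M]

/-- The inverse of the distinguished chart at `p`. -/
def param (E : Type*) [NormedAddCommGroup E] [NormedSpace ℝ E]
    {M : Type*} [TopologicalSpace M] [ChartedSpace E M] (p : M) : E → M :=
  (extChartAt 𝓘(ℝ, E) p).symm

/-- The domain of the inverse of the distinguished chart at `p`. -/
def dom (E : Type*) [NormedAddCommGroup E] [NormedSpace ℝ E]
    {M : Type*} [TopologicalSpace M] [ChartedSpace E M] (p : M) : Set E :=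
  (extChartAt 𝓘(ℝ, E) p).target

/-- The derivative of the distinguished chart at `p`. -/
def chartDeriv (p x : M) : TangentSpace 𝓘(ℝ, E) x →L[ℝ] E :=
  mvfderiv 𝓘(ℝ, E) (extChartAt 𝓘(ℝ, E) p) x

/-- The derivative of the inverse of the distinguished chart at `p`. -/
def paramDeriv (p : M) (y : E) : E →L[ℝ] TangentSpace 𝓘(ℝ, E) (param E p y) :=
  mfderiv 𝓘(ℝ, E) 𝓘(ℝ, E) (param E p) y

lemma isOpen_dom (p : M) : IsOpen (dom E p) := isOpen_extChartAt_target p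

lemma dom_mem_nhds {p : M} {y : E} (hy : y ∈ dom E p) : dom E p ∈ 𝓝 y :=
  (isOpen_dom p).mem_nhds hy

lemma param_mem_source {p : M} {y : E} (hy : y ∈ dom E p) : param E p y ∈ (chartAt E p).source := by
  have := (extChartAt 𝓘(ℝ, E) p).map_target hy
  rwa [extChartAt_source] at this

lemma chart_param {p : M} {y : E} (hy : y ∈ dom E p) :
    extChartAt 𝓘(ℝ, E) p (param E p y) = y := (extChartAt 𝓘(ℝ, E) p).right_inv hy

lemma param_chart {p x : M} (hx : x ∈ (chartAt E p).source) :
    param E p (extChartAt 𝓘(ℝ, E) p x) = x :=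
  (extChartAt 𝓘(ℝ, E) p).left_inv (by rwa [extChartAt_source])

lemma chart_mem_dom {p x : M} (hx : x ∈ (chartAt E p).source) :
    extChartAt 𝓘(ℝ, E) p x ∈ dom E p :=
  (extChartAt 𝓘(ℝ, E) p).map_source (by rwa [extChartAt_source])

lemma self_mem_dom (p : M) : extChartAt 𝓘(ℝ, E) p p ∈ dom E p := mem_extChartAt_target p

lemma param_self (p : M) : param E p (extChartAt 𝓘(ℝ, E) p p) = p := extChartAt_to_inv p

variable [IsManifold 𝓘(ℝ, E) ∞ M]

lemma contMDiffAt_param {p : M} {y : E} (hy : y ∈ dom E p) :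
    ContMDiffAt 𝓘(ℝ, E) 𝓘(ℝ, E) ∞ (param E p) y :=
  (contMDiffOn_extChartAt_symm p).contMDiffAt (dom_mem_nhds hy)

lemma contMDiffAt_chart {p x : M} (hx : x ∈ (chartAt E p).source) :
    ContMDiffAt 𝓘(ℝ, E) 𝓘(ℝ, E) ∞ (extChartAt 𝓘(ℝ, E) p) x :=
  contMDiffAt_extChartAt' hx

lemma mdifferentiableAt_param {p : M} {y : E} (hy : y ∈ dom E p) :
    MDifferentiableAt 𝓘(ℝ, E) 𝓘(ℝ, E) (param E p) y :=
  (contMDiffAt_param hy).mdifferentiableAt (by simp)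

lemma continuousAt_param {p : M} {y : E} (hy : y ∈ dom E p) : ContinuousAt (param E p) y :=
  (contMDiffAt_param hy).continuousAt

lemma mdifferentiableAt_chart {p x : M} (hx : x ∈ (chartAt E p).source) :
    MDifferentiableAt 𝓘(ℝ, E) 𝓘(ℝ, E) (extChartAt 𝓘(ℝ, E) p) x :=
  (contMDiffAt_chart hx).mdifferentiableAt (by simp)

lemma chartDeriv_paramDeriv {p : M} {y : E} (hy : y ∈ dom E p) (v : E) :
    chartDeriv p (param E p y) (paramDeriv p y v) = v := by
  have h1 := mfderiv_comp y (mdifferentiableAt_chart (param_mem_source hy))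
    (mdifferentiableAt_param hy)
  have h2 : (extChartAt 𝓘(ℝ, E) p) ∘ (param E p) =ᶠ[𝓝 y] id := by
    filter_upwards [dom_mem_nhds hy] with z hz using chart_param hz
  rw [h2.mfderiv_eq] at h1
  have h3 := DFunLike.congr_fun h1 v
  rw [mfderiv_id] at h3
  exact h3.symm

lemma paramDeriv_chartDeriv {p : M} {y : E} (hy : y ∈ dom E p)
    (v : TangentSpace 𝓘(ℝ, E) (param E p y)) :
    paramDeriv p y (chartDeriv p (param E p y) v) = v := by
  have hx := param_mem_source hy
  have h1 := mfderiv_comp_of_eq (I := 𝓘(ℝ, E)) (I' := 𝓘(ℝ, E)) (I'' := 𝓘(ℝ, E))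
    (x := param E p y) (f := extChartAt 𝓘(ℝ, E) p) (g := param E p)
    (mdifferentiableAt_param hy) (mdifferentiableAt_chart hx) (chart_param hy)
  have h2 : (param E p) ∘ (extChartAt 𝓘(ℝ, E) p) =ᶠ[𝓝 (param E p y)] id := by
    filter_upwards [(chartAt E p).open_source.mem_nhds hx] with z hz using param_chart hz
  rw [h2.mfderiv_eq] at h1
  have h3 := DFunLike.congr_fun h1 v
  rw [mfderiv_id] at h3
  have h4 := chart_param hy
  rw [h4] at h3
  exact h3.symm

lemma mvfderiv_param {F : Type*} [NormedAddCommGroup F] [NormedSpace ℝ F] (f : M → F) {p : M}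
    {y : E} (hy : y ∈ dom E p) (v : TangentSpace 𝓘(ℝ, E) (param E p y)) :
    mvfderiv 𝓘(ℝ, E) f (param E p y) v
      = fderiv ℝ (f ∘ param E p) y (chartDeriv p (param E p y) v) := by
  have hx := param_mem_source hy
  by_cases hf : MDifferentiableAt 𝓘(ℝ, E) 𝓘(ℝ, F) f (param E p y)
  · have h1 := mfderiv_comp y hf (mdifferentiableAt_param hy)
    have h3 := DFunLike.congr_fun h1 (chartDeriv p (param E p y) v)
    rw [mfderiv_eq_fderiv] at h3
    refine Eq.trans ?_ h3.symm
    exact congrArg (mvfderiv 𝓘(ℝ, E) f (param E p y)) (paramDeriv_chartDeriv hy v).symm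
  -- Default values: `f` and its coordinate expression fail to be differentiable together, and then
  -- both derivatives are `0`. This is why no regularity of `f` is required.
  · have h1 : mvfderiv 𝓘(ℝ, E) f (param E p y) = 0 := by
      rw [mvfderiv, mfderiv_zero_of_not_mdifferentiableAt hf]
      exact ContinuousLinearMap.comp_zero _
    have h2 : ¬ DifferentiableAt ℝ (f ∘ param E p) y := by
      intro h
      apply hf
      have h3 := MDifferentiableAt.comp_of_eq (x := param E p y) (f := extChartAt 𝓘(ℝ, E) p)
        h.mdifferentiableAt (mdifferentiableAt_chart hx) (chart_param hy)
      refine h3.congr_of_eventuallyEq ?_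
      filter_upwards [(chartAt E p).open_source.mem_nhds hx] with z hz
      exact congrArg f (param_chart hz).symm
    rw [h1, fderiv_zero_of_not_differentiableAt h2]
    rfl

/-- The coordinate expression of a vector field. -/
def coordVec (p : M) (X : VField E M) (y : E) : E := chartDeriv p (param E p y) (X (param E p y))

/-- The coordinate expression of a field of covectors. -/
def coordCov (p : M) (A : Covector E M) (y : E) : E →L[ℝ] ℝ :=
  (A (param E p y)).comp (paramDeriv p y)

/-- The coordinate expression of a field of bilinear forms. -/
def coordBilin (p : M) (B : Bilin E M) (y : E) : E →L[ℝ] E →L[ℝ] ℝ :=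
  ContinuousLinearMap.bilinearComp (E := E) (F := E) (B (param E p y) : E →L[ℝ] E →L[ℝ] ℝ)
    (paramDeriv p y : E →L[ℝ] E) (paramDeriv p y : E →L[ℝ] E)

lemma coordCov_chartDeriv (A : Covector E M) {p : M} {y : E} (hy : y ∈ dom E p)
    (v : TangentSpace 𝓘(ℝ, E) (param E p y)) :
    coordCov p A y (chartDeriv p (param E p y) v) = A (param E p y) v := by
  simp only [coordCov, ContinuousLinearMap.comp_apply, paramDeriv_chartDeriv hy]

lemma coordBilin_chartDeriv (B : Bilin E M) {p : M} {y : E} (hy : y ∈ dom E p)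
    (v w : TangentSpace 𝓘(ℝ, E) (param E p y)) :
    coordBilin p B y (chartDeriv p (param E p y) v) (chartDeriv p (param E p y) w)
      = B (param E p y) v w := by
  change B (param E p y) (paramDeriv p y (chartDeriv p (param E p y) v))
    (paramDeriv p y (chartDeriv p (param E p y) w)) = _
  rw [paramDeriv_chartDeriv hy, paramDeriv_chartDeriv hy]

lemma isInvertible_mfderiv_param {p : M} {y : E} (hy : y ∈ dom E p) :
    (mfderiv 𝓘(ℝ, E) 𝓘(ℝ, E) (param E p) y).IsInvertible := by
  refine ContinuousLinearMap.IsInvertible.of_inverse (g := chartDeriv p (param E p y)) ?_ ?_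
  · ext v; exact paramDeriv_chartDeriv hy v
  · ext v; exact chartDeriv_paramDeriv hy v

lemma inverse_mfderiv_param {p : M} {y : E} (hy : y ∈ dom E p) :
    (mfderiv 𝓘(ℝ, E) 𝓘(ℝ, E) (param E p) y).inverse = chartDeriv p (param E p y) := by
  refine ContinuousLinearMap.inverse_eq ?_ ?_
  · ext v; exact paramDeriv_chartDeriv hy v
  · ext v; exact chartDeriv_paramDeriv hy v

lemma mpullback_param (X : VField E M) {p : M} {y : E} (hy : y ∈ dom E p) :
    VectorField.mpullback 𝓘(ℝ, E) 𝓘(ℝ, E) (param E p) X y = coordVec p X y := by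
  rw [VectorField.mpullback_apply, inverse_mfderiv_param hy]
  rfl

lemma mpullback_param_eventuallyEq (X : VField E M) {p : M} {y : E} (hy : y ∈ dom E p) :
    VectorField.mpullback 𝓘(ℝ, E) 𝓘(ℝ, E) (param E p) X =ᶠ[𝓝 y] coordVec p X := by
  filter_upwards [dom_mem_nhds hy] with z hz using mpullback_param X hz

lemma VField.DiffAt.coordVec [CompleteSpace E] {X : VField E M} {p : M} {y : E} (hy : y ∈ dom E p)
    (hX : X.DiffAt (param E p y)) : DifferentiableAt ℝ (coordVec p X) y := by
  have : IsManifold 𝓘(ℝ, E) 2 M := IsManifold.of_le two_le_infty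
  have h1 := MDifferentiableAt.mpullback_vectorField hX (contMDiffAt_param hy)
    (isInvertible_mfderiv_param hy) two_le_infty
  have h2 : DifferentiableAt ℝ
      (fun z ↦ (VectorField.mpullback 𝓘(ℝ, E) 𝓘(ℝ, E) (param E p) X z : E)) y :=
    MDifferentiableAt.differentiableAt <|
      ((contMDiff_snd_tangentBundle_modelSpace E 𝓘(ℝ, E) (n := 1)).contMDiffAt.mdifferentiableAt
        one_ne_zero).comp y h1
  exact h2.congr_of_eventuallyEq (mpullback_param_eventuallyEq X hy).symm

lemma mlieBracket_eq_fderiv (V W : E → E) (y : E) :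
    VectorField.mlieBracket 𝓘(ℝ, E) (M := E) V W y
      = fderiv ℝ W y (V y) - fderiv ℝ V y (W y) := by
  have h := congrFun (VectorField.mlieBracketWithin_eq_lieBracketWithin (𝕜 := ℝ) (V := V) (W := W)
    (s := Set.univ)) y
  have h1 := congrFun (VectorField.mlieBracketWithin_univ (I := 𝓘(ℝ, E)) (M := E)
    (V := V) (W := W)) y
  have h2 := congrFun (VectorField.lieBracketWithin_univ (𝕜 := ℝ) (V := V) (W := W)) y
  exact h1.symm.trans (h.trans h2)

/-- The bracket commutes with pullback along the inverse chart, and in a vector space it is the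
usual difference of directional derivatives. -/
lemma coordVec_mlieBracket [CompleteSpace E] {X Y : VField E M} {p : M} {y : E} (hy : y ∈ dom E p)
    (hX : X.DiffAt (param E p y)) (hY : Y.DiffAt (param E p y)) :
    chartDeriv p (param E p y) (VectorField.mlieBracket 𝓘(ℝ, E) X Y (param E p y)) =
      fderiv ℝ (coordVec p Y) y (coordVec p X y) - fderiv ℝ (coordVec p X) y (coordVec p Y y) := by
  have : IsManifold 𝓘(ℝ, E) (minSmoothness ℝ 2) M := by
    rw [minSmoothness_of_isRCLikeNormedField]; exact IsManifold.of_le two_le_infty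
  have : IsManifold 𝓘(ℝ, E) (minSmoothness ℝ 3) M := by
    rw [minSmoothness_of_isRCLikeNormedField]; infer_instance
  have h1 := VectorField.mpullback_mlieBracket hX hY (contMDiffAt_param hy)
    (by rw [minSmoothness_of_isRCLikeNormedField]; exact two_le_infty)
  rw [mpullback_param _ hy] at h1
  refine h1.trans ?_
  exact ((mpullback_param_eventuallyEq X hy).mlieBracket_vectorField_eq
    (mpullback_param_eventuallyEq Y hy)).trans (mlieBracket_eq_fderiv _ _ _)

end KGF

/-! ### Smoothness of sections read off in coordinates -/

namespace KGF

open Module Filter Flat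
open scoped Topology

variable {E : Type*} [NormedAddCommGroup E] [NormedSpace ℝ E]
  {M : Type*} [TopologicalSpace M] [ChartedSpace E M] [IsManifold 𝓘(ℝ, E) ∞ M]

lemma contDiffAt_congr {F F' : Type*} [NormedAddCommGroup F] [NormedSpace ℝ F]
    [NormedAddCommGroup F'] [NormedSpace ℝ F'] {f h : F → F'} {y : F} (e : f =ᶠ[𝓝 y] h) :
    ContDiffAt ℝ ∞ f y ↔ ContDiffAt ℝ ∞ h y :=
  ⟨fun k ↦ k.congr_of_eventuallyEq e.symm, fun k ↦ k.congr_of_eventuallyEq e⟩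

lemma contMDiffAt_param_iff {F : Type*} [NormedAddCommGroup F] [NormedSpace ℝ F] {f : M → F}
    {p : M} {y : E} (hy : y ∈ dom E p) :
    ContMDiffAt 𝓘(ℝ, E) 𝓘(ℝ, F) ∞ f (param E p y) ↔ ContDiffAt ℝ ∞ (f ∘ param E p) y := by
  rw [← contMDiffAt_iff_contDiffAt]
  refine ⟨fun h ↦ h.comp y (contMDiffAt_param hy), fun h ↦ ?_⟩
  have hx := param_mem_source hy
  have h3 := ContMDiffAt.comp_of_eq (x := param E p y) (f := extChartAt 𝓘(ℝ, E) p)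
    h (contMDiffAt_chart hx) (chart_param hy)
  refine h3.congr_of_eventuallyEq ?_
  filter_upwards [(chartAt E p).open_source.mem_nhds hx] with z hz
  exact congrArg f (param_chart hz).symm

/-- The tangent bundle is trivialized at `p` by the derivative of the chart. Hence the bundle notion
of smoothness becomes smoothness of `coordVec`, `coordCov` and `coordBilin`. -/
lemma symmL_trivializationAt_param {p : M} {y : E} (hy : y ∈ dom E p) :
    (trivializationAt E (TangentSpace 𝓘(ℝ, E)) p).symmL ℝ (param E p y) = paramDeriv p y := by
  rw [TangentBundle.symmL_trivializationAt (param_mem_source hy)]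
  simp only [mfderivWithin_univ, mfld_simps]
  have h := chart_param hy
  -- The base points `param z` and `param y` agree only propositionally, so the derivatives have
  -- different types and are first compared heterogeneously.
  have : ∀ z, z = y → HEq (mfderiv 𝓘(ℝ, E) 𝓘(ℝ, E) (param E p) z) (paramDeriv p y) := by
    rintro z rfl; rfl
  exact eq_of_heq (this _ h)

lemma inCoordinates_covector (A : Covector E M) {p : M} {y : E} (hy : y ∈ dom E p) :
    ContinuousLinearMap.inCoordinates E (TangentSpace 𝓘(ℝ, E)) ℝ (Bundle.Trivial M ℝ)
      p (param E p y) p (param E p y) (A (param E p y)) = coordCov p A y := by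
  rw [ContinuousLinearMap.inCoordinates, symmL_trivializationAt_param hy]
  ext v
  simp [coordCov]

lemma inCoordinates_bilin (B : Bilin E M) {p : M} {y : E} (hy : y ∈ dom E p) :
    ContinuousLinearMap.inCoordinates E (TangentSpace 𝓘(ℝ, E)) (E →L[ℝ] ℝ)
      (fun z : M ↦ TangentSpace 𝓘(ℝ, E) z →L[ℝ] Bundle.Trivial M ℝ z)
      p (param E p y) p (param E p y) (B (param E p y)) = coordBilin p B y := by
  have hx := param_mem_source hy
  have hxb : param E p y ∈ (trivializationAt E (TangentSpace 𝓘(ℝ, E)) p).baseSet := by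
    simpa using hx
  ext v w
  rw [inCoordinates_apply_eq₂ (by simpa using hx) (by simpa using hx) (by simp)]
  have h : ∀ v, (trivializationAt E (TangentSpace 𝓘(ℝ, E)) p).symm (param E p y) v
      = paramDeriv p y v := fun v ↦
    (Trivialization.symmL_apply _ hxb v).symm.trans
      (DFunLike.congr_fun (symmL_trivializationAt_param hy) v)
  have h1 : ∀ c : ℝ, (trivializationAt ℝ (Trivial M ℝ) p).linearMapAt ℝ (param E p y) c = c :=
    fun c ↦ by simp
  rw [h, h]
  exact h1 _

lemma contMDiffAt_covector_iff {A : Covector E M} {p : M} {y : E} (hy : y ∈ dom E p) :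
    ContMDiffAt 𝓘(ℝ, E) (𝓘(ℝ, E).prod 𝓘(ℝ, E →L[ℝ] ℝ)) ∞
      (fun y : M ↦ TotalSpace.mk' (E →L[ℝ] ℝ)
      (E := fun z : M ↦ TangentSpace 𝓘(ℝ, E) z →L[ℝ] Bundle.Trivial M ℝ z) y (A y))
      (param E p y) ↔ ContDiffAt ℝ ∞ (coordCov p A) y := by
  have hx := param_mem_source hy
  set e := trivializationAt (E →L[ℝ] ℝ)
    (fun z : M ↦ TangentSpace 𝓘(ℝ, E) z →L[ℝ] Bundle.Trivial M ℝ z) p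
  rw [e.contMDiffAt_section_iff (by simpa [e] using hx), contMDiffAt_param_iff hy]
  refine contDiffAt_congr ?_
  filter_upwards [dom_mem_nhds hy] with z hz
  exact inCoordinates_covector A hz

lemma Bilin.Smooth.coordBilin {B : Bilin E M} (hB : B.Smooth) {p : M} {y : E} (hy : y ∈ dom E p) :
    ContDiffAt ℝ ∞ (coordBilin p B) y := by
  have hx := param_mem_source hy
  set e := trivializationAt (E →L[ℝ] E →L[ℝ] ℝ)
    (fun z : M ↦ TangentSpace 𝓘(ℝ, E) z →L[ℝ] TangentSpace 𝓘(ℝ, E) z →L[ℝ]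
      Bundle.Trivial M ℝ z) p
  have h := hB.contMDiffAt (x := param E p y)
  rw [e.contMDiffAt_section_iff (by simpa [e] using hx), contMDiffAt_param_iff hy] at h
  refine h.congr_of_eventuallyEq ?_
  filter_upwards [dom_mem_nhds hy] with z hz
  exact (inCoordinates_bilin B hz).symm

lemma contMDiffAt_vectorField_iff {X : VField E M} {p : M} {y : E} (hy : y ∈ dom E p) :
    ContMDiffAt 𝓘(ℝ, E) (𝓘(ℝ, E).prod 𝓘(ℝ, E)) ∞
      (fun x : M ↦ TotalSpace.mk' E (E := fun z : M ↦ TangentSpace 𝓘(ℝ, E) z) x (X x))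
      (param E p y) ↔ ContDiffAt ℝ ∞ (coordVec p X) y := by
  set e := trivializationAt E (fun z : M ↦ TangentSpace 𝓘(ℝ, E) z) p
  have hx := param_mem_source hy
  have hb : ∀ x ∈ (chartAt E p).source, (e ⟨x, X x⟩).2 = chartDeriv p x (X x) := by
    intro x hx
    have h1 := TangentBundle.continuousLinearMapAt_trivializationAt (I := 𝓘(ℝ, E)) hx
    have h2 := DFunLike.congr_fun h1 (X x)
    rw [Trivialization.continuousLinearMapAt_apply, Trivialization.linearMapAt_apply,
      if_pos (by simpa using hx)] at h2
    exact h2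
  rw [e.contMDiffAt_section_iff (by simpa [e] using hx), contMDiffAt_param_iff hy]
  refine contDiffAt_congr ?_
  filter_upwards [dom_mem_nhds hy] with z hz
  exact hb _ (param_mem_source hz)

lemma VField.diffAt_of_coordVec {X : VField E M} {p : M} {y : E} (hy : y ∈ dom E p)
    (h : ContDiffAt ℝ ∞ (coordVec p X) y) : X.DiffAt (param E p y) :=
  ((contMDiffAt_vectorField_iff hy).2 h).mdifferentiableAt (by simp)

lemma extend_diffAt [FiniteDimensional ℝ E] {x : M} (v : TangentSpace 𝓘(ℝ, E) x) : (extend v : VField E M).DiffAt x :=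
  FiberBundle.mdifferentiableAt_extend 𝓘(ℝ, E) E v

lemma extend_self {x : M} (v : TangentSpace 𝓘(ℝ, E) x) : (extend v : VField E M) x = v :=
  FiberBundle.extend_apply_self ..

end KGF

/-! ### Exterior derivatives and the Levi-Civita connection in coordinates -/

namespace KGF

open Module Filter Flat
open scoped Topology

variable {E : Type*} [NormedAddCommGroup E] [NormedSpace ℝ E] [FiniteDimensional ℝ E]
  {M : Type*} [TopologicalSpace M] [ChartedSpace E M] [IsManifold 𝓘(ℝ, E) ∞ M]

lemma coordBilin_coordVec (B : Bilin E M) (Y Z : VField E M) {p : M} {y : E} (hy : y ∈ dom E p) :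
    coordBilin p B y (coordVec p Y y) (coordVec p Z y)
      = B (param E p y) (Y (param E p y)) (Z (param E p y)) := coordBilin_chartDeriv B hy _ _

lemma coordCov_coordVec (A : Covector E M) (Y : VField E M) {p : M} {y : E} (hy : y ∈ dom E p) :
    coordCov p A y (coordVec p Y y) = A (param E p y) (Y (param E p y)) :=
  coordCov_chartDeriv A hy _

lemma mvfderiv_bilin {B : Bilin E M} {Y Z : VField E M} {p : M} {y : E} (hy : y ∈ dom E p)
    (hB : ContDiffAt ℝ ∞ (coordBilin p B) y) (hY : DifferentiableAt ℝ (coordVec p Y) y)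
    (hZ : DifferentiableAt ℝ (coordVec p Z) y) (v : TangentSpace 𝓘(ℝ, E) (param E p y)) :
    mvfderiv 𝓘(ℝ, E) (fun x ↦ B x (Y x) (Z x)) (param E p y) v
      = fderiv ℝ (coordBilin p B) y (chartDeriv p (param E p y) v) (coordVec p Y y) (coordVec p Z y)
        + coordBilin p B y (fderiv ℝ (coordVec p Y) y (chartDeriv p (param E p y) v))
            (coordVec p Z y)
        + coordBilin p B y (coordVec p Y y)
            (fderiv ℝ (coordVec p Z) y (chartDeriv p (param E p y) v)) := by
  rw [mvfderiv_param _ hy]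
  have h1 : (fun x ↦ B x (Y x) (Z x)) ∘ param E p
      =ᶠ[𝓝 y] fun z ↦ coordBilin p B z (coordVec p Y z) (coordVec p Z z) := by
    filter_upwards [dom_mem_nhds hy] with z hz using (coordBilin_coordVec B Y Z hz).symm
  have h2 := (hB.hasFDerivAt_infty.clm_apply hY.hasFDerivAt).clm_apply hZ.hasFDerivAt
  rw [h1.fderiv_eq, h2.fderiv]
  simp only [add_apply, ContinuousLinearMap.comp_apply, ContinuousLinearMap.flip_apply]
  ring

lemma mvfderiv_cov {A : Covector E M} {Y : VField E M} {p : M} {y : E} (hy : y ∈ dom E p)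
    (hA : ContDiffAt ℝ ∞ (coordCov p A) y) (hY : DifferentiableAt ℝ (coordVec p Y) y)
    (v : TangentSpace 𝓘(ℝ, E) (param E p y)) :
    mvfderiv 𝓘(ℝ, E) (fun x ↦ A x (Y x)) (param E p y) v
      = fderiv ℝ (coordCov p A) y (chartDeriv p (param E p y) v) (coordVec p Y y)
        + coordCov p A y (fderiv ℝ (coordVec p Y) y (chartDeriv p (param E p y) v)) := by
  rw [mvfderiv_param _ hy]
  have h1 : (fun x ↦ A x (Y x)) ∘ param E p
      =ᶠ[𝓝 y] fun z ↦ coordCov p A z (coordVec p Y z) := by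
    filter_upwards [dom_mem_nhds hy] with z hz using (coordCov_coordVec A Y hz).symm
  have h2 := hA.hasFDerivAt_infty.clm_apply hY.hasFDerivAt
  rw [h1.fderiv_eq, h2.fderiv]
  simp only [add_apply, ContinuousLinearMap.comp_apply, ContinuousLinearMap.flip_apply]
  ring

/-- The derivatives of `X` and `Y` cancel against the bracket, so the expression is tensorial;
`extDerivTwo_param` is the same cancellation for 2-forms, where antisymmetry is used as well. -/
lemma extDerivOne_param {A : Covector E M} {X Y : VField E M} {p : M} {y : E} (hy : y ∈ dom E p)
    (hA : ContDiffAt ℝ ∞ (coordCov p A) y) (hX : X.DiffAt (param E p y))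
    (hY : Y.DiffAt (param E p y)) :
    extDerivOne A X Y (param E p y) = fderiv ℝ (coordCov p A) y (coordVec p X y) (coordVec p Y y)
      - fderiv ℝ (coordCov p A) y (coordVec p Y y) (coordVec p X y) := by
  rw [extDerivOne, mvfderiv_cov hy hA (hY.coordVec hy), mvfderiv_cov hy hA (hX.coordVec hy),
    ← coordCov_chartDeriv A hy (VectorField.mlieBracket 𝓘(ℝ, E) X Y (param E p y)),
    coordVec_mlieBracket hy hX hY, map_sub]
  simp only [coordVec]
  ring

lemma extDerivTwo_param {F : Bilin E M} {X Y Z : VField E M} {p : M} {y : E} (hy : y ∈ dom E p)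
    (hF : ContDiffAt ℝ ∞ (coordBilin p F) y) (hFa : ∀ v w, coordBilin p F y v w = -coordBilin p F y w v)
    (hX : X.DiffAt (param E p y)) (hY : Y.DiffAt (param E p y)) (hZ : Z.DiffAt (param E p y)) :
    extDerivTwo F X Y Z (param E p y)
      = fderiv ℝ (coordBilin p F) y (coordVec p X y) (coordVec p Y y) (coordVec p Z y)
      - fderiv ℝ (coordBilin p F) y (coordVec p Y y) (coordVec p X y) (coordVec p Z y)
      + fderiv ℝ (coordBilin p F) y (coordVec p Z y) (coordVec p X y) (coordVec p Y y) := by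
  have h := fun (X Y Z : VField E M) (hX : X.DiffAt (param E p y)) (hY : Y.DiffAt (param E p y)) ↦
    (coordBilin_chartDeriv F hy (VectorField.mlieBracket 𝓘(ℝ, E) X Y (param E p y))
      (Z (param E p y))).symm.trans (congrArg (fun v ↦ coordBilin p F y v
        (chartDeriv p (param E p y) (Z (param E p y)))) (coordVec_mlieBracket hy hX hY))
  rw [extDerivTwo, mvfderiv_bilin hy hF (hY.coordVec hy) (hZ.coordVec hy),
    mvfderiv_bilin hy hF (hX.coordVec hy) (hZ.coordVec hy),
    mvfderiv_bilin hy hF (hX.coordVec hy) (hY.coordVec hy), h X Y Z hX hY, h X Z Y hX hZ,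
    h Y Z X hY hZ]
  simp only [map_sub, sub_apply]
  rw [hFa (coordVec p Y y), hFa (coordVec p X y), hFa (coordVec p X y)]
  simp only [coordVec]
  ring

/-- The derivatives of `X` and `Z` cancel, while those of `Y` add up to `2g(∂_X Y, Z)`: the
connection is tensorial in the direction and a derivation in the differentiated field. -/
lemma koszul_param {g : Bilin E M} {X Y Z : VField E M} {p : M} {y : E} (hy : y ∈ dom E p)
    (hg : ContDiffAt ℝ ∞ (coordBilin p g) y) (hs : ∀ v w, coordBilin p g y v w = coordBilin p g y w v)
    (hX : X.DiffAt (param E p y)) (hY : Y.DiffAt (param E p y)) (hZ : Z.DiffAt (param E p y)) :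
    koszul g X Y Z (param E p y)
      = koszulOf (fderiv ℝ (coordBilin p g) y) (coordVec p X y) (coordVec p Y y) (coordVec p Z y)
      + 2 * coordBilin p g y (fderiv ℝ (coordVec p Y) y (coordVec p X y)) (coordVec p Z y) := by
  have h := fun (X Y Z : VField E M) (hX : X.DiffAt (param E p y)) (hY : Y.DiffAt (param E p y)) ↦
    (coordBilin_chartDeriv g hy (VectorField.mlieBracket 𝓘(ℝ, E) X Y (param E p y))
      (Z (param E p y))).symm.trans (congrArg (fun v ↦ coordBilin p g y v
        (chartDeriv p (param E p y) (Z (param E p y)))) (coordVec_mlieBracket hy hX hY))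
  rw [koszul, mvfderiv_bilin hy hg (hY.coordVec hy) (hZ.coordVec hy),
    mvfderiv_bilin hy hg (hX.coordVec hy) (hZ.coordVec hy),
    mvfderiv_bilin hy hg (hX.coordVec hy) (hY.coordVec hy), h X Y Z hX hY, h X Z Y hX hZ,
    h Y Z X hY hZ]
  simp only [map_sub, sub_apply]
  rw [hs (coordVec p Y y), hs (coordVec p X y), hs (coordVec p X y), koszulOf]
  simp only [coordVec]
  ring

/-! ### The metric in coordinates -/

lemma coordBilin_symm (g : PseudoRiemannianMetric E M) (p : M) (y v w : E) :
    coordBilin p g.val y v w = coordBilin p g.val y w v :=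
  g.symm (param E p y) (paramDeriv p y v) (paramDeriv p y w)

lemma coordBilin_nondegenerate (g : PseudoRiemannianMetric E M) {p : M} {y : E} (hy : y ∈ dom E p)
    (v : E) (h : ∀ w, coordBilin p g.val y v w = 0) : v = 0 := by
  have h1 : paramDeriv p y v = 0 := by
    refine g.nondegenerate _ _ fun w ↦ ?_
    rw [← coordBilin_chartDeriv g.val hy, chartDeriv_paramDeriv hy, h]
  rw [← chartDeriv_paramDeriv hy v, h1, map_zero]

lemma coordVec_extend {p : M} {y : E} (v : TangentSpace 𝓘(ℝ, E) (param E p y)) :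
    coordVec p (extend v) y = chartDeriv p (param E p y) v := by
  rw [coordVec, extend_self]

/-- `nabla` raises the index with the Gram matrix of the tangent space, `christoffel` with the one
in coordinates. Both vectors have the same metric pairing with every vector, by the Koszul
expression, so they coincide by nondegeneracy. -/
lemma nabla_param (g : PseudoRiemannianMetric E M) {Y : VField E M} {p : M} {y : E}
    (hy : y ∈ dom E p) (hY : Y.DiffAt (param E p y)) (v : TangentSpace 𝓘(ℝ, E) (param E p y)) :
    chartDeriv p (param E p y) (g.nabla Y (param E p y) v)
      = fderiv ℝ (coordVec p Y) y (chartDeriv p (param E p y) v)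
        + christoffel (coordBilin p g.val) y (chartDeriv p (param E p y) v) (coordVec p Y y) := by
  set Q : E →L[ℝ] E := chartDeriv p (param E p y) with hQ
  obtain ⟨vh, hvh⟩ : ∃ vh : E, chartDeriv p (param E p y) v = vh := ⟨_, rfl⟩
  rw [hvh]
  set u := fderiv ℝ (coordVec p Y) y vh + christoffel (coordBilin p g.val) y vh
    (coordVec p Y y) with hu
  set B : E →L[ℝ] E →L[ℝ] ℝ := g.val (param E p y) with hB
  have hBQ : ∀ v w : E, B v w = coordBilin p g.val y (Q v) (Q w) := fun v w ↦
    (coordBilin_chartDeriv g.val hy v w).symm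
  have hl : ∀ w : TangentSpace 𝓘(ℝ, E) (param E p y),
      koszul g.val (extend v) Y (extend w) (param E p y) / 2
        = coordBilin p g.val y u (chartDeriv p (param E p y) w) := by
    intro w
    rw [koszul_param hy (g.smooth.coordBilin hy) (coordBilin_symm g p y) (extend_diffAt v) hY
      (extend_diffAt _), coordVec_extend, coordVec_extend, hvh,
      hu, map_add, add_apply, inner_christoffel (coordBilin_nondegenerate g hy), koszulOf]
    ring
  have h1 := sum_inv_gram_smul (B := B) (fun v h ↦ g.nondegenerate _ v h)
    (((coordBilin p g.val y u).comp Q).toLinearMap)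
  have h2 : g.nabla Y (param E p y) v = ∑ i, ∑ j, ((gram B)⁻¹ i j *
      ((coordBilin p g.val y u).comp Q).toLinearMap (finBasis ℝ E i)) • finBasis ℝ E j :=
    Finset.sum_congr rfl fun i _ ↦ Finset.sum_congr rfl fun j _ ↦
      congrArg (fun t : ℝ ↦ ((gram B)⁻¹ i j * t) • finBasis ℝ E j)
        (hl (tangentBasis (param E p y) i))
  have h3 : ∀ w : E, coordBilin p g.val y (Q (g.nabla Y (param E p y) v) - u) w = 0 := by
    intro w
    have h5 : Q (paramDeriv p y w) = w := chartDeriv_paramDeriv hy w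
    have h4 : B (g.nabla Y (param E p y) v : E) (paramDeriv p y w : E)
        = coordBilin p g.val y u (Q (paramDeriv p y w)) :=
      (congrArg (fun t : E ↦ B t (paramDeriv p y w : E)) h2).trans (h1 (paramDeriv p y w))
    have h6 := (hBQ (g.nabla Y (param E p y) v) (paramDeriv p y w)).symm.trans h4
    simp only [h5] at h6
    rw [map_sub, sub_apply, h6, sub_self]
  exact sub_eq_zero.1 (coordBilin_nondegenerate g hy _ h3)

end KGF

/-! ### The operators in coordinates -/

namespace KGF

open Module Filter Flat
open scoped Topology

variable {E : Type*} [NormedAddCommGroup E] [NormedSpace ℝ E] [FiniteDimensional ℝ E]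
  {M : Type*} [TopologicalSpace M] [ChartedSpace E M] [IsManifold 𝓘(ℝ, E) ∞ M]

/-- The connection form `i ε A` in coordinates. -/
def connForm (ε : ℝ) (A : E → E →L[ℝ] ℝ) (y : E) : E →L[ℝ] ℂ :=
  (Complex.I * (ε : ℂ)) • Complex.ofRealCLM.comp (A y)

lemma connForm_apply (ε : ℝ) (A : E → E →L[ℝ] ℝ) (y v : E) :
    connForm ε A y v = Complex.I * (ε : ℂ) * (A y v : ℂ) := rfl

/-- The zeroth order term of the symmetry operator in coordinates. -/
def gaugeFun (ε : ℝ) (A : E → E →L[ℝ] ℝ) (ξ : E → E) (χ : E → ℝ) (y : E) : ℂ :=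
  Complex.I * (ε : ℂ) * ((A y (ξ y) - χ y : ℝ) : ℂ)

lemma contDiffAt_connForm {ε : ℝ} {A : E → E →L[ℝ] ℝ} {y : E} (hA : ContDiffAt ℝ ∞ A y) :
    ContDiffAt ℝ ∞ (connForm ε A) y := by
  refine contDiffAt_clm_of_apply fun v ↦ ?_
  exact contDiffAt_const.mul
    (Complex.ofRealCLM.contDiff.contDiffAt.comp y (hA.clm_apply contDiffAt_const))

lemma contDiffAt_gaugeFun {ε : ℝ} {A : E → E →L[ℝ] ℝ} {ξ : E → E} {χ : E → ℝ} {y : E}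
    (hA : ContDiffAt ℝ ∞ A y) (hξ : ContDiffAt ℝ ∞ ξ y) (hχ : ContDiffAt ℝ ∞ χ y) :
    ContDiffAt ℝ ∞ (gaugeFun ε A ξ χ) y :=
  contDiffAt_const.mul
    (Complex.ofRealCLM.contDiff.contDiffAt.comp y ((hA.clm_apply hξ).sub hχ))

/-- Cartan's formula: `L_ξ A = d(A(ξ)) + i_ξ dA = d(A(ξ)) + i_ξ F = d(A(ξ) - χ)`. This is the reason
for the term `iεχ` in the symmetry operator. -/
lemma isGauge_gaugeFun {ε : ℝ} {A : E → E →L[ℝ] ℝ} {ξ : E → E} {χ : E → ℝ}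
    {F : E → E →L[ℝ] E →L[ℝ] ℝ} {y : E}
    (hA : ContDiffAt ℝ ∞ A y) (hξ : ContDiffAt ℝ ∞ ξ y) (hχ : ContDiffAt ℝ ∞ χ y)
    (hF : ∀ v w, fderiv ℝ A y v w - fderiv ℝ A y w v = F y v w)
    (hm : ∀ v, fderiv ℝ χ y v = -F y (ξ y) v) :
    IsGauge ξ (connForm ε A) (gaugeFun ε A ξ χ) y := by
  intro v
  have h1 : HasFDerivAt (gaugeFun ε A ξ χ) _ y := ((Complex.ofRealCLM.hasFDerivAt.comp y
    ((hA.hasFDerivAt_infty.clm_apply hξ.hasFDerivAt_infty).sub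
      hχ.hasFDerivAt_infty)).const_mul (Complex.I * (ε : ℂ)))
  have h2 : HasFDerivAt (connForm ε A) _ y :=
    ((ContinuousLinearMap.compL ℝ E ℝ ℂ Complex.ofRealCLM).hasFDerivAt.comp y
      hA.hasFDerivAt_infty).const_smul (Complex.I * (ε : ℂ))
  rw [h1.fderiv, h2.fderiv, connForm_apply]
  have h3 := hF (ξ y) v
  have h4 := hm v
  have h5 : fderiv ℝ A y v (ξ y) - fderiv ℝ χ y v = fderiv ℝ A y (ξ y) v := by linarith
  simp only [FunLike.coe_smul, Pi.smul_apply, ContinuousLinearMap.comp_apply, add_apply, sub_apply,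
    ContinuousLinearMap.flip_apply, Complex.ofRealCLM_apply, ContinuousLinearMap.compL_apply,
    smul_eq_mul, ← h5]
  push_cast
  ring

lemma shiftedDeriv_param (ε : ℝ) (A : Covector E M) (φ : M → ℂ) {p : M} {y : E} (hy : y ∈ dom E p)
    (v : TangentSpace 𝓘(ℝ, E) (param E p y)) :
    shiftedDeriv ε A φ (param E p y) v
      = grad (connForm ε (coordCov p A)) (φ ∘ param E p) y (chartDeriv p (param E p y) v) := by
  rw [shiftedDeriv, mvfderiv_param _ hy, grad, sub_apply, smul_apply, connForm_apply,
    coordCov_chartDeriv A hy, smul_eq_mul, Function.comp_apply]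
  ring

lemma symOp_param (ε : ℝ) (A : Covector E M) (ξ : VField E M) (χ : M → ℝ) (φ : M → ℂ) {p : M}
    {y : E} (hy : y ∈ dom E p) :
    symOp ε A ξ χ φ (param E p y) = lieFun (coordVec p ξ)
      (gaugeFun ε (coordCov p A) (coordVec p ξ) (χ ∘ param E p)) (φ ∘ param E p) y := by
  rw [symOp, shiftedDeriv_param ε A φ hy, lieFun, grad, gaugeFun, sub_apply, smul_apply,
    connForm_apply]
  simp only [coordVec, Function.comp_apply, smul_eq_mul]
  push_cast
  ring

/-- The derivative of the field extending `w` occurs in `v(α(W))` and in `α(∇_v W)` and cancels,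
which leaves only the Christoffel term. -/
lemma shiftedDerivCovector_param (g : PseudoRiemannianMetric E M) (ε : ℝ) (A : Covector E M)
    (φ : M → ℂ) {p : M} {y : E} (hy : y ∈ dom E p) (hA : ContDiffAt ℝ ∞ (coordCov p A) y)
    (hφ : ContDiffAt ℝ ∞ (φ ∘ param E p) y) (v w : TangentSpace 𝓘(ℝ, E) (param E p y)) :
    shiftedDerivCovector g ε A (shiftedDeriv ε A φ) (param E p y) v w
      = covDeriv (coordBilin p g.val) (connForm ε (coordCov p A))
          (grad (connForm ε (coordCov p A)) (φ ∘ param E p)) y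
          (chartDeriv p (param E p y) v) (chartDeriv p (param E p y) w) := by
  set α := grad (connForm ε (coordCov p A)) (φ ∘ param E p) with hα
  have hαs : ContDiffAt ℝ ∞ α y := contDiffAt_grad (contDiffAt_connForm hA) hφ
  have hW := (extend_diffAt w).coordVec hy
  have h1 : (fun x ↦ shiftedDeriv ε A φ x ((extend w : VField E M) x)) ∘ param E p
      =ᶠ[𝓝 y] fun z ↦ α z (coordVec p (extend w) z) := by
    filter_upwards [dom_mem_nhds hy] with z hz using shiftedDeriv_param ε A φ hz _
  have h2 := hαs.hasFDerivAt_infty.clm_apply hW.hasFDerivAt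
  rw [shiftedDerivCovector, mvfderiv_param _ hy, h1.fderiv_eq, h2.fderiv,
    shiftedDeriv_param ε A φ hy, shiftedDeriv_param ε A φ hy, nabla_param g hy (extend_diffAt w),
    covDeriv_apply, connForm_apply, coordCov_chartDeriv A hy, coordVec_extend]
  simp only [add_apply, ContinuousLinearMap.comp_apply, ContinuousLinearMap.flip_apply, map_add]
  ring

/-- The derivative of the distinguished chart as a linear equivalence. -/
def chartEquiv {p : M} {y : E} (hy : y ∈ dom E p) : E ≃L[ℝ] E :=
  ContinuousLinearEquiv.equivOfInverse (M₁ := E) (M₂ := E) (chartDeriv p (param E p y) : E →L[ℝ] E)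
    (paramDeriv p y : E →L[ℝ] E) (paramDeriv_chartDeriv hy) (chartDeriv_paramDeriv hy)

/-- The two contractions use bases that differ by the derivative of the chart; `trace_comp` makes
the difference harmless. -/
lemma kgf_param (g : PseudoRiemannianMetric E M) (m ε : ℝ) (A : Covector E M)
    (φ : M → ℂ) {p : M} {y : E} (hy : y ∈ dom E p) (hA : ContDiffAt ℝ ∞ (coordCov p A) y)
    (hφ : ContDiffAt ℝ ∞ (φ ∘ param E p) y) :
    kgf g m ε A φ (param E p y) = Flat.kgf (coordBilin p g.val) m (connForm ε (coordCov p A))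
      (φ ∘ param E p) y := by
  set T := covDeriv (coordBilin p g.val) (connForm ε (coordCov p A))
    (grad (connForm ε (coordCov p A)) (φ ∘ param E p)) y with hT
  have h1 := trace_comp (coordBilin p g.val y)
    ((ContinuousLinearMap.coeLM ℝ).comp T.toLinearMap) (chartEquiv hy)
  have h2 : ContinuousLinearMap.bilinearComp (E := E) (F := E) (coordBilin p g.val y)
      (chartEquiv hy : E →L[ℝ] E) (chartEquiv hy : E →L[ℝ] E)
      = (g.val (param E p y) : E →L[ℝ] E →L[ℝ] ℝ) := by
    ext v w
    exact coordBilin_chartDeriv g.val hy v w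
  rw [h2] at h1
  refine congrArg (· + (m : ℂ) ^ 2 * φ (param E p y)) (Eq.trans ?_ h1)
  refine Finset.sum_congr rfl fun i _ ↦ Finset.sum_congr rfl fun j _ ↦ ?_
  exact congrArg (fun t : ℂ ↦ ((g.inv (param E p y) i j : ℝ) : ℂ) * t)
    (shiftedDerivCovector_param g ε A φ hy hA hφ _ _)

end KGF

/-! ### Infinitesimal consequences of invariance; brackets of related fields -/

namespace KGF.Flat

open Module Filter
open scoped Topology

variable {D E : Type*} [NormedAddCommGroup D] [NormedSpace ℝ D]
  [NormedAddCommGroup E] [NormedSpace ℝ E]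

/-- The velocity at parameter `c` in the direction `d` of a family of maps `E → E`. -/
def velocity (κ : D × E → E) (c d : D) (z : E) : E := fderiv ℝ κ (c, z) (d, 0)

lemma contDiffAt_velocity {κ : D × E → E} {c d : D} {y : E} (hκ : ContDiffAt ℝ ∞ κ (c, y)) :
    ContDiffAt ℝ ∞ (velocity κ c d) y :=
  (ContDiffAt.comp y (f := fun z : E ↦ (c, z)) hκ.fderiv_infty
    (contDiffAt_const.prodMk contDiffAt_id)).clm_apply contDiffAt_const

lemma fderiv_velocity {κ : D × E → E} {c : D} {y : E} (hκ : ContDiffAt ℝ ∞ κ (c, y)) (d : D)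
    (u : E) : fderiv ℝ (velocity κ c d) y u = fderiv ℝ (fderiv ℝ κ) (c, y) (0, u) (d, 0) := by
  have h : HasFDerivAt (velocity κ c d) _ y :=
    (HasFDerivAt.comp y (f := fun z : E ↦ (c, z)) hκ.fderiv_infty.hasFDerivAt_infty
      (hasFDerivAt_prodMk_right c y)).clm_apply (hasFDerivAt_const _ y)
  rw [h.fderiv]
  simp

/-- The maps `κ(s, ·)` preserve `B` at `y` and are the identity at `s = c`. Differentiating in `s`
gives the Lie derivative, because symmetry of mixed derivatives turns the variation of the Jacobian
into the Jacobian of the velocity. -/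
lemma lieBilin_velocity {κ : D × E → E} {c : D} {y : E} (hκ : ContDiffAt ℝ ∞ κ (c, y))
    (h0 : ∀ᶠ z in 𝓝 y, κ (c, z) = z) {B : E → E →L[ℝ] E →L[ℝ] ℝ} (hB : ContDiffAt ℝ ∞ B y)
    (h : ∀ᶠ s in 𝓝 c, ∀ u w, B (κ (s, y)) (fderiv ℝ κ (s, y) (0, u)) (fderiv ℝ κ (s, y) (0, w))
      = B y u w) (d : D) (u w : E) :
    lieBilin B (velocity κ c d) y u w = 0 := by
  have hid : ∀ u, fderiv ℝ κ (c, y) (0, u) = u := by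
    intro u
    have h1 : HasFDerivAt (fun z : E ↦ κ (c, z)) _ y :=
      HasFDerivAt.comp y (f := fun z : E ↦ (c, z)) hκ.hasFDerivAt_infty
        (hasFDerivAt_prodMk_right c y)
    have h2 := h1.unique ((hasFDerivAt_id y).congr_of_eventuallyEq h0)
    exact DFunLike.congr_fun h2 u
  have hy := h0.self_of_nhds
  have h1 : HasFDerivAt (fun s : D ↦ κ (s, y)) _ c :=
    HasFDerivAt.comp c (f := fun s : D ↦ (s, y)) hκ.hasFDerivAt_infty
      (hasFDerivAt_prodMk_left c y)
  have h2 : ∀ u, HasFDerivAt (fun s : D ↦ fderiv ℝ κ (s, y) (0, u)) _ c := fun u ↦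
    (HasFDerivAt.comp c (f := fun s : D ↦ (s, y)) hκ.fderiv_infty.hasFDerivAt_infty
      (hasFDerivAt_prodMk_left c y)).clm_apply (hasFDerivAt_const _ c)
  have h3 : HasFDerivAt (fun s : D ↦ B (κ (s, y))) _ c :=
    HasFDerivAt.comp c (f := fun s : D ↦ κ (s, y)) (hy.symm ▸ hB.hasFDerivAt_infty) h1
  have h4 := (h3.clm_apply (h2 u)).clm_apply (h2 w)
  have h5 := h4.unique ((hasFDerivAt_const (B y u w) c).congr_of_eventuallyEq
    (h.mono fun s hs ↦ hs u w))
  have h6 := DFunLike.congr_fun h5 d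
  simp only [add_apply, ContinuousLinearMap.comp_apply, ContinuousLinearMap.flip_apply, hid,
    ContinuousLinearMap.inl_apply, zero_apply, hy, map_zero, zero_add] at h6
  rw [lieBilin, fderiv_velocity hκ, fderiv_velocity hκ, hκ.fderiv_fderiv_symm,
    hκ.fderiv_fderiv_symm (0, w), velocity]
  linarith

/-- Differentiating the relation for one field along the other produces the second derivative of
`f`, which is symmetric and drops out of the bracket. -/
lemma fderiv_bracket_of_related {f : D → E} {c : D} (hf : ContDiffAt ℝ ∞ f c) {V W : D → D}
    {V' W' : E → E} (hV : DifferentiableAt ℝ V c) (hW : DifferentiableAt ℝ W c)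
    (hV' : DifferentiableAt ℝ V' (f c)) (hW' : DifferentiableAt ℝ W' (f c))
    (h1 : ∀ᶠ z in 𝓝 c, fderiv ℝ f z (V z) = V' (f z))
    (h2 : ∀ᶠ z in 𝓝 c, fderiv ℝ f z (W z) = W' (f z)) :
    fderiv ℝ f c (fderiv ℝ W c (V c) - fderiv ℝ V c (W c))
      = fderiv ℝ W' (f c) (V' (f c)) - fderiv ℝ V' (f c) (W' (f c)) := by
  have key : ∀ {V : D → D} {V' : E → E}, DifferentiableAt ℝ V c → DifferentiableAt ℝ V' (f c) →
      (∀ᶠ z in 𝓝 c, fderiv ℝ f z (V z) = V' (f z)) → ∀ u, fderiv ℝ (fderiv ℝ f) c u (V c)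
        + fderiv ℝ f c (fderiv ℝ V c u) = fderiv ℝ V' (f c) (fderiv ℝ f c u) := by
    intro V V' hV hV' h u
    have h3 := hf.fderiv_infty.hasFDerivAt_infty.clm_apply hV.hasFDerivAt
    have h4 := hV'.hasFDerivAt.comp c hf.hasFDerivAt_infty
    have h5 := DFunLike.congr_fun (h3.unique (h4.congr_of_eventuallyEq h)) u
    simpa [add_comm] using h5
  have h3 := key hV hV' h1 (W c)
  have h4 := key hW hW' h2 (V c)
  rw [h2.self_of_nhds] at h3
  rw [h1.self_of_nhds] at h4
  rw [map_sub, ← h3, ← h4, hf.fderiv_fderiv_symm (V c)]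
  abel

end KGF.Flat

/-! ### Generators of the group action -/

namespace KGF

open Module Filter Flat
open scoped Topology

section

variable {E : Type*} [NormedAddCommGroup E] [NormedSpace ℝ E]
  {M : Type*} [TopologicalSpace M] [ChartedSpace E M] [IsManifold 𝓘(ℝ, E) ∞ M]

lemma exists_eq_param {p x : M} (hx : x ∈ (chartAt E p).source) :
    ∃ y ∈ dom E p, param E p y = x := ⟨_, chart_mem_dom hx, param_chart hx⟩

lemma mvfderiv_chart {F : Type*} [NormedAddCommGroup F] [NormedSpace ℝ F] (f : M → F) {p x : M}
    (hx : x ∈ (chartAt E p).source) (v : TangentSpace 𝓘(ℝ, E) x) :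
    mvfderiv 𝓘(ℝ, E) f x v
      = fderiv ℝ (f ∘ param E p) (extChartAt 𝓘(ℝ, E) p x) (chartDeriv p x v) := by
  obtain ⟨y, hy, rfl⟩ := exists_eq_param hx
  rw [mvfderiv_param f hy, chart_param hy]

lemma chartDeriv_congr {p x x' : M} (h : x = x') (u : E) :
    (chartDeriv p x : E →L[ℝ] E) u = (chartDeriv p x' : E →L[ℝ] E) u := by
  subst h; rfl

end

variable {E : Type*} [NormedAddCommGroup E] [NormedSpace ℝ E]
  {M : Type*} [TopologicalSpace M] [ChartedSpace E M] [IsManifold 𝓘(ℝ, E) ∞ M]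
  {EG : Type*} [NormedAddCommGroup EG] [NormedSpace ℝ EG]
  {G : Type*} [TopologicalSpace G] [ChartedSpace EG G] [Group G] [LieGroup 𝓘(ℝ, EG) ∞ G]
  [MulAction G M]

/-- The action `x ↦ h⁻¹ • x` in coordinates, near the identity. -/
def actionMap (G : Type*) [TopologicalSpace G] [ChartedSpace EG G] [Group G] [MulAction G M]
    (p : M) (q : EG × E) : E :=
  extChartAt 𝓘(ℝ, E) p ((param EG (1 : G) q.1)⁻¹ • param E p q.2)

lemma contDiffAt_actionMap
    (hsmooth : ContMDiff (𝓘(ℝ, EG).prod 𝓘(ℝ, E)) 𝓘(ℝ, E) ∞ (fun p : G × M ↦ p.1 • p.2))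
    {p : M} {s : EG} {y : E} (hs : s ∈ dom EG (1 : G)) (hy : y ∈ dom E p)
    (h : (param EG (1 : G) s)⁻¹ • param E p y ∈ (chartAt E p).source) :
    ContDiffAt ℝ ∞ (actionMap (EG := EG) (E := E) G p) (s, y) := by
  have h1 : ContMDiffAt 𝓘(ℝ, EG × E) 𝓘(ℝ, EG) ∞ (fun q : EG × E ↦ (param EG (1 : G) q.1)⁻¹)
      (s, y) :=
    (ContMDiffAt.comp (s, y) (contMDiffAt_param hs) contDiff_fst.contMDiff.contMDiffAt).inv
  have h2 : ContMDiffAt 𝓘(ℝ, EG × E) 𝓘(ℝ, E) ∞ (fun q : EG × E ↦ param E p q.2) (s, y) :=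
    ContMDiffAt.comp (s, y) (contMDiffAt_param hy) contDiff_snd.contMDiff.contMDiffAt
  have h3 := ContMDiffAt.comp (s, y) hsmooth.contMDiffAt (h1.prodMk h2)
  exact (ContMDiffAt.comp (s, y) (contMDiffAt_chart h) h3).contDiffAt

/-- The coordinates of the identity. -/
abbrev idCoord (EG : Type*) [NormedAddCommGroup EG] [NormedSpace ℝ EG]
    (G : Type*) [TopologicalSpace G] [ChartedSpace EG G] [Group G] : EG :=
  extChartAt 𝓘(ℝ, EG) (1 : G) 1

lemma actionMap_one {p : M} {y : E} (hy : y ∈ dom E p) :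
    actionMap G p (idCoord EG G, y) = y := by
  rw [actionMap, param_self, inv_one, one_smul, chart_param hy]

lemma contDiffAt_actionMap_one
    (hsmooth : ContMDiff (𝓘(ℝ, EG).prod 𝓘(ℝ, E)) 𝓘(ℝ, E) ∞ (fun p : G × M ↦ p.1 • p.2))
    {p : M} {y : E} (hy : y ∈ dom E p) :
    ContDiffAt ℝ ∞ (actionMap (EG := EG) (E := E) G p) (idCoord EG G, y) :=
  contDiffAt_actionMap hsmooth (self_mem_dom _) hy
    (by simpa [param_self] using param_mem_source hy)

/-- The orbit map `h ↦ h⁻¹ • x`. -/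
def orbitMap (G : Type*) [Group G] [MulAction G M] (x : M) (h : G) : M := h⁻¹ • x

lemma contMDiff_orbitMap
    (hsmooth : ContMDiff (𝓘(ℝ, EG).prod 𝓘(ℝ, E)) 𝓘(ℝ, E) ∞ (fun p : G × M ↦ p.1 • p.2)) (x : M) :
    ContMDiff 𝓘(ℝ, EG) 𝓘(ℝ, E) ∞ (orbitMap G x) :=
  hsmooth.comp ((contMDiff_inv 𝓘(ℝ, EG) ∞).prodMk contMDiff_const)

lemma contMDiff_smul_const
    (hsmooth : ContMDiff (𝓘(ℝ, EG).prod 𝓘(ℝ, E)) 𝓘(ℝ, E) ∞ (fun p : G × M ↦ p.1 • p.2)) (h : G) :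
    ContMDiff 𝓘(ℝ, E) 𝓘(ℝ, E) ∞ (fun x : M ↦ h • x) :=
  hsmooth.comp (contMDiff_const.prodMk contMDiff_id)

/-- In the charts at `1` and `p` the orbit map is `s ↦ actionMap G p (s, y)`. This form shows that
the generator depends smoothly on the point. -/
lemma coordVec_generator
    (hsmooth : ContMDiff (𝓘(ℝ, EG).prod 𝓘(ℝ, E)) 𝓘(ℝ, E) ∞ (fun p : G × M ↦ p.1 • p.2))
    (v : GroupLieAlgebra 𝓘(ℝ, EG) G) {p : M} {y : E} (hy : y ∈ dom E p) :
    coordVec p (generator v) y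
      = velocity (actionMap G p) (idCoord EG G) (chartDeriv (1 : G) 1 v) y := by
  set x := param E p y with hx
  -- The derivative defining the generator takes values in the tangent space at `1⁻¹ • x`;
  -- `chartDeriv_congr` moves it to `x`.
  have h1x : (1 : G)⁻¹ • x = x := by simp
  have h1 : mvfderiv 𝓘(ℝ, EG) (extChartAt 𝓘(ℝ, E) p ∘ orbitMap G x) (1 : G) v
      = (chartDeriv p ((1 : G)⁻¹ • x) : E →L[ℝ] E) (generator v x) := by
    have h2 := mfderiv_comp (I := 𝓘(ℝ, EG)) (I' := 𝓘(ℝ, E)) (I'' := 𝓘(ℝ, E)) (1 : G)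
      (f := orbitMap G x) (g := extChartAt 𝓘(ℝ, E) p)
      (mdifferentiableAt_chart (by rw [orbitMap, h1x]; exact param_mem_source hy))
      ((contMDiff_orbitMap hsmooth x).mdifferentiableAt (by simp))
    exact DFunLike.congr_fun h2 v
  have h2 : (chartDeriv p ((1 : G)⁻¹ • x) : E →L[ℝ] E) (generator v x) = coordVec p (generator v) y :=
    chartDeriv_congr h1x _
  rw [h2, mvfderiv_chart (p := (1 : G)) _ (mem_chart_source EG (1 : G))] at h1
  rw [← h1]
  have h3 : HasFDerivAt (fun s : EG ↦ actionMap G p (s, y)) _ (idCoord EG G) :=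
    HasFDerivAt.comp (idCoord EG G) (f := fun s : EG ↦ (s, y))
      (contDiffAt_actionMap_one hsmooth hy).hasFDerivAt_infty
      (hasFDerivAt_prodMk_left (idCoord EG G) y)
  exact DFunLike.congr_fun h3.fderiv _

lemma contDiffAt_coordVec_generator
    (hsmooth : ContMDiff (𝓘(ℝ, EG).prod 𝓘(ℝ, E)) 𝓘(ℝ, E) ∞ (fun p : G × M ↦ p.1 • p.2))
    (v : GroupLieAlgebra 𝓘(ℝ, EG) G) {p : M} {y : E} (hy : y ∈ dom E p) :
    ContDiffAt ℝ ∞ (coordVec p (generator v)) y := by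
  refine (contDiffAt_velocity (d := chartDeriv (1 : G) 1 v)
    (contDiffAt_actionMap_one hsmooth hy)).congr_of_eventuallyEq ?_
  filter_upwards [dom_mem_nhds hy] with z hz using coordVec_generator hsmooth v hz

lemma generator_diffAt
    (hsmooth : ContMDiff (𝓘(ℝ, EG).prod 𝓘(ℝ, E)) 𝓘(ℝ, E) ∞ (fun p : G × M ↦ p.1 • p.2))
    (v : GroupLieAlgebra 𝓘(ℝ, EG) G) (x : M) : (generator v : VField E M).DiffAt x := by
  have h := VField.diffAt_of_coordVec (self_mem_dom x)
    (contDiffAt_coordVec_generator hsmooth v (self_mem_dom x))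
  rwa [param_self] at h

/-- Near the identity, the coordinate map at parameter `s` is the action of a group element, so
invariance under `G` is the hypothesis of `lieBilin_velocity`. The lemma serves both `g` (Killing
equation) and `F`. -/
lemma lieBilin_generator
    (hsmooth : ContMDiff (𝓘(ℝ, EG).prod 𝓘(ℝ, E)) 𝓘(ℝ, E) ∞ (fun p : G × M ↦ p.1 • p.2))
    {B : Bilin E M} (hB : B.Smooth) (hinv : ∀ h : G, B.InvariantUnder (fun x : M ↦ h • x))
    (v : GroupLieAlgebra 𝓘(ℝ, EG) G) {p : M} {y : E} (hy : y ∈ dom E p) (u w : E) :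
    lieBilin (coordBilin p B) (coordVec p (generator v)) y u w = 0 := by
  have hκ := contDiffAt_actionMap_one hsmooth hy
  have he : coordVec p (generator v) =ᶠ[𝓝 y]
      velocity (actionMap G p) (idCoord EG G) (chartDeriv (1 : G) 1 v) := by
    filter_upwards [dom_mem_nhds hy] with z hz using coordVec_generator hsmooth v hz
  rw [lieBilin, he.eq_of_nhds, he.fderiv_eq]
  refine lieBilin_velocity hκ ?_ (hB.coordBilin hy) ?_ _ u w
  · filter_upwards [dom_mem_nhds hy] with z hz using actionMap_one hz
  have hsrc : ∀ᶠ s in 𝓝 (idCoord EG G),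
      (param EG (1 : G) s)⁻¹ • param E p y ∈ (chartAt E p).source := by
    have h1 : ContinuousAt (fun s ↦ orbitMap G (param E p y) (param EG (1 : G) s))
        (idCoord EG G) :=
      ContinuousAt.comp (contMDiff_orbitMap hsmooth (param E p y)).continuous.continuousAt
        (continuousAt_param (self_mem_dom _))
    refine h1.eventually_mem ((chartAt E p).open_source.mem_nhds ?_)
    simpa [orbitMap, param_self] using param_mem_source hy
  filter_upwards [dom_mem_nhds (self_mem_dom (1 : G)), hsrc] with s hs hsrc u w
  set h := (param EG (1 : G) s)⁻¹ with hh
  set x := param E p y with hx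
  have hd : ∀ u : E, fderiv ℝ (actionMap G p) (s, y) (0, u)
      = chartDeriv p (h • x) (mfderiv 𝓘(ℝ, E) 𝓘(ℝ, E) (fun x : M ↦ h • x) x
          (paramDeriv p y u)) := by
    intro u
    have h3 : HasFDerivAt (fun z : E ↦ actionMap G p (s, z)) _ y :=
      HasFDerivAt.comp y (f := fun z : E ↦ (s, z))
        (contDiffAt_actionMap hsmooth hs hy hsrc).hasFDerivAt_infty
        (hasFDerivAt_prodMk_right s y)
    have h4 := mvfderiv_param (extChartAt 𝓘(ℝ, E) p ∘ (fun x : M ↦ h • x)) hy (paramDeriv p y u)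
    rw [chartDeriv_paramDeriv hy] at h4
    have h5 := mfderiv_comp (I := 𝓘(ℝ, E)) (I' := 𝓘(ℝ, E)) (I'' := 𝓘(ℝ, E)) x
      (f := fun x : M ↦ h • x) (g := extChartAt 𝓘(ℝ, E) p) (mdifferentiableAt_chart hsrc)
      ((contMDiff_smul_const hsmooth h).mdifferentiableAt (by simp))
    exact (DFunLike.congr_fun h3.fderiv u).symm.trans
      (h4.symm.trans (DFunLike.congr_fun h5 (paramDeriv p y u)))
  obtain ⟨z, hz, hzx⟩ := exists_eq_param hsrc
  have hz' : actionMap G p (s, y) = z := by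
    rw [actionMap, ← hx, ← hh, ← hzx, chart_param hz]
  have key : ∀ (x' : M) (hx' : param E p z = x') (a b : TangentSpace 𝓘(ℝ, E) x'),
      coordBilin p B z (chartDeriv p x' a) (chartDeriv p x' b) = B x' a b := by
    rintro _ rfl a b
    exact coordBilin_chartDeriv B hz a b
  rw [hz', hd, hd, key _ hzx]
  exact hinv h x _ _

lemma generator_add (v w : GroupLieAlgebra 𝓘(ℝ, EG) G) (x : M) :
    (generator (v + w) : VField E M) x = generator v x + generator w x :=
  map_add (mfderiv 𝓘(ℝ, EG) 𝓘(ℝ, E) (fun h : G ↦ h⁻¹ • x) 1) v w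

lemma generator_smul (c : ℝ) (v : GroupLieAlgebra 𝓘(ℝ, EG) G) (x : M) :
    (generator (c • v) : VField E M) x = c • generator v x :=
  map_smul (mfderiv 𝓘(ℝ, EG) 𝓘(ℝ, E) (fun h : G ↦ h⁻¹ • x) 1) c v

/-- From `(hk)⁻¹ • x = k⁻¹ • (h⁻¹ • x)`: the orbit map relates left-invariant fields to generators.
The inverse in the definition of the generator is what makes the brackets agree without a sign. -/
lemma mfderiv_orbitMap
    (hsmooth : ContMDiff (𝓘(ℝ, EG).prod 𝓘(ℝ, E)) 𝓘(ℝ, E) ∞ (fun p : G × M ↦ p.1 • p.2))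
    (v : GroupLieAlgebra 𝓘(ℝ, EG) G) (x : M) (h : G) :
    mfderiv 𝓘(ℝ, EG) 𝓘(ℝ, E) (orbitMap G x) h (mulInvariantVectorField v h)
      = generator v (orbitMap G x h) := by
  have h1 : orbitMap G x ∘ (fun k : G ↦ h * k) = fun k : G ↦ k⁻¹ • (orbitMap G x h) := by
    funext k
    simp [orbitMap, mul_smul]
  have h2 := mfderiv_comp_of_eq (I := 𝓘(ℝ, EG)) (I' := 𝓘(ℝ, EG)) (I'' := 𝓘(ℝ, E)) (x := (1 : G))
    (f := fun k : G ↦ h * k) (g := orbitMap G x) (y := h)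
    ((contMDiff_orbitMap hsmooth x).mdifferentiableAt (by simp))
    ((contMDiff_mul_left (I := 𝓘(ℝ, EG)) (n := ∞) (a := h)).mdifferentiableAt (by simp))
    (mul_one h)
  rw [h1] at h2
  have h3 : ∀ k, k = h → ∀ u : EG, (mfderiv 𝓘(ℝ, EG) 𝓘(ℝ, E) (orbitMap G x) k u : E)
      = (mfderiv 𝓘(ℝ, EG) 𝓘(ℝ, E) (orbitMap G x) h : EG → E) u := by
    rintro _ rfl u; rfl
  exact (h3 _ (mul_one h) _).symm.trans (DFunLike.congr_fun h2 v).symm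

lemma fderiv_orbitMap_coord
    (hsmooth : ContMDiff (𝓘(ℝ, EG).prod 𝓘(ℝ, E)) 𝓘(ℝ, E) ∞ (fun p : G × M ↦ p.1 • p.2))
    (v : GroupLieAlgebra 𝓘(ℝ, EG) G) {p x : M} {z : EG} (hz : z ∈ dom EG (1 : G))
    (hs : orbitMap G x (param EG (1 : G) z) ∈ (chartAt E p).source) :
    fderiv ℝ (fun s ↦ extChartAt 𝓘(ℝ, E) p (orbitMap G x (param EG (1 : G) s))) z
        (coordVec (1 : G) (mulInvariantVectorField v) z)
      = coordVec p (generator v) (extChartAt 𝓘(ℝ, E) p (orbitMap G x (param EG (1 : G) z))) := by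
  set h := param EG (1 : G) z with hh
  have h1 := mvfderiv_param (extChartAt 𝓘(ℝ, E) p ∘ orbitMap G x) hz (mulInvariantVectorField v h)
  refine h1.symm.trans ?_
  have h2 := mfderiv_comp (I := 𝓘(ℝ, EG)) (I' := 𝓘(ℝ, E)) (I'' := 𝓘(ℝ, E)) h
    (f := orbitMap G x) (g := extChartAt 𝓘(ℝ, E) p) (mdifferentiableAt_chart hs)
    ((contMDiff_orbitMap hsmooth x).mdifferentiableAt (by simp))
  refine (DFunLike.congr_fun h2 (mulInvariantVectorField v h)).trans ?_
  have h3 := congrArg (fun u ↦ (chartDeriv p (orbitMap G x h) : E →L[ℝ] E) u)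
    (mfderiv_orbitMap hsmooth v x h)
  refine h3.trans ?_
  obtain ⟨y, hy, hyx⟩ := exists_eq_param hs
  rw [← hyx, chart_param hy]
  rfl

lemma differentiableAt_coordVec_mulInvariantVectorField [CompleteSpace EG]
    (v : GroupLieAlgebra 𝓘(ℝ, EG) G) :
    DifferentiableAt ℝ (coordVec (1 : G) (mulInvariantVectorField v)) (idCoord EG G) := by
  have h : VField.DiffAt (mulInvariantVectorField v) (1 : G) :=
    mdifferentiableAt_mulInvariantVectorField v
  refine VField.DiffAt.coordVec (self_mem_dom _) ?_
  rwa [param_self]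

lemma chartDeriv_mlieBracket [CompleteSpace E] {X Y : VField E M} {p x : M}
    (hx : x ∈ (chartAt E p).source) (hX : X.DiffAt x) (hY : Y.DiffAt x) :
    chartDeriv p x (VectorField.mlieBracket 𝓘(ℝ, E) X Y x) =
      fderiv ℝ (coordVec p Y) (extChartAt 𝓘(ℝ, E) p x) (coordVec p X (extChartAt 𝓘(ℝ, E) p x))
      - fderiv ℝ (coordVec p X) (extChartAt 𝓘(ℝ, E) p x)
        (coordVec p Y (extChartAt 𝓘(ℝ, E) p x)) := by
  obtain ⟨y, hy, rfl⟩ := exists_eq_param hx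
  rw [chart_param hy, coordVec_mlieBracket hy hX hY]

/-- The generators of the action respect Lie brackets. -/
theorem mlieBracket_generator [CompleteSpace E] [CompleteSpace EG]
    (hsmooth : ContMDiff (𝓘(ℝ, EG).prod 𝓘(ℝ, E)) 𝓘(ℝ, E) ∞ (fun p : G × M ↦ p.1 • p.2))
    (v w : GroupLieAlgebra 𝓘(ℝ, EG) G) (x : M) :
    VectorField.mlieBracket 𝓘(ℝ, E) (generator v) (generator w) x = generator ⁅v, w⁆ x := by
  have hxs := mem_chart_source E x
  set y := extChartAt 𝓘(ℝ, E) x x with hy'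
  have hy : y ∈ dom E x := self_mem_dom x
  have hyx : param E x y = x := param_self x
  set f : EG → E := fun s ↦ extChartAt 𝓘(ℝ, E) x (orbitMap G x (param EG (1 : G) s)) with hf
  have hfκ : f = fun s ↦ actionMap G x (s, y) := by
    funext s; simp only [hf, actionMap, orbitMap, hyx]
  have hκ := contDiffAt_actionMap_one (EG := EG) (G := G) hsmooth hy
  have hfs : ContDiffAt ℝ ∞ f (idCoord EG G) := by
    rw [hfκ]
    exact ContDiffAt.comp _ (f := fun s : EG ↦ (s, y)) hκ (contDiffAt_id.prodMk contDiffAt_const)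
  have hf1 : f (idCoord EG G) = y := by rw [hfκ]; exact actionMap_one hy
  have hfd : ∀ d, fderiv ℝ f (idCoord EG G) d = velocity (actionMap G x) (idCoord EG G) d y := by
    intro d
    have h3 : HasFDerivAt (fun s : EG ↦ actionMap G x (s, y)) _ (idCoord EG G) :=
      HasFDerivAt.comp (idCoord EG G) (f := fun s : EG ↦ (s, y)) hκ.hasFDerivAt_infty
        (hasFDerivAt_prodMk_left (idCoord EG G) y)
    rw [hfκ]
    exact DFunLike.congr_fun h3.fderiv d
  have hsrc : ∀ᶠ s in 𝓝 (idCoord EG G),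
      orbitMap G x (param EG (1 : G) s) ∈ (chartAt E x).source := by
    have h1 : ContinuousAt (fun s ↦ orbitMap G x (param EG (1 : G) s)) (idCoord EG G) :=
      ContinuousAt.comp (contMDiff_orbitMap hsmooth x).continuous.continuousAt
        (continuousAt_param (self_mem_dom _))
    refine h1.eventually_mem ((chartAt E x).open_source.mem_nhds ?_)
    simp [orbitMap, param_self]
  have hrel : ∀ v : GroupLieAlgebra 𝓘(ℝ, EG) G, ∀ᶠ z in 𝓝 (idCoord EG G),
      fderiv ℝ f z (coordVec (1 : G) (mulInvariantVectorField v) z)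
        = coordVec x (generator v) (f z) := fun v ↦ by
    filter_upwards [dom_mem_nhds (self_mem_dom (1 : G)), hsrc] with z hz hs
      using fderiv_orbitMap_coord hsmooth v hz hs
  have hd : ∀ v : GroupLieAlgebra 𝓘(ℝ, EG) G,
      DifferentiableAt ℝ (coordVec x (generator v : VField E M)) (f (idCoord EG G)) := fun v ↦ by
    rw [hf1]
    exact (contDiffAt_coordVec_generator hsmooth v hy).differentiableAt (by simp)
  -- The left-invariant fields of `v` and `w` are related to their generators by the orbit map,
  -- hence so are the brackets; at `1` the bracket of the former is `⁅v, w⁆` by definition.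
  have h1 := fderiv_bracket_of_related hfs (differentiableAt_coordVec_mulInvariantVectorField v)
    (differentiableAt_coordVec_mulInvariantVectorField w) (hd v) (hd w) (hrel v) (hrel w)
  have h2 := chartDeriv_mlieBracket (p := (1 : G)) (mem_chart_source EG (1 : G))
    (mdifferentiableAt_mulInvariantVectorField v) (mdifferentiableAt_mulInvariantVectorField w)
  rw [← GroupLieAlgebra.bracket_def] at h2
  rw [← h2, hfd, ← coordVec_generator hsmooth _ hy, hf1,
    ← chartDeriv_mlieBracket hxs (generator_diffAt hsmooth v x) (generator_diffAt hsmooth w x)] at h1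
  have h3 : (chartDeriv x x : E →L[ℝ] E) (generator ⁅v, w⁆ x) = coordVec x (generator ⁅v, w⁆) y := by
    rw [coordVec, hyx]
  have h4 := h3.trans h1
  have h5 : Function.Injective (chartDeriv x x : TangentSpace 𝓘(ℝ, E) x → E) := by
    have h6 : ∀ x', param E x y = x' →
        Function.Injective (chartDeriv x x' : TangentSpace 𝓘(ℝ, E) x' → E) := by
      rintro _ rfl
      exact Function.LeftInverse.injective (paramDeriv_chartDeriv hy)
    exact h6 x hyx
  exact (h5 h4).symm

end KGF

/-! ### Parametric integrals and the Poincaré lemma for 2-forms -/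

namespace KGF.Flat

open Module Filter Set MeasureTheory
open scoped Topology Interval

section ParametricIntegral

variable {E : Type*} [NormedAddCommGroup E] [NormedSpace ℝ E] [FiniteDimensional ℝ E]
  {F : Type*} [NormedAddCommGroup F] [NormedSpace ℝ F] [CompleteSpace F]

lemma hasFDerivAt_intervalIntegral {f : ℝ × E → F} {U : Set E} (hU : IsOpen U)
    (hf : ∀ t ∈ Icc (0 : ℝ) 1, ∀ y ∈ U, ContDiffAt ℝ ∞ f (t, y)) {y : E} (hy : y ∈ U) :
    HasFDerivAt (fun z ↦ ∫ t in (0 : ℝ)..1, f (t, z))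
      (∫ t in (0 : ℝ)..1, (fderiv ℝ f (t, y)).comp (ContinuousLinearMap.inr ℝ ℝ E)) y := by
  obtain ⟨r, hr, hrU⟩ := Metric.nhds_basis_closedBall.mem_iff.1 (hU.mem_nhds hy)
  have hI : Ι (0 : ℝ) 1 ⊆ Icc 0 1 := by
    rw [uIoc_of_le zero_le_one]; exact Ioc_subset_Icc_self
  have hc : ∀ z ∈ U, ContinuousOn (fun t ↦ f (t, z)) (Icc (0 : ℝ) 1) := fun z hz t ht ↦
    (ContinuousAt.comp (f := fun t : ℝ ↦ (t, z)) (hf t ht z hz).continuousAt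
      (by fun_prop)).continuousWithinAt
  have hcd : ContinuousOn (fun q : ℝ × E ↦
      (fderiv ℝ f q).comp (ContinuousLinearMap.inr ℝ ℝ E)) (Icc (0 : ℝ) 1 ×ˢ U) := by
    rintro ⟨t, z⟩ ⟨ht, hz⟩
    exact (((hf t ht z hz).fderiv_infty.continuousAt).clm_comp
      continuousAt_const).continuousWithinAt
  have hcd' : ∀ z ∈ U, ContinuousOn (fun t ↦
      (fderiv ℝ f (t, z)).comp (ContinuousLinearMap.inr ℝ ℝ E)) (Icc (0 : ℝ) 1) := fun z hz ↦
    hcd.comp (f := fun t : ℝ ↦ (t, z)) (by fun_prop) fun t ht ↦ ⟨ht, hz⟩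
  -- Closed balls are compact in finite dimension, so the derivative has a constant bound on `[0,
  -- 1]` times a ball; this constant is the dominating function.
  obtain ⟨C, hC⟩ := (isCompact_Icc.prod (isCompact_closedBall y r)).exists_bound_of_continuousOn
    (hcd.mono (prod_mono subset_rfl hrU))
  refine (intervalIntegral.hasFDerivAt_integral_of_dominated_of_fderiv_le
    (s := Metric.closedBall y r) (bound := fun _ ↦ C)
    (F' := fun z t ↦ (fderiv ℝ f (t, z)).comp (ContinuousLinearMap.inr ℝ ℝ E))
    (Metric.closedBall_mem_nhds y hr) ?_ ?_ ?_ ?_ ?_ ?_)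
  · filter_upwards [hU.mem_nhds hy] with z hz
    exact ((hc z hz).mono hI).aestronglyMeasurable measurableSet_uIoc
  · exact ((hc y hy).mono (by rw [uIcc_of_le zero_le_one])).intervalIntegrable
  · exact ((hcd' y hy).mono hI).aestronglyMeasurable measurableSet_uIoc
  · exact Eventually.of_forall fun t ht z hz ↦ hC (t, z) ⟨hI ht, hz⟩
  · exact intervalIntegrable_const
  · refine Eventually.of_forall fun t ht z hz ↦ ?_
    exact HasFDerivAt.comp z (f := fun z : E ↦ (t, z)) (hf t (hI ht) z (hrU hz)).hasFDerivAt_infty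
      (hasFDerivAt_prodMk_right t z)

end ParametricIntegral

universe u

/-- Induction on the order: the derivative is again a parametric integral, now with values in `E
→L[ℝ] F`. The target must vary in the induction, and the common universe keeps `E →L[ℝ] F` in the
universe of `F`. -/
lemma contDiffAt_intervalIntegral {E F : Type u} [NormedAddCommGroup E] [NormedSpace ℝ E]
    [FiniteDimensional ℝ E] [NormedAddCommGroup F] [NormedSpace ℝ F] [CompleteSpace F]
    {f : ℝ × E → F} {U : Set E} (hU : IsOpen U)
    (hf : ∀ t ∈ Icc (0 : ℝ) 1, ∀ y ∈ U, ContDiffAt ℝ ∞ f (t, y)) {y : E} (hy : y ∈ U) :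
    ContDiffAt ℝ ∞ (fun z ↦ ∫ t in (0 : ℝ)..1, f (t, z)) y := by
  rw [contDiffAt_infty]
  intro n
  induction n generalizing F with
  | zero =>
    rw [Nat.cast_zero, contDiffAt_zero]
    exact ⟨U, hU.mem_nhds hy, fun z hz ↦
      (hasFDerivAt_intervalIntegral hU hf hz).continuousAt.continuousWithinAt⟩
  | succ n ih =>
    rw [Nat.cast_succ, contDiffAt_succ_iff_hasFDerivAt]
    refine ⟨fun z ↦ ∫ t in (0 : ℝ)..1, (fderiv ℝ f (t, z)).comp (ContinuousLinearMap.inr ℝ ℝ E),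
      ⟨U, hU.mem_nhds hy, fun z hz ↦ hasFDerivAt_intervalIntegral hU hf hz⟩, ?_⟩
    exact ih (f := fun q ↦ (fderiv ℝ f q).comp (ContinuousLinearMap.inr ℝ ℝ E))
      fun t ht z hz ↦ (hf t ht z hz).fderiv_infty.clm_comp contDiffAt_const

variable {E : Type*} [NormedAddCommGroup E] [NormedSpace ℝ E] [FiniteDimensional ℝ E]

/-- The homotopy operator of the Poincaré lemma on 2-forms. -/
def potential (F : E → E →L[ℝ] E →L[ℝ] ℝ) (c : E) (y : E) : E →L[ℝ] ℝ :=
  ∫ t in (0 : ℝ)..1, t • F (c + t • (y - c)) (y - c)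

variable {F : E → E →L[ℝ] E →L[ℝ] ℝ} {c : E} {r : ℝ}

lemma contDiffAt_potential_integrand (hF : ∀ y ∈ Metric.ball c r, ContDiffAt ℝ ∞ F y) :
    ∀ t ∈ Icc (0 : ℝ) 1, ∀ y ∈ Metric.ball c r,
      ContDiffAt ℝ ∞ (fun q : ℝ × E ↦ q.1 • F (c + q.1 • (q.2 - c)) (q.2 - c)) (t, y) ∧
      c + t • (y - c) ∈ Metric.ball c r := by
  intro t ht y hy
  have hr : 0 < r := (dist_nonneg).trans_lt hy
  have h1 : c + t • (y - c) ∈ Metric.ball c r :=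
    (convex_ball c r).add_smul_sub_mem (Metric.mem_ball_self hr) hy ht
  refine ⟨?_, h1⟩
  have h2 : ContDiffAt ℝ ∞ (fun q : ℝ × E ↦ F (c + q.1 • (q.2 - c))) (t, y) :=
    ContDiffAt.comp (t, y) (f := fun q : ℝ × E ↦ c + q.1 • (q.2 - c)) (hF _ h1)
      (contDiffAt_const.add (contDiffAt_fst.smul (contDiffAt_snd.sub contDiffAt_const)))
  exact contDiffAt_fst.smul (h2.clm_apply (contDiffAt_snd.sub contDiffAt_const))

lemma contDiffAt_potential (hF : ∀ y ∈ Metric.ball c r, ContDiffAt ℝ ∞ F y) {y : E}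
    (hy : y ∈ Metric.ball c r) : ContDiffAt ℝ ∞ (potential F c) y :=
  contDiffAt_intervalIntegral Metric.isOpen_ball
    (fun t ht y hy ↦ (contDiffAt_potential_integrand hF t ht y hy).1) hy

/-- Poincaré lemma for 2-forms on a ball. -/
lemma fderiv_potential (hF : ∀ y ∈ Metric.ball c r, ContDiffAt ℝ ∞ F y)
    (halt : ∀ y ∈ Metric.ball c r, ∀ v w, F y v w = -F y w v)
    (hcl : ∀ y ∈ Metric.ball c r, ∀ u v w,
      fderiv ℝ F y u v w - fderiv ℝ F y v u w + fderiv ℝ F y w u v = 0) {y : E}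
    (hy : y ∈ Metric.ball c r) (v w : E) :
    fderiv ℝ (potential F c) y v w - fderiv ℝ (potential F c) y w v = F y v w := by
  set z := y - c with hz
  have hp := fun t ht ↦ contDiffAt_potential_integrand hF t ht y hy
  have hd : ∀ t ∈ Icc (0 : ℝ) 1, ∀ v w,
      fderiv ℝ (fun q : ℝ × E ↦ q.1 • F (c + q.1 • (q.2 - c)) (q.2 - c)) (t, y) (0, v) w
        = t * (t * fderiv ℝ F (c + t • z) v z w + F (c + t • z) v w) := by
    intro t ht v w
    have h1 : HasFDerivAt (fun x : E ↦ t • F (c + t • (x - c)) (x - c)) _ y :=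
      HasFDerivAt.comp y (f := fun x : E ↦ (t, x)) (hp t ht).1.hasFDerivAt_infty
        (hasFDerivAt_prodMk_right t y)
    have h2 : HasFDerivAt (fun x : E ↦ F (c + t • (x - c))) _ y :=
      HasFDerivAt.comp y (f := fun x : E ↦ c + t • (x - c)) (hF _ (hp t ht).2).hasFDerivAt_infty
        ((((hasFDerivAt_id y).sub_const c).const_smul t).const_add c)
    have h3 := (h2.clm_apply ((hasFDerivAt_id y).sub_const c)).const_smul t
    have h4 := DFunLike.congr_fun (DFunLike.congr_fun (h1.unique h3) v) w
    refine h4.trans ?_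
    simp only [FunLike.coe_smul, Pi.smul_apply, add_apply, ContinuousLinearMap.comp_apply,
      ContinuousLinearMap.flip_apply, ContinuousLinearMap.id_apply, map_smul, smul_eq_mul, id, ← hz]
    ring
  have hint : IntervalIntegrable (fun t : ℝ ↦ (fderiv ℝ (fun q : ℝ × E ↦
      q.1 • F (c + q.1 • (q.2 - c)) (q.2 - c)) (t, y)).comp (ContinuousLinearMap.inr ℝ ℝ E))
      volume 0 1 := by
    refine ContinuousOn.intervalIntegrable fun t ht ↦ ?_
    rw [uIcc_of_le zero_le_one] at ht
    exact ((ContinuousAt.comp (f := fun t : ℝ ↦ (t, y)) (hp t ht).1.fderiv_infty.continuousAt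
      (by fun_prop)).clm_comp continuousAt_const).continuousWithinAt
  have hA := (hasFDerivAt_intervalIntegral Metric.isOpen_ball
    (fun t ht y hy ↦ (contDiffAt_potential_integrand hF t ht y hy).1) hy).fderiv
  have hA' : ∀ v w, fderiv ℝ (potential F c) y v w = ∫ t in (0 : ℝ)..1,
      t * (t * fderiv ℝ F (c + t • z) v z w + F (c + t • z) v w) := by
    intro v w
    refine (congrArg (fun L : E →L[ℝ] E →L[ℝ] ℝ ↦ L v w) hA).trans ?_
    have h1 := ContinuousLinearMap.intervalIntegral_comp_comm
      ((ContinuousLinearMap.apply ℝ ℝ w).comp (ContinuousLinearMap.apply ℝ (E →L[ℝ] ℝ) v)) hint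
    refine h1.symm.trans (intervalIntegral.integral_congr fun t ht ↦ ?_)
    rw [uIcc_of_le zero_le_one] at ht
    exact hd t ht v w
  have hi : ∀ v w, IntervalIntegrable (fun t : ℝ ↦
      t * (t * fderiv ℝ F (c + t • z) v z w + F (c + t • z) v w)) volume 0 1 := by
    intro v w
    refine ContinuousOn.intervalIntegrable fun t ht ↦ ?_
    rw [uIcc_of_le zero_le_one] at ht
    have h1 := hF _ (hp t ht).2
    have h2 : ContinuousAt (fun t : ℝ ↦ c + t • z) t := by fun_prop
    have h3 : ContinuousAt (fun t : ℝ ↦ fderiv ℝ F (c + t • z)) t :=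
      ContinuousAt.comp (f := fun t : ℝ ↦ c + t • z) h1.fderiv_infty.continuousAt h2
    have h4 : ContinuousAt (fun t : ℝ ↦ F (c + t • z)) t :=
      ContinuousAt.comp (f := fun t : ℝ ↦ c + t • z) h1.continuousAt h2
    exact ContinuousAt.continuousWithinAt (by fun_prop)
  -- Closedness, applied to `z, v, w`, and antisymmetry make the integrand of the antisymmetrized
  -- derivative the total derivative of `t² F(c + tz)(v, w)`. Its boundary values are `F(y)(v, w)`
  -- and `0`.
  have hftc : ∀ t ∈ Icc (0 : ℝ) 1, HasDerivAt (fun t : ℝ ↦ t ^ 2 * F (c + t • z) v w)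
      (t * (t * fderiv ℝ F (c + t • z) v z w + F (c + t • z) v w)
        - t * (t * fderiv ℝ F (c + t • z) w z v + F (c + t • z) w v)) t := by
    intro t ht
    have hb := (hp t ht).2
    have h1 : HasDerivAt (fun t : ℝ ↦ c + t • z) z t := by
      simpa using ((hasDerivAt_id t).smul_const z).const_add c
    have h2 := (hF _ hb).hasFDerivAt_infty.comp_hasDerivAt t h1
    have h3 := (h2.clm_apply (hasDerivAt_const t v)).clm_apply (hasDerivAt_const t w)
    have h4 := (hasDerivAt_pow 2 t).mul h3
    refine h4.congr_deriv ?_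
    have h5 := hcl _ hb z v w
    have h6 := halt _ hb w v
    simp only [Function.comp_apply, map_zero, add_zero]
    push_cast
    linear_combination (t ^ 2) * h5 + t * h6
  rw [hA', hA', ← intervalIntegral.integral_sub (hi v w) (hi w v),
    intervalIntegral.integral_eq_sub_of_hasDerivAt (f := fun t : ℝ ↦ t ^ 2 * F (c + t • z) v w)
      (fun t ht ↦ hftc t (by rwa [uIcc_of_le zero_le_one] at ht)) ((hi v w).sub (hi w v))]
  simp [hz]

end KGF.Flat

/-! ### Local primitives of the contractions with symmetry fields -/

namespace KGF.Flat

open Module Filter Set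
open scoped Topology

variable {E : Type*} [NormedAddCommGroup E] [NormedSpace ℝ E]

/-- Contraction of a closed 2-form with a vector field that preserves it is closed. -/
lemma fderiv_contraction_symm {F : E → E →L[ℝ] E →L[ℝ] ℝ} {ξ : E → E} {y : E}
    (hF : ContDiffAt ℝ ∞ F y) (hξ : ContDiffAt ℝ ∞ ξ y)
    (halt : ∀ v w, F y v w = -F y w v)
    (hcl : ∀ u v w, fderiv ℝ F y u v w - fderiv ℝ F y v u w + fderiv ℝ F y w u v = 0)
    (hLie : ∀ v w, lieBilin F ξ y v w = 0) (v w : E) :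
    fderiv ℝ (fun z ↦ -F z (ξ z)) y v w = fderiv ℝ (fun z ↦ -F z (ξ z)) y w v := by
  have h1 : HasFDerivAt (fun z ↦ -F z (ξ z)) _ y :=
    (hF.hasFDerivAt_infty.clm_apply hξ.hasFDerivAt_infty).neg
  rw [h1.fderiv]
  have h2 := hcl (ξ y) v w
  have h3 := hLie v w
  have h4 := halt v (fderiv ℝ ξ y w)
  rw [lieBilin] at h3
  simp only [neg_apply, add_apply, ContinuousLinearMap.comp_apply,
    ContinuousLinearMap.flip_apply]
  linarith

/-- By `fderiv_contraction_symm` the form `-i_ξ F` is closed, so it has a primitive on the convex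
ball. The primitive is smooth because its derivative is. -/
lemma exists_moment [FiniteDimensional ℝ E] {F : E → E →L[ℝ] E →L[ℝ] ℝ} {ξ : E → E} {c : E} {r : ℝ}
    (hF : ∀ y ∈ Metric.ball c r, ContDiffAt ℝ ∞ F y)
    (hξ : ∀ y ∈ Metric.ball c r, ContDiffAt ℝ ∞ ξ y)
    (halt : ∀ y ∈ Metric.ball c r, ∀ v w, F y v w = -F y w v)
    (hcl : ∀ y ∈ Metric.ball c r, ∀ u v w,
      fderiv ℝ F y u v w - fderiv ℝ F y v u w + fderiv ℝ F y w u v = 0)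
    (hLie : ∀ y ∈ Metric.ball c r, ∀ v w, lieBilin F ξ y v w = 0) :
    ∃ χ : E → ℝ, ∀ y ∈ Metric.ball c r, ContDiffAt ℝ ∞ χ y ∧
      ∀ v, fderiv ℝ χ y v = -F y (ξ y) v := by
  have hs : ∀ y ∈ Metric.ball c r, ContDiffAt ℝ ∞ (fun z ↦ -F z (ξ z)) y := fun y hy ↦
    ((hF y hy).clm_apply (hξ y hy)).neg
  have hd : DifferentiableOn ℝ (fun z ↦ -F z (ξ z)) (Metric.ball c r) := fun y hy ↦
    ((hs y hy).differentiableAt (by simp)).differentiableWithinAt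
  obtain ⟨χ, hχ⟩ := (convex_ball c r).exists_forall_hasFDerivAt_of_fderiv_symmetric
    Metric.isOpen_ball hd
    (fun y hy ↦ fderiv_contraction_symm (hF y hy) (hξ y hy) (halt y hy) (hcl y hy) (hLie y hy))
  refine ⟨χ, fun y hy ↦ ⟨?_, fun v ↦ by rw [(hχ y hy).fderiv]; rfl⟩⟩
  have h1 : ContDiffOn ℝ ∞ χ (Metric.ball c r) := by
    rw [contDiffOn_infty_iff_fderiv_of_isOpen Metric.isOpen_ball]
    refine ⟨fun y hy ↦ (hχ y hy).differentiableAt.differentiableWithinAt, ?_⟩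
    exact ContDiffOn.congr (fun y hy ↦ (hs y hy).contDiffWithinAt) fun y hy ↦ (hχ y hy).fderiv
  exact h1.contDiffAt (Metric.isOpen_ball.mem_nhds hy)

end KGF.Flat

/-! ### Local existence of potentials and moments on the manifold -/

namespace KGF

open Module Filter Flat Set
open scoped Topology

variable {E : Type*} [NormedAddCommGroup E] [NormedSpace ℝ E] [FiniteDimensional ℝ E]
  {M : Type*} [TopologicalSpace M] [ChartedSpace E M] [IsManifold 𝓘(ℝ, E) ∞ M]

lemma IsClosedTwoForm.neg_swap {F : Bilin E M} (hF : IsClosedTwoForm F) (x : M)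
    (v w : TangentSpace 𝓘(ℝ, E) x) : F x v w = -F x w v := by
  have h := hF.alternating x (v + w)
  simp only [map_add, add_apply, hF.alternating] at h
  linarith

lemma IsClosedTwoForm.coordBilin_neg_swap {F : Bilin E M} (hF : IsClosedTwoForm F) (p : M)
    (y v w : E) : coordBilin p F y v w = -coordBilin p F y w v :=
  hF.neg_swap (param E p y) (paramDeriv p y v) (paramDeriv p y w)

lemma IsClosedTwoForm.fderiv_coordBilin {F : Bilin E M} (hF : IsClosedTwoForm F) {p : M} {y : E}
    (hy : y ∈ dom E p) (u v w : E) :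
    fderiv ℝ (coordBilin p F) y u v w - fderiv ℝ (coordBilin p F) y v u w
      + fderiv ℝ (coordBilin p F) y w u v = 0 := by
  have h := hF.closed (param E p y) _ _ _ (extend_diffAt (paramDeriv p y u))
    (extend_diffAt (paramDeriv p y v)) (extend_diffAt (paramDeriv p y w))
  rw [extDerivTwo_param hy (hF.smooth.coordBilin hy) (hF.coordBilin_neg_swap p y)
    (extend_diffAt _) (extend_diffAt _) (extend_diffAt _)] at h
  simpa only [coordVec_extend, chartDeriv_paramDeriv hy] using h

lemma IsPotentialOn.contDiffAt_coordCov {F : Bilin E M} {A : Covector E M} {U : Set M}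
    (hA : IsPotentialOn F A U) (hU : IsOpen U) {p : M} {y : E} (hy : y ∈ dom E p)
    (hyU : param E p y ∈ U) : ContDiffAt ℝ ∞ (coordCov p A) y :=
  (contMDiffAt_covector_iff hy).1 (hA.smooth.contMDiffAt (hU.mem_nhds hyU))

lemma IsPotentialOn.fderiv_coordCov {F : Bilin E M} {A : Covector E M} {U : Set M}
    (hA : IsPotentialOn F A U) (hU : IsOpen U) {p : M} {y : E} (hy : y ∈ dom E p)
    (hyU : param E p y ∈ U) (v w : E) :
    fderiv ℝ (coordCov p A) y v w - fderiv ℝ (coordCov p A) y w v = coordBilin p F y v w := by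
  have h := hA.extDeriv_eq (param E p y) hyU _ _ (extend_diffAt (paramDeriv p y v))
    (extend_diffAt (paramDeriv p y w))
  rw [extDerivOne_param hy (hA.contDiffAt_coordCov hU hy hyU) (extend_diffAt _)
    (extend_diffAt _), extend_self, extend_self] at h
  simp only [coordVec_extend, chartDeriv_paramDeriv hy] at h
  exact h

lemma IsMomentOn.contDiffAt {F : Bilin E M} {ξ : VField E M} {χ : M → ℝ} {U : Set M}
    (hχ : IsMomentOn F ξ χ U) (hU : IsOpen U) {p : M} {y : E} (hy : y ∈ dom E p)
    (hyU : param E p y ∈ U) : ContDiffAt ℝ ∞ (χ ∘ param E p) y :=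
  (contMDiffAt_param_iff hy).1 (hχ.smooth.contMDiffAt (hU.mem_nhds hyU))

lemma IsMomentOn.fderiv_eq {F : Bilin E M} {ξ : VField E M} {χ : M → ℝ} {U : Set M}
    (hχ : IsMomentOn F ξ χ U) {p : M} {y : E} (hy : y ∈ dom E p)
    (hyU : param E p y ∈ U) (v : E) :
    fderiv ℝ (χ ∘ param E p) y v = -coordBilin p F y (coordVec p ξ y) v := by
  have h := hχ.deriv_eq _ hyU (paramDeriv p y v)
  rw [mvfderiv_param _ hy, chartDeriv_paramDeriv hy,
    ← coordBilin_chartDeriv F hy, chartDeriv_paramDeriv hy] at h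
  exact h

lemma isPotentialOn_of_coord {F : Bilin E M} {A : Covector E M} {U : Set M} {p : M}
    (hU : U ⊆ (chartAt E p).source)
    (h1 : ∀ y ∈ dom E p, param E p y ∈ U → ContDiffAt ℝ ∞ (coordCov p A) y)
    (h2 : ∀ y ∈ dom E p, param E p y ∈ U → ∀ v w, fderiv ℝ (coordCov p A) y v w
      - fderiv ℝ (coordCov p A) y w v = coordBilin p F y v w) : IsPotentialOn F A U := by
  constructor
  · intro x hx
    obtain ⟨y, hy, rfl⟩ := exists_eq_param (hU hx)
    exact ((contMDiffAt_covector_iff hy).2 (h1 y hy hx)).contMDiffWithinAt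
  · intro x hx X Y hX hY
    obtain ⟨y, hy, rfl⟩ := exists_eq_param (hU hx)
    rw [extDerivOne_param hy (h1 y hy hx) hX hY, h2 y hy hx, coordBilin_coordVec F X Y hy]

lemma isMomentOn_of_coord {F : Bilin E M} {ξ : VField E M} {χ : M → ℝ} {U : Set M} {p : M}
    (hU : U ⊆ (chartAt E p).source)
    (h1 : ∀ y ∈ dom E p, param E p y ∈ U → ContDiffAt ℝ ∞ (χ ∘ param E p) y)
    (h2 : ∀ y ∈ dom E p, param E p y ∈ U → ∀ v, fderiv ℝ (χ ∘ param E p) y v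
      = -coordBilin p F y (coordVec p ξ y) v) : IsMomentOn F ξ χ U := by
  constructor
  · intro x hx
    obtain ⟨y, hy, rfl⟩ := exists_eq_param (hU hx)
    exact ((contMDiffAt_param_iff hy).2 (h1 y hy hx)).contMDiffWithinAt
  · intro x hx v
    obtain ⟨y, hy, rfl⟩ := exists_eq_param (hU hx)
    rw [mvfderiv_param _ hy, h2 y hy hx, ← coordBilin_chartDeriv F hy]
    rfl

/-- Around every point there is a neighbourhood on which a closed 2-form has a potential, and every
vector field that preserves it has a moment. -/
theorem exists_potential_moment {F : Bilin E M} (hF : IsClosedTwoForm F) {ι : Type*}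
    (ξ : ι → VField E M) (p : M)
    (hξ : ∀ a, ∀ y ∈ dom E p, ContDiffAt ℝ ∞ (coordVec p (ξ a)) y)
    (hLie : ∀ a, ∀ y ∈ dom E p, ∀ v w, lieBilin (coordBilin p F) (coordVec p (ξ a)) y v w = 0) :
    ∃ U : Set M, IsOpen U ∧ IsConnected U ∧ p ∈ U ∧ (∃ A : Covector E M, IsPotentialOn F A U) ∧
      ∃ χ : ι → M → ℝ, ∀ a, IsMomentOn F (ξ a) (χ a) U := by
  set c := extChartAt 𝓘(ℝ, E) p p with hc
  obtain ⟨r, hr, hrd⟩ := Metric.mem_nhds_iff.1 (dom_mem_nhds (self_mem_dom (E := E) p))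
  -- The neighbourhood is a coordinate ball: convexity in the chart serves the Poincaré lemma, and
  -- being the image of a ball makes it connected.
  set U : Set M := (chartAt E p).source ∩ extChartAt 𝓘(ℝ, E) p ⁻¹' Metric.ball c r with hU
  have hUo : IsOpen U := by
    have h := (continuousOn_extChartAt (I := 𝓘(ℝ, E)) p).isOpen_inter_preimage
      (isOpen_extChartAt_source p) (Metric.isOpen_ball (x := c) (ε := r))
    rwa [extChartAt_source] at h
  have hUi : U = param E p '' Metric.ball c r := by
    ext x
    constructor
    · rintro ⟨h1, h2⟩
      exact ⟨_, h2, param_chart h1⟩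
    · rintro ⟨y, hy, rfl⟩
      exact ⟨param_mem_source (hrd hy), by rw [mem_preimage, chart_param (hrd hy)]; exact hy⟩
  have hUb : ∀ y ∈ dom E p, param E p y ∈ U → y ∈ Metric.ball c r := by
    intro y hy h
    have := h.2
    rwa [mem_preimage, chart_param hy] at this
  have hpU : p ∈ U := ⟨mem_chart_source E p, Metric.mem_ball_self hr⟩
  refine ⟨U, hUo, ⟨⟨p, hpU⟩, ?_⟩, hpU, ?_, ?_⟩
  · rw [hUi]
    exact (convex_ball c r).isPreconnected.image _
      fun y hy ↦ (continuousAt_param (hrd hy)).continuousWithinAt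
  · set A' := potential (coordBilin p F) c
    have hA' : ∀ y ∈ Metric.ball c r, ContDiffAt ℝ ∞ A' y := fun y hy ↦
      contDiffAt_potential (fun y hy ↦ hF.smooth.coordBilin (hrd hy)) hy
    let A : Covector E M := fun x ↦ (A' (extChartAt 𝓘(ℝ, E) p x)).comp (chartDeriv p x)
    have hA : ∀ y ∈ dom E p, coordCov p A y = A' y := by
      intro y hy
      ext v
      change A' (extChartAt 𝓘(ℝ, E) p (param E p y)) (chartDeriv p (param E p y) (paramDeriv p y v))
        = _
      rw [chart_param hy, chartDeriv_paramDeriv hy]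
    have hAe : ∀ y ∈ dom E p, coordCov p A =ᶠ[𝓝 y] A' := fun y hy ↦ by
      filter_upwards [dom_mem_nhds hy] with z hz using hA z hz
    refine ⟨A, isPotentialOn_of_coord inter_subset_left (fun y hy hyU ↦ ?_) fun y hy hyU v w ↦ ?_⟩
    · exact (hA' y (hUb y hy hyU)).congr_of_eventuallyEq (hAe y hy)
    · rw [(hAe y hy).fderiv_eq]
      exact fderiv_potential (fun y hy ↦ hF.smooth.coordBilin (hrd hy))
        (fun y _ ↦ hF.coordBilin_neg_swap p y) (fun y hy ↦ hF.fderiv_coordBilin (hrd hy))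
        (hUb y hy hyU) v w
  · choose χ' hχ' using fun a ↦ exists_moment (F := coordBilin p F) (ξ := coordVec p (ξ a))
      (c := c) (r := r) (fun y hy ↦ hF.smooth.coordBilin (hrd hy)) (fun y hy ↦ hξ a y (hrd hy))
      (fun y _ ↦ hF.coordBilin_neg_swap p y) (fun y hy ↦ hF.fderiv_coordBilin (hrd hy))
      (fun y hy ↦ hLie a y (hrd hy))
    have he : ∀ a, ∀ y ∈ dom E p,
        (χ' a ∘ extChartAt 𝓘(ℝ, E) p) ∘ param E p =ᶠ[𝓝 y] χ' a := fun a y hy ↦ by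
      filter_upwards [dom_mem_nhds hy] with z hz
      exact congrArg (χ' a) (chart_param hz)
    refine ⟨fun a ↦ χ' a ∘ extChartAt 𝓘(ℝ, E) p, fun a ↦
      isMomentOn_of_coord inter_subset_left (fun y hy hyU ↦ ?_) fun y hy hyU v ↦ ?_⟩
    · exact (hχ' a y (hUb y hy hyU)).1.congr_of_eventuallyEq (he a y hy)
    · rw [(he a y hy).fderiv_eq]
      exact (hχ' a y (hUb y hy hyU)).2 v

end KGF

/-! ### A Killing field is determined by its 1-jet -/

namespace KGF.Flat

open Module Filter Set
open scoped Topology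

variable {E : Type*} [NormedAddCommGroup E] [NormedSpace ℝ E] [FiniteDimensional ℝ E]

/-- A Killing field that vanishes to first order at a point of a convex set vanishes on it. -/
lemma killing_eq_zero {g : E → E →L[ℝ] E →L[ℝ] ℝ} {ξ : E → E} {s : Set E} (hs : Convex ℝ s)
    (hso : IsOpen s) (hg : ∀ y ∈ s, ContDiffAt ℝ ∞ g y)
    (hsymm : ∀ y ∈ s, ∀ v w, g y v w = g y w v)
    (hnd : ∀ y ∈ s, ∀ v, (∀ w, g y v w = 0) → v = 0)
    (h : ∀ y ∈ s, ∀ v w, lieBilin g ξ y v w = 0) (hξ : ∀ y ∈ s, ContDiffAt ℝ ∞ ξ y)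
    {c : E} (hc : c ∈ s) (h0 : ξ c = 0) (h1 : fderiv ℝ ξ c = 0) : ∀ y ∈ s, ξ y = 0 := by
  intro y hy
  set d := y - c with hd
  set γ : ℝ → E := fun t ↦ c + t • d with hγ
  have hγs : ∀ t ∈ Icc (0 : ℝ) 1, γ t ∈ s := fun t ht ↦ hs.add_smul_sub_mem hc hy ht
  have hγd : ∀ t, HasDerivAt γ d t := fun t ↦ by
    simpa [hγ] using (((hasDerivAt_id t).smul_const d).const_add c)
  have hγc : Continuous γ := by fun_prop
  have hΓ : ∀ t ∈ Icc (0 : ℝ) 1, ContDiffAt ℝ ∞ (christoffel g) (γ t) := fun t ht ↦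
    contDiffAt_christoffel (hg _ (hγs t ht)) (hnd _ (hγs t ht))
  have hΓc : ContinuousOn (fun t ↦ christoffel g (γ t)) (Icc 0 1) := fun t ht ↦
    (ContinuousAt.comp (f := γ) (hΓ t ht).continuousAt hγc.continuousAt).continuousWithinAt
  have hDΓc : ContinuousOn (fun t ↦ fderiv ℝ (christoffel g) (γ t)) (Icc 0 1) := fun t ht ↦
    (ContinuousAt.comp (f := γ) (hΓ t ht).fderiv_infty.continuousAt
      hγc.continuousAt).continuousWithinAt
  obtain ⟨C₁, hC₁⟩ := isCompact_Icc.exists_bound_of_continuousOn hΓc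
  obtain ⟨C₂, hC₂⟩ := isCompact_Icc.exists_bound_of_continuousOn hDΓc
  have hC₁0 : 0 ≤ C₁ := (norm_nonneg _).trans (hC₁ 0 (by simp))
  have hC₂0 : 0 ≤ C₂ := (norm_nonneg _).trans (hC₂ 0 (by simp))
  -- By `lie_christoffel`, `∂∂ξ` is linear in `ξ` and `∂ξ`. The 1-jet along the segment from `c` to
  -- `y` therefore satisfies `‖u'‖ ≤ K‖u‖` with `u 0 = 0`, and Grönwall's inequality gives `u = 0`.
  -- In `K`, the `1` bounds `∂_d ξ`, `C₂` the term with `∂Γ`, and `3C₁` the three terms with `Γ`.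
  set u : ℝ → E × (E →L[ℝ] E) := fun t ↦ (ξ (γ t), fderiv ℝ ξ (γ t)) with hu
  have hu' : ∀ t ∈ Icc (0 : ℝ) 1, HasDerivAt u
      (fderiv ℝ ξ (γ t) d, fderiv ℝ (fderiv ℝ ξ) (γ t) d) t := fun t ht ↦
    ((hξ _ (hγs t ht)).hasFDerivAt_infty.comp_hasDerivAt t (hγd t)).prodMk
      ((hξ _ (hγs t ht)).fderiv_infty.hasFDerivAt_infty.comp_hasDerivAt t (hγd t))
  have key := eq_zero_of_abs_deriv_le_mul_abs_self_of_eq_zero_right (f := u) (a := 0) (b := 1)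
    (K := ‖d‖ * (1 + C₂ + 3 * C₁))
    (fun t ht ↦ (hu' t ht).continuousAt.continuousWithinAt)
    (fun t ht ↦ (hu' t (Ico_subset_Icc_self ht)).hasDerivWithinAt)
    (by simp [hu, hγ, h0, h1]) ?_ 1 (by simp)
  · have : ξ (γ 1) = 0 := congrArg Prod.fst key
    simpa [hγ, hd] using this
  intro t ht
  have ht' := Ico_subset_Icc_self ht
  have hts := hγs t ht'
  have hev := hso.mem_nhds hts
  have ha : ‖ξ (γ t)‖ ≤ ‖u t‖ := norm_fst_le (u t)
  have hb : ‖fderiv ℝ ξ (γ t)‖ ≤ ‖u t‖ := norm_snd_le (u t)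
  set n := ‖u t‖
  have hn : 0 ≤ n := norm_nonneg _
  set X := ξ (γ t)
  set L := fderiv ℝ ξ (γ t)
  set Γ := christoffel g (γ t)
  have hL : ∀ a, ‖L a‖ ≤ n * ‖a‖ := fun a ↦ (L.le_opNorm a).trans (by gcongr)
  have hΓ1 : ∀ a b, ‖Γ a b‖ ≤ C₁ * ‖a‖ * ‖b‖ := fun a b ↦
    (Γ.le_opNorm₂ a b).trans (by gcongr; exact hC₁ t ht')
  have hDΓ : ∀ a b, ‖fderiv ℝ (christoffel g) (γ t) X a b‖ ≤ C₂ * n * ‖a‖ * ‖b‖ := fun a b ↦ by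
    refine (ContinuousLinearMap.le_opNorm₂ _ a b).trans ?_
    gcongr
    exact (ContinuousLinearMap.le_opNorm _ _).trans
      (mul_le_mul (hC₂ t ht') ha (norm_nonneg _) hC₂0)
  refine max_le ?_ ?_
  · calc ‖L d‖ ≤ n * ‖d‖ := hL d
      _ ≤ ‖d‖ * (1 + C₂ + 3 * C₁) * n := by
        have : 0 ≤ ‖d‖ * n * (C₂ + 3 * C₁) := by positivity
        linarith
  · refine ContinuousLinearMap.opNorm_le_bound _ (by positivity) fun w ↦ ?_
    have hk := lie_christoffel (hg _ hts) (hξ _ hts) (Filter.mem_of_superset hev fun z hz ↦ hsymm z hz)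
      (Filter.mem_of_superset hev fun z hz ↦ hnd z hz)
      (Filter.mem_of_superset hev fun z hz ↦ h z hz) d w
    have hk' : fderiv ℝ (fderiv ℝ ξ) (γ t) d w = L (Γ d w) -
        (fderiv ℝ (christoffel g) (γ t) X d w + Γ (L d) w + Γ d (L w)) := by
      rw [eq_sub_iff_add_eq, ← sub_eq_zero, ← hk]
      abel
    rw [hk']
    have e1 := (hL (Γ d w)).trans (mul_le_mul_of_nonneg_left (hΓ1 d w) hn)
    have e2 := hDΓ d w
    have e3 : ‖Γ (L d) w‖ ≤ C₁ * (n * ‖d‖) * ‖w‖ :=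
      (hΓ1 (L d) w).trans (by gcongr; exact hL d)
    have e4 : ‖Γ d (L w)‖ ≤ C₁ * ‖d‖ * (n * ‖w‖) :=
      (hΓ1 d (L w)).trans (by gcongr; exact hL w)
    have e5 := norm_sub_le (L (Γ d w))
      (fderiv ℝ (christoffel g) (γ t) X d w + Γ (L d) w + Γ d (L w))
    have e6 := norm_add₃_le (a := fderiv ℝ (christoffel g) (γ t) X d w) (b := Γ (L d) w)
      (c := Γ d (L w))
    have e7 : 0 ≤ ‖d‖ * n * ‖w‖ := by positivity
    calc _ ≤ _ := e5
      _ ≤ n * (C₁ * ‖d‖ * ‖w‖) + (C₂ * n * ‖d‖ * ‖w‖ + C₁ * (n * ‖d‖) * ‖w‖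
          + C₁ * ‖d‖ * (n * ‖w‖)) := by linarith
      _ ≤ _ := by linarith

end KGF.Flat

/-! ### Unique continuation and faithfulness of the generators -/

namespace KGF

open Module Filter Flat Set
open scoped Topology

variable {E : Type*} [NormedAddCommGroup E] [NormedSpace ℝ E] [FiniteDimensional ℝ E]
  {M : Type*} [TopologicalSpace M] [ChartedSpace E M] [IsManifold 𝓘(ℝ, E) ∞ M]

lemma coordVec_eq_zero_iff {ξ : VField E M} {p : M} {y : E} (hy : y ∈ dom E p) :
    coordVec p ξ y = 0 ↔ ξ (param E p y) = 0 := by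
  refine ⟨fun h ↦ ?_, fun h ↦ by rw [coordVec, h, map_zero]⟩
  rw [← paramDeriv_chartDeriv hy (ξ (param E p y))]
  exact (congrArg (paramDeriv p y) h).trans (map_zero _)

/-- Unique continuation for Killing fields. -/
theorem killing_eq_zero_of_isOpen [ConnectedSpace M] (g : PseudoRiemannianMetric E M)
    {ξ : VField E M} (hξ : ∀ p, ∀ y ∈ dom E p, ContDiffAt ℝ ∞ (coordVec p ξ) y)
    (hLie : ∀ p, ∀ y ∈ dom E p, ∀ v w, lieBilin (coordBilin p g.val) (coordVec p ξ) y v w = 0)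
    {U : Set M} (hU : IsOpen U) (hne : U.Nonempty) (h0 : ∀ x ∈ U, ξ x = 0) (x : M) : ξ x = 0 := by
  -- The interior of the zero set is open and nonempty, so on a connected manifold it is enough that
  -- it is closed. Near a point of its closure, a coordinate ball contains a point around which `ξ`
  -- vanishes, and there its 1-jet is zero.
  set Z := interior {x | ξ x = 0} with hZ
  have hUZ : U ⊆ Z := interior_maximal h0 hU
  have hclosed : IsClosed Z := by
    refine isClosed_of_closure_subset fun p hp ↦ ?_
    set c := extChartAt 𝓘(ℝ, E) p p with hc
    obtain ⟨r, hr, hrd⟩ := Metric.mem_nhds_iff.1 (dom_mem_nhds (self_mem_dom (E := E) p))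
    set V : Set M := (chartAt E p).source ∩ extChartAt 𝓘(ℝ, E) p ⁻¹' Metric.ball c r with hV
    have hVo : IsOpen V := by
      have h := (continuousOn_extChartAt (I := 𝓘(ℝ, E)) p).isOpen_inter_preimage
        (isOpen_extChartAt_source p) (Metric.isOpen_ball (x := c) (ε := r))
      rwa [extChartAt_source] at h
    have hpV : p ∈ V := ⟨mem_chart_source E p, Metric.mem_ball_self hr⟩
    obtain ⟨q, hqV, hqZ⟩ := mem_closure_iff.1 hp V hVo hpV
    have hy0 : extChartAt 𝓘(ℝ, E) p q ∈ Metric.ball c r := hqV.2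
    set y0 := extChartAt 𝓘(ℝ, E) p q
    have hq : param E p y0 = q := param_chart hqV.1
    have hev : ∀ᶠ y in 𝓝 y0, coordVec p ξ y = 0 := by
      have h1 : ∀ᶠ y in 𝓝 y0, param E p y ∈ Z :=
        (continuousAt_param (hrd hy0)).eventually_mem (by
          rw [hq]; exact isOpen_interior.mem_nhds hqZ)
      filter_upwards [h1, dom_mem_nhds (hrd hy0)] with y hy hyd
      exact (coordVec_eq_zero_iff hyd).2 (interior_subset (s := {x | ξ x = 0}) hy)
    have hD : fderiv ℝ (coordVec p ξ) y0 = 0 := by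
      have h2 : coordVec p ξ =ᶠ[𝓝 y0] fun _ ↦ 0 := hev
      rw [h2.fderiv_eq]; simp
    have hall := killing_eq_zero (convex_ball c r) Metric.isOpen_ball
      (fun y hy ↦ g.smooth.coordBilin (hrd hy)) (fun y _ ↦ coordBilin_symm g p y)
      (fun y hy ↦ coordBilin_nondegenerate g (hrd hy)) (fun y hy ↦ hLie p y (hrd hy))
      (fun y hy ↦ hξ p y (hrd hy)) hy0 hev.self_of_nhds hD
    refine interior_maximal (t := V) ?_ hVo hpV
    intro x hx
    have h3 := hall _ hx.2
    rw [coordVec_eq_zero_iff (hrd hx.2), param_chart hx.1] at h3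
    exact h3
  have huniv := IsClopen.eq_univ ⟨hclosed, isOpen_interior⟩ (hne.mono hUZ)
  have hx : x ∈ Z := by rw [huniv]; exact mem_univ x
  exact interior_subset (s := {x | ξ x = 0}) hx

variable {EG : Type*} [NormedAddCommGroup EG] [NormedSpace ℝ EG] [FiniteDimensional ℝ EG]
  {G : Type*} [TopologicalSpace G] [ChartedSpace EG G] [Group G] [LieGroup 𝓘(ℝ, EG) ∞ G]
  [MulAction G M]

lemma contMDiff_generator
    (hsmooth : ContMDiff (𝓘(ℝ, EG).prod 𝓘(ℝ, E)) 𝓘(ℝ, E) ∞ (fun p : G × M ↦ p.1 • p.2))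
    (v : GroupLieAlgebra 𝓘(ℝ, EG) G) :
    ContMDiff 𝓘(ℝ, E) (𝓘(ℝ, E).prod 𝓘(ℝ, E)) ∞
      (fun x : M ↦ TotalSpace.mk' E (E := fun z : M ↦ TangentSpace 𝓘(ℝ, E) z) x
        ((generator v : VField E M) x)) := by
  intro x
  have h := (contMDiffAt_vectorField_iff (self_mem_dom x)).2
    (contDiffAt_coordVec_generator hsmooth v (self_mem_dom x))
  rwa [param_self] at h

/-- If only a discrete subgroup acts trivially, the generators are faithful. -/
theorem eq_zero_of_generator_eq_zero [T2Space M]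
    (hsmooth : ContMDiff (𝓘(ℝ, EG).prod 𝓘(ℝ, E)) 𝓘(ℝ, E) ∞ (fun p : G × M ↦ p.1 • p.2))
    (hker : DiscreteTopology (MulAction.toPermHom G M).ker)
    {v : GroupLieAlgebra 𝓘(ℝ, EG) G} (h : ∀ x : M, (generator v : VField E M) x = 0) : v = 0 := by
  have hX : ContMDiffAt 𝓘(ℝ, EG) (𝓘(ℝ, EG).prod 𝓘(ℝ, EG)) 1
      (fun k : G ↦ (⟨k, mulInvariantVectorField v k⟩ : TangentBundle 𝓘(ℝ, EG) G)) 1 :=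
    (contMDiff_mulInvariantVectorField v).contMDiffAt.of_le (by
      rw [minSmoothness_of_isRCLikeNormedField]; exact one_le_two)
  have : IsManifold 𝓘(ℝ, EG) 1 G := IsManifold.of_le (n := ∞) (by simp)
  have : IsManifold 𝓘(ℝ, E) 1 M := IsManifold.of_le (n := ∞) (by simp)
  -- A local integral curve of the left-invariant field replaces the one-parameter subgroup
  -- `exp(tv)`.
  obtain ⟨γ, hγ0, hγ⟩ := exists_isMIntegralCurveAt_of_contMDiffAt_boundaryless 0 hX
  obtain ⟨δ, hδ, hγδ⟩ := isMIntegralCurveAt_iff'.1 hγ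
  rw [Real.ball_eq_Ioo, zero_sub, zero_add] at hγδ
  have hfix : ∀ t ∈ Ioo (-δ) δ, γ t ∈ (MulAction.toPermHom G M).ker := by
    intro t ht
    rw [MonoidHom.mem_ker]
    ext x
    -- The curve `γ(t)⁻¹ • x` and the constant curve `x` are integral curves of the same, vanishing,
    -- generator; by uniqueness they agree, so `γ(t)` fixes every point.
    have h1 : IsMIntegralCurveOn (fun t ↦ orbitMap G x (γ t)) (generator v : VField E M)
        (Ioo (-δ) δ) := by
      intro t ht
      have h2 := (((contMDiff_orbitMap hsmooth x).mdifferentiableAt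
        (x := γ t) (by simp)).hasMFDerivAt).comp_hasMFDerivWithinAt t (hγδ t ht)
      refine h2.congr_mfderiv ?_
      ext
      exact (congrArg (mfderiv 𝓘(ℝ, EG) 𝓘(ℝ, E) (orbitMap G x) (γ t))
        (one_smul ℝ (mulInvariantVectorField v (γ t)))).trans
          ((mfderiv_orbitMap hsmooth v x (γ t)).trans
            (one_smul ℝ (generator v (orbitMap G x (γ t)) : E)).symm)
    have h2 : IsMIntegralCurveOn (fun _ ↦ x) (generator v : VField E M) (Ioo (-δ) δ) := by
      intro t ht
      have h3 := hasMFDerivWithinAt_const (I := 𝓘(ℝ, ℝ)) (I' := 𝓘(ℝ, E)) x (Ioo (-δ) δ) t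
      refine h3.congr_mfderiv ?_
      ext
      exact ((one_smul ℝ (generator v x : E)).trans (h x)).symm
    have h3 := isMIntegralCurveOn_Ioo_eqOn_of_contMDiff_boundaryless (t₀ := 0)
      ⟨by linarith, hδ⟩ ((contMDiff_generator hsmooth v).of_le (by simp)) h1 h2
      (by simp [orbitMap, hγ0])
    have h4 : (γ t)⁻¹ • x = x := h3 ht
    change γ t • x = x
    conv_lhs => rw [← h4, smul_inv_smul]
  -- Discreteness isolates `1` in the kernel of the action. The continuous curve `γ` stays in this
  -- kernel, so it is constant near `0`, and its initial velocity `v` is zero.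
  have hone : ∀ᶠ k in 𝓝 (1 : G), k ∈ (MulAction.toPermHom G M).ker → k = 1 := by
    have h1 : IsOpen ({1} : Set (MulAction.toPermHom G M).ker) := isOpen_discrete _
    obtain ⟨V, hV, hV1⟩ := isOpen_induced_iff.1 h1
    have h1V : (1 : G) ∈ V := by
      have : (1 : (MulAction.toPermHom G M).ker) ∈ Subtype.val ⁻¹' V := by rw [hV1]; rfl
      exact this
    filter_upwards [hV.mem_nhds h1V] with k hk hkk
    have : (⟨k, hkk⟩ : (MulAction.toPermHom G M).ker) ∈ Subtype.val ⁻¹' V := hk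
    rw [hV1] at this
    exact congrArg Subtype.val this
  have hγc : ContinuousAt γ 0 := hγ.continuousAt
  have hγ1 : γ =ᶠ[𝓝 0] fun _ ↦ (1 : G) := by
    filter_upwards [hγc.eventually (by rwa [hγ0]), Ioo_mem_nhds (neg_lt_zero.2 hδ) hδ] with t h1 h2
    exact h1 (hfix t h2)
  have h1 := hγ.self_of_nhds
  have h2 := (hasMFDerivAt_const (I := 𝓘(ℝ, ℝ)) (I' := 𝓘(ℝ, EG)) (1 : G) (0 : ℝ))
  have h3 := h1.mfderiv.symm.trans (hγ1.mfderiv_eq.trans h2.mfderiv)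
  have h4 := DFunLike.congr_fun h3 (1 : ℝ)
  have h5 : (mulInvariantVectorField v (γ 0) : EG) = 0 := by
    refine Eq.trans ?_ h4
    exact (one_smul ℝ (mulInvariantVectorField v (γ 0) : EG)).symm
  rw [hγ0] at h5
  have h6 : (mulInvariantVectorField v (1 : G) : EG) = v := by
    have h7 : (fun k : G ↦ 1 * k) = id := by funext k; simp
    rw [mulInvariantVectorField, h7, mfderiv_id]
    rfl
  exact h6.symm.trans h5

end KGF

/-! ### Pairings of symmetry fields, linearity and commutators, in coordinates -/

namespace KGF.Flat

open Module Filter Set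
open scoped Topology

variable {E : Type*} [NormedAddCommGroup E] [NormedSpace ℝ E]

section TwoForm

variable {F : E → E →L[ℝ] E →L[ℝ] ℝ} {ξ η ζ : E → E} {y : E}

/-- Closedness on `ξ, η, ζ` with the three invariance equations substituted. It is the part of the
cocycle identity that concerns `F`. -/
lemma cyclic_bracket_eq_zero (halt : ∀ v w, F y v w = -F y w v)
    (hcl : ∀ u v w, fderiv ℝ F y u v w - fderiv ℝ F y v u w + fderiv ℝ F y w u v = 0)
    (hξ : ∀ v w, lieBilin F ξ y v w = 0) (hη : ∀ v w, lieBilin F η y v w = 0)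
    (hζ : ∀ v w, lieBilin F ζ y v w = 0) :
    F y (fderiv ℝ η y (ξ y) - fderiv ℝ ξ y (η y)) (ζ y)
      + F y (fderiv ℝ ξ y (ζ y) - fderiv ℝ ζ y (ξ y)) (η y)
      + F y (fderiv ℝ ζ y (η y) - fderiv ℝ η y (ζ y)) (ξ y) = 0 := by
  have h1 := hcl (ξ y) (η y) (ζ y)
  have h2 := hξ (η y) (ζ y)
  have h3 := hη (ξ y) (ζ y)
  have h4 := hζ (ξ y) (η y)
  simp only [lieBilin] at h2 h3 h4
  simp only [map_sub, sub_apply]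
  rw [halt (η y) (fderiv ℝ ξ y (ζ y))] at h2
  rw [halt (ξ y) (fderiv ℝ η y (ζ y))] at h3
  rw [halt (ξ y) (fderiv ℝ ζ y (η y))] at h4
  linarith

/-- The formula `d(F(ξ, η)) = -i_[ξ,η] F`. A moment of the field `[ξ, η]` has the same differential,
so the two functions differ by a local constant. -/
lemma hasFDerivAt_pairing (hF : ContDiffAt ℝ ∞ F y) (hξs : ContDiffAt ℝ ∞ ξ y)
    (hηs : ContDiffAt ℝ ∞ η y) (halt : ∀ v w, F y v w = -F y w v)
    (hcl : ∀ u v w, fderiv ℝ F y u v w - fderiv ℝ F y v u w + fderiv ℝ F y w u v = 0)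
    (hξ : ∀ v w, lieBilin F ξ y v w = 0) (hη : ∀ v w, lieBilin F η y v w = 0) :
    HasFDerivAt (fun z ↦ F z (ξ z) (η z))
      (-F y (fderiv ℝ η y (ξ y) - fderiv ℝ ξ y (η y))) y := by
  refine ((hF.hasFDerivAt_infty.clm_apply hξs.hasFDerivAt_infty).clm_apply
    hηs.hasFDerivAt_infty).congr_fderiv ?_
  ext u
  have h1 := hcl u (ξ y) (η y)
  have h2 := hξ (η y) u
  have h3 := hη (ξ y) u
  -- Antisymmetry of `F` is assumed only at `y`, so that of its derivative along `ξ` is deduced from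
  -- invariance.
  have h4 : fderiv ℝ F y (ξ y) u (η y) = -fderiv ℝ F y (ξ y) (η y) u := by
    have h5 := hξ u (η y)
    simp only [lieBilin] at h2 h5
    rw [halt u, halt _ (η y)] at h5
    linarith
  have h6 : fderiv ℝ F y (η y) u (ξ y) = -fderiv ℝ F y (η y) (ξ y) u := by
    have h5 := hη u (ξ y)
    simp only [lieBilin] at h3 h5
    rw [halt u, halt _ (ξ y)] at h5
    linarith
  simp only [lieBilin] at h2 h3
  rw [halt (η y)] at h2
  simp only [neg_apply, sub_apply, add_apply, map_sub, ContinuousLinearMap.comp_apply,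
    ContinuousLinearMap.flip_apply]
  linarith

end TwoForm

section Operators

variable {φ ψ : E → ℂ} {y : E}

lemma grad_linear {a : E → E →L[ℝ] ℂ} (c : ℂ) (hφ : ContDiffAt ℝ ∞ φ y)
    (hψ : ContDiffAt ℝ ∞ ψ y) :
    grad a (fun z ↦ c * φ z + ψ z) y = c • grad a φ y + grad a ψ y := by
  have h : HasFDerivAt (fun z ↦ c * φ z + ψ z) _ y :=
    (hφ.hasFDerivAt_infty.const_mul c).add hψ.hasFDerivAt_infty
  ext v
  simp only [grad, h.fderiv, add_apply, sub_apply, smul_apply, smul_eq_mul]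
  ring

lemma lieFun_linear {ξ : E → E} {b : E → ℂ} (c : ℂ) (hφ : ContDiffAt ℝ ∞ φ y)
    (hψ : ContDiffAt ℝ ∞ ψ y) :
    lieFun ξ b (fun z ↦ c * φ z + ψ z) y = c * lieFun ξ b φ y + lieFun ξ b ψ y := by
  have h : HasFDerivAt (fun z ↦ c * φ z + ψ z) _ y :=
    (hφ.hasFDerivAt_infty.const_mul c).add hψ.hasFDerivAt_infty
  simp only [lieFun, h.fderiv, add_apply, smul_apply, smul_eq_mul]
  ring

lemma trace_linear [FiniteDimensional ℝ E] (B : E →L[ℝ] E →L[ℝ] ℝ) (c : ℂ) (T T' : E → E → ℂ) :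
    trace B (fun v w ↦ c * T v w + T' v w) = c * trace B T + trace B T' := by
  simp only [trace, Finset.mul_sum, ← Finset.sum_add_distrib]
  refine Finset.sum_congr rfl fun i _ ↦ Finset.sum_congr rfl fun j _ ↦ ?_
  ring

lemma kgf_linear [FiniteDimensional ℝ E] {g : E → E →L[ℝ] E →L[ℝ] ℝ} {m : ℝ}
    {a : E → E →L[ℝ] ℂ} (ha : ContDiffAt ℝ ∞ a y) (c : ℂ)
    (hφ : ∀ᶠ z in 𝓝 y, ContDiffAt ℝ ∞ φ z) (hψ : ∀ᶠ z in 𝓝 y, ContDiffAt ℝ ∞ ψ z) :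
    kgf g m a (fun z ↦ c * φ z + ψ z) y = c * kgf g m a φ y + kgf g m a ψ y := by
  have h1 : grad a (fun z ↦ c * φ z + ψ z) =ᶠ[𝓝 y] fun z ↦ c • grad a φ z + grad a ψ z := by
    filter_upwards [hφ, hψ] with z h1 h2 using grad_linear c h1 h2
  have h2 : HasFDerivAt (fun z ↦ c • grad a φ z + grad a ψ z) _ y :=
    ((contDiffAt_grad ha hφ.self_of_nhds).hasFDerivAt_infty.const_smul c).add
      (contDiffAt_grad ha hψ.self_of_nhds).hasFDerivAt_infty
  have h3 : ∀ v w, covDeriv g a (grad a (fun z ↦ c * φ z + ψ z)) y v w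
      = c * covDeriv g a (grad a φ) y v w + covDeriv g a (grad a ψ) y v w := by
    intro v w
    simp only [covDeriv_apply, h1.fderiv_eq, h1.eq_of_nhds, h2.fderiv, add_apply, smul_apply,
      smul_eq_mul]
    ring
  simp only [kgf, h3, trace_linear]
  ring

lemma lieFun_congr {ξ : E → E} {b : E → ℂ} (h : φ =ᶠ[𝓝 y] ψ) :
    lieFun ξ b φ y = lieFun ξ b ψ y := by
  rw [lieFun, lieFun, h.fderiv_eq, h.eq_of_nhds]

/-- The second derivatives of `φ` and the products `b b'` cancel, so a first order operator remains.
-/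
lemma lieFun_commutator {ξ η : E → E} {b b' : E → ℂ} (hξ : ContDiffAt ℝ ∞ ξ y)
    (hη : ContDiffAt ℝ ∞ η y) (hb : ContDiffAt ℝ ∞ b y) (hb' : ContDiffAt ℝ ∞ b' y)
    (hφ : ContDiffAt ℝ ∞ φ y) :
    lieFun ξ b (lieFun η b' φ) y - lieFun η b' (lieFun ξ b φ) y
      = fderiv ℝ φ y (fderiv ℝ η y (ξ y) - fderiv ℝ ξ y (η y))
        - (fderiv ℝ b' y (ξ y) - fderiv ℝ b y (η y)) * φ y := by
  have h1 : HasFDerivAt (lieFun ξ b φ) _ y :=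
    (hφ.fderiv_infty.hasFDerivAt_infty.clm_apply hξ.hasFDerivAt_infty).sub
      (hb.hasFDerivAt_infty.mul hφ.hasFDerivAt_infty)
  have h2 : HasFDerivAt (lieFun η b' φ) _ y :=
    (hφ.fderiv_infty.hasFDerivAt_infty.clm_apply hη.hasFDerivAt_infty).sub
      (hb'.hasFDerivAt_infty.mul hφ.hasFDerivAt_infty)
  rw [lieFun, h2.fderiv, lieFun.eq_def η b' (lieFun ξ b φ), h1.fderiv]
  simp only [lieFun, add_apply, sub_apply, smul_apply, smul_eq_mul, map_sub,
    ContinuousLinearMap.comp_apply, ContinuousLinearMap.flip_apply]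
  rw [hφ.fderiv_fderiv_symm (ξ y)]
  ring

end Operators

end KGF.Flat

/-! ### Moments for all Lie algebra elements and the cocycle -/

namespace KGF

open Module Filter Flat Set
open scoped Topology

section

variable {E : Type*} [NormedAddCommGroup E] [NormedSpace ℝ E]
  {M : Type*} [TopologicalSpace M] [ChartedSpace E M] [IsManifold 𝓘(ℝ, E) ∞ M]

/-- A function whose derivative vanishes is constant on preconnected open sets. -/
lemma eq_of_coord_fderiv_eq_zero {f : M → ℝ} {U : Set M} (hU : IsOpen U) (hUc : IsPreconnected U)
    (h : ∀ p, ∀ y ∈ dom E p, param E p y ∈ U → HasFDerivAt (f ∘ param E p) (0 : E →L[ℝ] ℝ) y)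
    {x x' : M} (hx : x ∈ U) (hx' : x' ∈ U) : f x = f x' := by
  -- Equality of values is an equivalence relation, so on a preconnected set it suffices to
  -- establish it near each point, inside a coordinate ball.
  refine hUc.induction₂ (fun a b ↦ f a = f b) (fun p hp ↦ ?_) (fun _ _ _ _ _ _ ↦ Eq.trans)
    (fun _ _ _ _ ↦ Eq.symm) hx hx'
  set c := extChartAt 𝓘(ℝ, E) p p with hc
  have hcd : c ∈ dom E p := self_mem_dom p
  have hev : ∀ᶠ y in 𝓝 c, y ∈ dom E p ∧ param E p y ∈ U :=
    Filter.Eventually.and (dom_mem_nhds hcd) ((continuousAt_param hcd).eventually_mem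
      (hU.mem_nhds (by rw [hc, param_self]; exact hp)))
  obtain ⟨r, hr, hrd⟩ := Metric.mem_nhds_iff.1 hev
  have hpr : ∀ᶠ q in 𝓝 p, q ∈ (chartAt E p).source ∧ extChartAt 𝓘(ℝ, E) p q ∈ Metric.ball c r :=
    Filter.Eventually.and ((chartAt E p).open_source.mem_nhds (mem_chart_source E p))
      ((continuousAt_extChartAt (I := 𝓘(ℝ, E)) p).eventually_mem (Metric.ball_mem_nhds c hr))
  filter_upwards [mem_nhdsWithin_of_mem_nhds hpr] with q ⟨hq1, hq2⟩
  have hd : ∀ y ∈ Metric.ball c r, HasFDerivAt (f ∘ param E p) (0 : E →L[ℝ] ℝ) y := fun y hy ↦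
    h p y (hrd hy).1 (hrd hy).2
  have key := Metric.isOpen_ball.is_const_of_fderiv_eq_zero (𝕜 := ℝ) (convex_ball c r).isPreconnected
    (fun y hy ↦ (hd y hy).differentiableAt.differentiableWithinAt) (fun y hy ↦ (hd y hy).fderiv)
    (Metric.mem_ball_self hr) hq2
  rwa [Function.comp_apply, Function.comp_apply, hc, param_self, param_chart hq1] at key

end

variable {E : Type*} [NormedAddCommGroup E] [NormedSpace ℝ E] [FiniteDimensional ℝ E]
  {M : Type*} [TopologicalSpace M] [ChartedSpace E M] [IsManifold 𝓘(ℝ, E) ∞ M]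
  {EG : Type*} [NormedAddCommGroup EG] [NormedSpace ℝ EG] [FiniteDimensional ℝ EG]
  {G : Type*} [TopologicalSpace G] [ChartedSpace EG G] [Group G] [LieGroup 𝓘(ℝ, EG) ∞ G]
  [MulAction G M] {ι : Type*} [Fintype ι] (e : Basis ι ℝ (GroupLieAlgebra 𝓘(ℝ, EG) G))

/-- The function `χ_v` for an element `v` of the Lie algebra. -/
def moment (χ : ι → M → ℝ) (v : GroupLieAlgebra 𝓘(ℝ, EG) G) (x : M) : ℝ :=
  ∑ a, e.repr v a * χ a x

lemma moment_add (χ : ι → M → ℝ) (v w : GroupLieAlgebra 𝓘(ℝ, EG) G) (x : M) :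
    moment e χ (v + w) x = moment e χ v x + moment e χ w x := by
  simp only [moment, map_add, Finsupp.add_apply, add_mul, Finset.sum_add_distrib]

lemma moment_smul (χ : ι → M → ℝ) (c : ℝ) (v : GroupLieAlgebra 𝓘(ℝ, EG) G) (x : M) :
    moment e χ (c • v) x = c * moment e χ v x := by
  simp only [moment, map_smul, Finsupp.smul_apply, smul_eq_mul, mul_assoc, Finset.mul_sum]

lemma moment_basis (χ : ι → M → ℝ) (a : ι) (x : M) : moment e χ (e a) x = χ a x := by
  classical
  rw [moment, Finset.sum_eq_single a]
  · simp
  · intro b _ hb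
    simp [Finsupp.single_eq_of_ne hb]
  · simp

variable {e}

/-- Generators and moments are linear in the Lie algebra element, so the moment equation passes from
the basis to every `v` and later arguments need no structure constants. -/
lemma isMomentOn_moment {F : Bilin E M} {χ : ι → M → ℝ} {U : Set M} (hU : IsOpen U)
    (hχ : ∀ a, IsMomentOn F (generator (e a)) (χ a) U) (v : GroupLieAlgebra 𝓘(ℝ, EG) G) :
    IsMomentOn F (generator v) (moment e χ v) U := by
  have hs : ∀ p, ∀ y ∈ dom E p, param E p y ∈ U →
      HasFDerivAt (moment e χ v ∘ param E p)
        (∑ a, e.repr v a • fderiv ℝ (χ a ∘ param E p) y) y ∧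
      ContDiffAt ℝ ∞ (moment e χ v ∘ param E p) y := fun p y hy hyU ↦
    ⟨HasFDerivAt.fun_sum fun a _ ↦
      ((hχ a).contDiffAt hU hy hyU).hasFDerivAt_infty.const_mul (e.repr v a),
    ContDiffAt.sum fun a _ ↦ contDiffAt_const.mul ((hχ a).contDiffAt hU hy hyU)⟩
  constructor
  · intro x hx
    obtain ⟨p, hp⟩ : ∃ p, x ∈ (chartAt E p).source := ⟨x, mem_chart_source E x⟩
    obtain ⟨y, hy, rfl⟩ := exists_eq_param hp
    exact ((contMDiffAt_param_iff hy).2 (hs p y hy hx).2).contMDiffWithinAt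
  · intro x hx u
    obtain ⟨p, hp⟩ : ∃ p, x ∈ (chartAt E p).source := ⟨x, mem_chart_source E x⟩
    obtain ⟨y, hy, rfl⟩ := exists_eq_param hp
    let l : GroupLieAlgebra 𝓘(ℝ, EG) G →ₗ[ℝ] ℝ :=
      { toFun := fun v ↦ F (param E p y) (generator v (param E p y)) u
        map_add' := fun v w ↦ by rw [generator_add, map_add]; rfl
        map_smul' := fun c v ↦ by rw [generator_smul, map_smul]; rfl }
    have hl : l v = ∑ a, e.repr v a *
        F (param E p y) (generator (e a) (param E p y)) u := by
      conv_lhs => rw [← e.sum_repr v, map_sum]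
      exact Finset.sum_congr rfl fun a _ ↦ map_smul l _ _
    have hl' : F (param E p y) (generator v (param E p y)) u = ∑ a, e.repr v a *
        F (param E p y) (generator (e a) (param E p y)) u := hl
    rw [mvfderiv_param _ hy, (hs p y hy hx).1.fderiv, hl', FunLike.coe_sum, Finset.sum_apply,
      ← Finset.sum_neg_distrib]
    refine Finset.sum_congr rfl fun a _ ↦ ?_
    have h1 := (hχ a).deriv_eq _ hx u
    rw [mvfderiv_param _ hy] at h1
    rw [smul_apply, h1, smul_eq_mul, mul_neg]

variable (e) in
/-- The expression `F(ξ_v, ξ_w) - χ_[v, w]`. -/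
def cocycleFun (F : Bilin E M) (χ : ι → M → ℝ) (v w : GroupLieAlgebra 𝓘(ℝ, EG) G) (x : M) : ℝ :=
  F x (generator v x) (generator w x) - moment e χ ⁅v, w⁆ x

lemma coordVec_generator_lie
    (hsmooth : ContMDiff (𝓘(ℝ, EG).prod 𝓘(ℝ, E)) 𝓘(ℝ, E) ∞ (fun p : G × M ↦ p.1 • p.2))
    (v w : GroupLieAlgebra 𝓘(ℝ, EG) G) {p : M} {y : E} (hy : y ∈ dom E p) :
    coordVec p (generator ⁅v, w⁆) y
      = fderiv ℝ (coordVec p (generator w)) y (coordVec p (generator v) y)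
        - fderiv ℝ (coordVec p (generator v)) y (coordVec p (generator w) y) := by
  rw [← coordVec_mlieBracket hy (generator_diffAt hsmooth v _) (generator_diffAt hsmooth w _),
    mlieBracket_generator hsmooth]
  rfl

section

variable {F : Bilin E M} {χ : ι → M → ℝ} {U : Set M}

lemma cocycleFun_eq
    (hsmooth : ContMDiff (𝓘(ℝ, EG).prod 𝓘(ℝ, E)) 𝓘(ℝ, E) ∞ (fun p : G × M ↦ p.1 • p.2))
    (hF : IsClosedTwoForm F) (hFinv : ∀ h : G, F.InvariantUnder (fun x : M ↦ h • x))
    (hU : IsOpen U) (hUc : IsPreconnected U) (hχ : ∀ a, IsMomentOn F (generator (e a)) (χ a) U)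
    (v w : GroupLieAlgebra 𝓘(ℝ, EG) G) {x x' : M} (hx : x ∈ U) (hx' : x' ∈ U) :
    cocycleFun e F χ v w x = cocycleFun e F χ v w x' := by
  refine eq_of_coord_fderiv_eq_zero (E := E) hU hUc (fun p y hy hyU ↦ ?_) hx hx'
  have h1 := hasFDerivAt_pairing (hF.smooth.coordBilin hy)
    (contDiffAt_coordVec_generator hsmooth v hy) (contDiffAt_coordVec_generator hsmooth w hy)
    (hF.coordBilin_neg_swap p y) (hF.fderiv_coordBilin hy)
    (lieBilin_generator hsmooth hF.smooth hFinv v hy)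
    (lieBilin_generator hsmooth hF.smooth hFinv w hy)
  have hm := isMomentOn_moment hU hχ ⁅v, w⁆
  have h2 := (hm.contDiffAt hU hy hyU).hasFDerivAt_infty
  have h3 : cocycleFun e F χ v w ∘ param E p =ᶠ[𝓝 y] fun z ↦
      coordBilin p F z (coordVec p (generator v) z) (coordVec p (generator w) z)
        - (moment e χ ⁅v, w⁆ ∘ param E p) z := by
    filter_upwards [dom_mem_nhds hy] with z hz
    rw [coordBilin_coordVec F _ _ hz]
    rfl
  refine ((h1.sub h2).congr_of_eventuallyEq h3).congr_fderiv ?_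
  ext u
  rw [sub_apply, neg_apply, hm.fderiv_eq hy hyU, coordVec_generator_lie hsmooth v w hy]
  simp

lemma cyclic_generator_eq_zero
    (hsmooth : ContMDiff (𝓘(ℝ, EG).prod 𝓘(ℝ, E)) 𝓘(ℝ, E) ∞ (fun p : G × M ↦ p.1 • p.2))
    (hF : IsClosedTwoForm F) (hFinv : ∀ h : G, F.InvariantUnder (fun x : M ↦ h • x))
    (u v w : GroupLieAlgebra 𝓘(ℝ, EG) G) (x : M) :
    F x (generator ⁅u, v⁆ x) (generator w x) + F x (generator ⁅w, u⁆ x) (generator v x)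
      + F x (generator ⁅v, w⁆ x) (generator u x) = 0 := by
  obtain ⟨p, hp⟩ : ∃ p, x ∈ (chartAt E p).source := ⟨x, mem_chart_source E x⟩
  obtain ⟨y, hy, rfl⟩ := exists_eq_param hp
  have h := cyclic_bracket_eq_zero (hF.coordBilin_neg_swap p y) (hF.fderiv_coordBilin hy)
    (lieBilin_generator hsmooth hF.smooth hFinv u hy)
    (lieBilin_generator hsmooth hF.smooth hFinv v hy)
    (lieBilin_generator hsmooth hF.smooth hFinv w hy)
  rw [← coordVec_generator_lie hsmooth u v hy, ← coordVec_generator_lie hsmooth v w hy,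
    ← coordVec_generator_lie hsmooth w u hy, coordBilin_coordVec F _ _ hy,
    coordBilin_coordVec F _ _ hy, coordBilin_coordVec F _ _ hy] at h
  exact h

variable (e) in
/-- The expression `F(ξ_v, ξ_w) - χ_[v, w]` at a point as a cochain. -/
def cocycleCochain (hF : IsClosedTwoForm F) (χ : ι → M → ℝ) (x : M) :
    LieModule.Cohomology.twoCochain ℝ (GroupLieAlgebra 𝓘(ℝ, EG) G)
      (TrivialLieModule ℝ (GroupLieAlgebra 𝓘(ℝ, EG) G) ℝ) where
  val := LinearMap.mk₂ ℝ (fun v w ↦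
      (TrivialLieModule.equiv ℝ (GroupLieAlgebra 𝓘(ℝ, EG) G) ℝ).symm (cocycleFun e F χ v w x))
    (fun v v' w ↦ by
      rw [← map_add]
      congr 1
      simp only [cocycleFun, generator_add, map_add, add_lie, moment_add, add_apply]
      ring)
    (fun c v w ↦ by
      rw [← map_smul]
      congr 1
      simp only [cocycleFun, generator_smul, map_smul, smul_lie, moment_smul, smul_apply,
        smul_eq_mul]
      ring)
    (fun v w w' ↦ by
      rw [← map_add]
      congr 1
      simp only [cocycleFun, generator_add, map_add, lie_add, moment_add]
      ring)
    (fun c v w ↦ by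
      rw [← map_smul]
      congr 1
      simp only [cocycleFun, generator_smul, map_smul, lie_smul, moment_smul, smul_eq_mul]
      ring)
  property := fun v ↦ by
    have h : cocycleFun e F χ v v x = 0 := by
      rw [cocycleFun, hF.alternating, lie_self]
      simp [moment]
    rw [LinearMap.mk₂_apply, h, map_zero]

end

end KGF

/-! ### The operators on smooth functions on the open set and their commutators -/

namespace KGF

open Module Filter Flat Set
open scoped Topology

section SmoothFun

variable {E : Type*} [NormedAddCommGroup E] [NormedSpace ℝ E]
  {M : Type*} [TopologicalSpace M] [ChartedSpace E M] {U : Set M}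

lemma smoothFun_ext {φ ψ : SmoothFun E U}
    (h : ∀ x ∈ U, (φ : M → ℂ) x = (ψ : M → ℂ) x) : φ = ψ := by
  refine Subtype.ext (funext fun x ↦ ?_)
  by_cases hx : x ∈ U
  · exact h x hx
  · rw [φ.2.2 x hx, ψ.2.2 x hx]

/-- The operator on `C^∞(U, ℂ)` given by an expression that preserves smoothness on `U`. -/
lemma exists_isGivenBy (D : (M → ℂ) → M → ℂ)
    (hsm : ∀ φ ∈ SmoothFun E U, ContMDiffOn 𝓘(ℝ, E) 𝓘(ℝ, ℂ) ∞ (D φ) U)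
    (hlin : ∀ (c : ℂ), ∀ φ ∈ SmoothFun E U, ∀ ψ ∈ SmoothFun E U, ∀ x ∈ U,
      D (fun z ↦ c * φ z + ψ z) x = c * D φ x + D ψ x) :
    ∃ T : Module.End ℂ (SmoothFun E U), IsGivenBy T D := by
  classical
  -- Off `U` the expression `D φ` has no meaning, while elements of `SmoothFun` vanish there; the
  -- indicator restores this convention.
  have hmem : ∀ φ : SmoothFun E U, U.indicator (D φ) ∈ SmoothFun E U := fun φ ↦
    ⟨(hsm φ φ.2).congr fun x hx ↦ indicator_of_mem hx _, fun x hx ↦ indicator_of_notMem hx _⟩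
  have hadd : ∀ φ ψ : SmoothFun E U, ∀ x ∈ U,
      D (φ + ψ : SmoothFun E U) x = D φ x + D ψ x := fun φ ψ x hx ↦ by
    have h := hlin 1 φ φ.2 ψ ψ.2 x hx
    simp only [one_mul] at h
    exact h
  have h0 : ∀ x ∈ U, D (0 : SmoothFun E U) x = 0 := fun x hx ↦ by
    have h := hadd 0 0 x hx
    rw [add_zero] at h
    simpa using h
  have hsmul : ∀ (c : ℂ) (φ : SmoothFun E U), ∀ x ∈ U,
      D (c • φ : SmoothFun E U) x = c * D φ x := fun c φ x hx ↦ by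
    have h := hlin c φ φ.2 ((0 : SmoothFun E U) : M → ℂ) (SmoothFun E U).zero_mem x hx
    rw [h0 x hx, add_zero] at h
    rw [← h]
    congr 1
    funext z
    simp
  refine ⟨{ toFun := fun φ ↦ ⟨U.indicator (D φ), hmem φ⟩, map_add' := ?_, map_smul' := ?_ }, ?_⟩
  · refine fun φ ψ ↦ smoothFun_ext fun x hx ↦ ?_
    change U.indicator (D _) x = U.indicator (D φ) x + U.indicator (D ψ) x
    rw [indicator_of_mem hx, indicator_of_mem hx, indicator_of_mem hx, hadd φ ψ x hx]
  · refine fun c φ ↦ smoothFun_ext fun x hx ↦ ?_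
    change U.indicator (D _) x = c * U.indicator (D φ) x
    rw [indicator_of_mem hx, indicator_of_mem hx, hsmul c φ x hx]
  · exact fun φ x hx ↦ indicator_of_mem hx _

lemma isGivenBy_const (c : ℂ) :
    IsGivenBy (c • (1 : Module.End ℂ (SmoothFun E U))) (fun φ x ↦ c * φ x) := fun _ _ _ ↦ rfl

lemma lie_smul_one (c : ℂ) (T : Module.End ℂ (SmoothFun E U)) :
    ⁅T, c • (1 : Module.End ℂ (SmoothFun E U))⁆ = 0 := by
  rw [Ring.lie_def, mul_smul_comm, smul_mul_assoc, mul_one, one_mul, sub_self]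

end SmoothFun

variable {E : Type*} [NormedAddCommGroup E] [NormedSpace ℝ E] [FiniteDimensional ℝ E]
  {M : Type*} [TopologicalSpace M] [ChartedSpace E M] [IsManifold 𝓘(ℝ, E) ∞ M] {U : Set M}

lemma eventually_dom_mem (hU : IsOpen U) {p : M} {y : E} (hy : y ∈ dom E p)
    (hyU : param E p y ∈ U) : ∀ᶠ z in 𝓝 y, z ∈ dom E p ∧ param E p z ∈ U :=
  Filter.Eventually.and (dom_mem_nhds hy)
    ((continuousAt_param hy).eventually_mem (hU.mem_nhds hyU))

lemma contDiffAt_smoothFun (hU : IsOpen U) {φ : M → ℂ} (hφ : φ ∈ SmoothFun E U) {p : M} {y : E}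
    (hy : y ∈ dom E p) (hyU : param E p y ∈ U) : ContDiffAt ℝ ∞ (φ ∘ param E p) y :=
  (contMDiffAt_param_iff hy).1 (hφ.1.contMDiffAt (hU.mem_nhds hyU))

lemma contMDiffOn_of_coord {f : M → ℂ}
    (h : ∀ p, ∀ y ∈ dom E p, param E p y ∈ U → ContDiffAt ℝ ∞ (f ∘ param E p) y) :
    ContMDiffOn 𝓘(ℝ, E) 𝓘(ℝ, ℂ) ∞ f U := by
  intro x hx
  obtain ⟨p, hp⟩ : ∃ p, x ∈ (chartAt E p).source := ⟨x, mem_chart_source E x⟩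
  obtain ⟨y, hy, rfl⟩ := exists_eq_param hp
  exact ((contMDiffAt_param_iff hy).2 (h p y hy hx)).contMDiffWithinAt

variable {F : Bilin E M} {A : Covector E M} (hU : IsOpen U) (hA : IsPotentialOn F A U)

include hU hA in
lemma exists_kgf (g : PseudoRiemannianMetric E M) (m ε : ℝ) :
    ∃ H : Module.End ℂ (SmoothFun E U), IsGivenBy H (kgf g m ε A) := by
  have hkgf : ∀ φ ∈ SmoothFun E U, ∀ p, ∀ y ∈ dom E p, param E p y ∈ U →
      kgf g m ε A φ (param E p y) = Flat.kgf (coordBilin p g.val) m (connForm ε (coordCov p A))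
        (φ ∘ param E p) y := fun φ hφ p y hy hyU ↦
    kgf_param g m ε A φ hy (hA.contDiffAt_coordCov hU hy hyU) (contDiffAt_smoothFun hU hφ hy hyU)
  refine exists_isGivenBy _ (fun φ hφ ↦ contMDiffOn_of_coord fun p y hy hyU ↦ ?_)
    fun c φ hφ ψ hψ x hx ↦ ?_
  · refine (contDiffAt_kgf (m := m) (g.smooth.coordBilin hy) (coordBilin_nondegenerate g hy)
      (contDiffAt_connForm (ε := ε) (hA.contDiffAt_coordCov hU hy hyU))
      (contDiffAt_smoothFun hU hφ hy hyU)).congr_of_eventuallyEq ?_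
    filter_upwards [eventually_dom_mem hU hy hyU] with z hz using hkgf φ hφ p z hz.1 hz.2
  · obtain ⟨p, hp⟩ : ∃ p, x ∈ (chartAt E p).source := ⟨x, mem_chart_source E x⟩
    obtain ⟨y, hy, rfl⟩ := exists_eq_param hp
    have hev := eventually_dom_mem hU hy hx
    have h1 : (fun z ↦ c * φ z + ψ z) ∈ SmoothFun E U :=
      (SmoothFun E U).add_mem ((SmoothFun E U).smul_mem c hφ) hψ
    rw [hkgf _ h1 p y hy hx, hkgf φ hφ p y hy hx, hkgf ψ hψ p y hy hx]
    exact kgf_linear (contDiffAt_connForm (hA.contDiffAt_coordCov hU hy hx)) c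
      (hev.mono fun z hz ↦ contDiffAt_smoothFun hU hφ hz.1 hz.2)
      (hev.mono fun z hz ↦ contDiffAt_smoothFun hU hψ hz.1 hz.2)

variable {ξ : VField E M} {χ : M → ℝ}
  (hξ : ∀ p, ∀ y ∈ dom E p, ContDiffAt ℝ ∞ (coordVec p ξ) y) (hχ : IsMomentOn F ξ χ U)

include hU hA hξ hχ in
lemma contDiffAt_gaugeFun_coord (ε : ℝ) {p : M} {y : E} (hy : y ∈ dom E p)
    (hyU : param E p y ∈ U) :
    ContDiffAt ℝ ∞ (gaugeFun ε (coordCov p A) (coordVec p ξ) (χ ∘ param E p)) y :=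
  contDiffAt_gaugeFun (hA.contDiffAt_coordCov hU hy hyU) (hξ p y hy) (hχ.contDiffAt hU hy hyU)

include hU hA hξ hχ in
lemma exists_symOp (ε : ℝ) :
    ∃ X : Module.End ℂ (SmoothFun E U), IsGivenBy X (symOp ε A ξ χ) := by
  refine exists_isGivenBy _ (fun φ hφ ↦ contMDiffOn_of_coord fun p y hy hyU ↦ ?_)
    fun c φ hφ ψ hψ x hx ↦ ?_
  · refine (contDiffAt_lieFun (hξ p y hy) (contDiffAt_gaugeFun_coord hU hA hξ hχ ε hy hyU)
      (contDiffAt_smoothFun hU hφ hy hyU)).congr_of_eventuallyEq ?_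
    filter_upwards [dom_mem_nhds hy] with z hz using symOp_param ε A ξ χ φ hz
  · obtain ⟨p, hp⟩ : ∃ p, x ∈ (chartAt E p).source := ⟨x, mem_chart_source E x⟩
    obtain ⟨y, hy, rfl⟩ := exists_eq_param hp
    rw [symOp_param ε A ξ χ _ hy, symOp_param ε A ξ χ _ hy, symOp_param ε A ξ χ _ hy]
    exact lieFun_linear c (contDiffAt_smoothFun hU hφ hy hx) (contDiffAt_smoothFun hU hψ hy hx)

include hU hA hξ hχ in
/-- The Klein-Gordon-Fock operator commutes with the symmetry operator of a Killing field. -/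
theorem kgf_symOp_comm (g : PseudoRiemannianMetric E M) (m ε : ℝ)
    (hLie : ∀ p, ∀ y ∈ dom E p, ∀ v w, lieBilin (coordBilin p g.val) (coordVec p ξ) y v w = 0)
    {H X : Module.End ℂ (SmoothFun E U)} (hH : IsGivenBy H (kgf g m ε A))
    (hX : IsGivenBy X (symOp ε A ξ χ)) : ⁅H, X⁆ = 0 := by
  rw [Ring.lie_def, sub_eq_zero]
  refine LinearMap.ext fun φ ↦ smoothFun_ext fun x hx ↦ ?_
  obtain ⟨p, hp⟩ : ∃ p, x ∈ (chartAt E p).source := ⟨x, mem_chart_source E x⟩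
  obtain ⟨y, hy, rfl⟩ := exists_eq_param hp
  have hev := eventually_dom_mem hU hy hx
  have hAy := fun z (hz : z ∈ dom E p ∧ param E p z ∈ U) ↦ hA.contDiffAt_coordCov hU hz.1 hz.2
  have hH' : ∀ φ : SmoothFun E U, (H φ : M → ℂ) ∘ param E p =ᶠ[𝓝 y]
      Flat.kgf (coordBilin p g.val) m (connForm ε (coordCov p A)) (φ ∘ param E p) := fun φ ↦ by
    filter_upwards [hev] with z hz
    exact (hH φ _ hz.2).trans (kgf_param g m ε A φ hz.1 (hAy z hz)
      (contDiffAt_smoothFun hU φ.2 hz.1 hz.2))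
  have hX' : ∀ φ : SmoothFun E U, (X φ : M → ℂ) ∘ param E p =ᶠ[𝓝 y] lieFun (coordVec p ξ)
      (gaugeFun ε (coordCov p A) (coordVec p ξ) (χ ∘ param E p)) (φ ∘ param E p) := fun φ ↦ by
    filter_upwards [hev] with z hz
    exact (hX φ _ hz.2).trans (symOp_param ε A ξ χ φ hz.1)
  have h1 : (H (X φ) : M → ℂ) (param E p y) = _ := (hH' (X φ)).eq_of_nhds
  have h2 : (X (H φ) : M → ℂ) (param E p y) = _ := (hX' (H φ)).eq_of_nhds
  change (H (X φ) : M → ℂ) (param E p y) = (X (H φ) : M → ℂ) (param E p y)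
  -- The outer operator sees only the germ of the inner result, and that germ is the coordinate
  -- expression.
  rw [h1, h2, kgf_congr (hX' φ), lieFun_congr (hH' φ)]
  exact kgf_lieFun (g.smooth.coordBilin hy) (Eventually.of_forall (coordBilin_symm g p))
    (hev.mono fun z hz ↦ coordBilin_nondegenerate g hz.1) (hev.mono fun z hz ↦ hLie p z hz.1)
    (hev.mono fun z hz ↦ hξ p z hz.1) (hev.mono fun z hz ↦ contDiffAt_connForm (hAy z hz))
    (hev.mono fun z hz ↦ contDiffAt_gaugeFun_coord hU hA hξ hχ ε hz.1 hz.2)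
    (hev.mono fun z hz ↦ contDiffAt_smoothFun hU φ.2 hz.1 hz.2)
    (hev.mono fun z hz ↦ isGauge_gaugeFun (hAy z hz) (hξ p z hz.1)
      (hχ.contDiffAt hU hz.1 hz.2) (hA.fderiv_coordCov hU hz.1 hz.2) (hχ.fderiv_eq hz.1 hz.2))

variable {η ζ : VField E M} {χη χζ : M → ℝ}
  (hη : ∀ p, ∀ y ∈ dom E p, ContDiffAt ℝ ∞ (coordVec p η) y) (hχη : IsMomentOn F η χη U)

include hU hA hξ hχ hη hχη in
/-- The commutator of two symmetry operators. -/
theorem symOp_commutator (ε : ℝ) (hζ : ∀ p, ∀ y ∈ dom E p, coordVec p ζ y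
      = fderiv ℝ (coordVec p η) y (coordVec p ξ y) - fderiv ℝ (coordVec p ξ) y (coordVec p η y))
    {X Y : Module.End ℂ (SmoothFun E U)} (hX : IsGivenBy X (symOp ε A ξ χ))
    (hY : IsGivenBy Y (symOp ε A η χη)) (φ : SmoothFun E U) {x : M} (hx : x ∈ U) :
    (⁅X, Y⁆ φ : M → ℂ) x = symOp ε A ζ χζ φ x
      + ((F x (ξ x) (η x) - χζ x : ℝ) : ℂ) * (Complex.I * (ε : ℂ) * (φ : M → ℂ) x) := by
  obtain ⟨p, hp⟩ : ∃ p, x ∈ (chartAt E p).source := ⟨x, mem_chart_source E x⟩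
  obtain ⟨y, hy, rfl⟩ := exists_eq_param hp
  have hev := eventually_dom_mem hU hy hx
  have hop : ∀ {ξ : VField E M} {χ : M → ℝ} {X : Module.End ℂ (SmoothFun E U)},
      IsGivenBy X (symOp ε A ξ χ) → ∀ φ : SmoothFun E U,
      (X φ : M → ℂ) ∘ param E p =ᶠ[𝓝 y] lieFun (coordVec p ξ)
        (gaugeFun ε (coordCov p A) (coordVec p ξ) (χ ∘ param E p)) (φ ∘ param E p) := by
    intro ξ χ X hX φ
    filter_upwards [hev] with z hz
    exact (hX φ _ hz.2).trans (symOp_param ε A ξ χ φ hz.1)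
  have h1 : (X (Y φ) : M → ℂ) (param E p y) = _ := (hop hX (Y φ)).eq_of_nhds
  have h2 : (Y (X φ) : M → ℂ) (param E p y) = _ := (hop hY (X φ)).eq_of_nhds
  have h3 := lieFun_commutator (hξ p y hy) (hη p y hy)
    (contDiffAt_gaugeFun_coord hU hA hξ hχ ε hy hx)
    (contDiffAt_gaugeFun_coord hU hA hη hχη ε hy hx) (contDiffAt_smoothFun hU φ.2 hy hx)
  have hAy := hA.contDiffAt_coordCov hU hy hx
  -- The gauge relations evaluate the zeroth order part: `ξ(b') - η(b) = iε(A(ζ) - F(ξ, η))`, where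
  -- `ζ = [ξ, η]`. The function `χζ` is arbitrary, since it cancels between the two terms of the
  -- right side.
  have h4 := isGauge_gaugeFun (ε := ε) hAy (hξ p y hy)
      (hχ.contDiffAt hU hy hx) (hA.fderiv_coordCov hU hy hx) (hχ.fderiv_eq hy hx) (coordVec p η y)
  have h5 := isGauge_gaugeFun (ε := ε) hAy (hη p y hy)
      (hχη.contDiffAt hU hy hx) (hA.fderiv_coordCov hU hy hx) (hχη.fderiv_eq hy hx)
      (coordVec p ξ y)
  have h6 : ∀ v w, fderiv ℝ (connForm ε (coordCov p A)) y v w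
      = Complex.I * (ε : ℂ) * (fderiv ℝ (coordCov p A) y v w : ℂ) := fun v w ↦ by
    have h : HasFDerivAt (connForm ε (coordCov p A)) _ y :=
      ((ContinuousLinearMap.compL ℝ E ℝ ℂ Complex.ofRealCLM).hasFDerivAt.comp y
        hAy.hasFDerivAt_infty).const_smul (Complex.I * (ε : ℂ))
    rw [h.fderiv]
    rfl
  change (X (Y φ) : M → ℂ) (param E p y) - (Y (X φ) : M → ℂ) (param E p y) = _
  rw [h1, h2, lieFun_congr (hop hY φ), lieFun_congr (hop hX φ), h3, h4, h5,
    symOp_param ε A ζ χζ φ hy, lieFun, hζ p y hy, gaugeFun, hζ p y hy, h6, h6, connForm_apply,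
    connForm_apply, ← coordBilin_coordVec F ξ η hy, ← hA.fderiv_coordCov hU hy hx]
  simp only [map_sub, Function.comp_apply]
  push_cast
  ring

end KGF

/-! ### Test functions, linearity in the Lie algebra, the cocycle identity -/

namespace KGF

open Module Filter Flat Set
open scoped Topology

section TestFunctions

variable {E : Type*} [NormedAddCommGroup E] [NormedSpace ℝ E] [FiniteDimensional ℝ E]
  {M : Type*} [TopologicalSpace M] [ChartedSpace E M] [IsManifold 𝓘(ℝ, E) ∞ M] {U : Set M}

/-- A smooth function on `U` with a prescribed first jet. -/
lemma exists_smoothFun_fderiv [T2Space M] (hU : IsOpen U) {p : M} (hp : p ∈ U) (l : E →L[ℝ] ℝ) :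
    ∃ φ : SmoothFun E U, (φ : M → ℂ) p = 0 ∧ ∀ v : TangentSpace 𝓘(ℝ, E) p,
      mvfderiv 𝓘(ℝ, E) (φ : M → ℂ) p v = (l (chartDeriv p p v) : ℂ) := by
  classical
  -- The function is a linear form in the chart, centred at `p` and multiplied by a bump function
  -- equal to `1` near `p`.
  let f : SmoothBumpFunction 𝓘(ℝ, E) p := Classical.arbitrary _
  let c : M → ℂ := fun x ↦ (l (extChartAt 𝓘(ℝ, E) p x - extChartAt 𝓘(ℝ, E) p p) : ℂ)
  have hc : ContMDiffOn 𝓘(ℝ, E) 𝓘(ℝ, ℂ) ∞ c (chartAt E p).source := by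
    have h1 : ContDiff ℝ ∞ fun y : E ↦ ((l (y - extChartAt 𝓘(ℝ, E) p p) : ℝ) : ℂ) :=
      Complex.ofRealCLM.contDiff.comp (l.contDiff.comp (contDiff_id.sub contDiff_const))
    exact h1.contMDiff.comp_contMDiffOn contMDiffOn_extChartAt
  have hs : ContMDiff 𝓘(ℝ, E) 𝓘(ℝ, ℂ) ∞ fun x ↦ f x • c x := f.contMDiff_smul hc
  let φ : M → ℂ := U.indicator fun x ↦ f x • c x
  have hφ : φ ∈ SmoothFun E U :=
    ⟨hs.contMDiffOn.congr fun x hx ↦ indicator_of_mem hx _, fun x hx ↦ indicator_of_notMem hx _⟩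
  have hev : ∀ᶠ x in 𝓝 p, φ x = c x := by
    filter_upwards [hU.mem_nhds hp, f.eventuallyEq_one] with x hx h1
    change U.indicator (fun x ↦ f x • c x) x = c x
    rw [indicator_of_mem hx, h1, Pi.one_apply, one_smul]
  refine ⟨⟨φ, hφ⟩, ?_, fun v ↦ ?_⟩
  · exact hev.self_of_nhds.trans (by simp [c])
  · rw [mvfderiv_chart _ (mem_chart_source E p)]
    have h1 : φ ∘ param E p =ᶠ[𝓝 (extChartAt 𝓘(ℝ, E) p p)]
        fun y ↦ ((l (y - extChartAt 𝓘(ℝ, E) p p) : ℝ) : ℂ) := by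
      have h2 := continuousAt_param (E := E) (self_mem_dom p)
      rw [ContinuousAt, param_self] at h2
      filter_upwards [h2.eventually hev, dom_mem_nhds (self_mem_dom p)] with y hy hyd
      change φ (param E p y) = _
      rw [hy]
      change ((l (extChartAt 𝓘(ℝ, E) p (param E p y) - _) : ℝ) : ℂ) = _
      rw [chart_param hyd]
    have h3 : HasFDerivAt (fun y : E ↦ ((l (y - extChartAt 𝓘(ℝ, E) p p) : ℝ) : ℂ))
        (Complex.ofRealCLM.comp l) (extChartAt 𝓘(ℝ, E) p p) :=
      Complex.ofRealCLM.hasFDerivAt.comp _ (l.hasFDerivAt.comp _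
        ((hasFDerivAt_id _).sub_const _))
    change fderiv ℝ (φ ∘ param E p) _ _ = _
    rw [h1.fderiv_eq, h3.fderiv]
    rfl

/-- The constant function `1` on `U`. -/
def smoothFunOne (E : Type*) [NormedAddCommGroup E] [NormedSpace ℝ E]
    {M : Type*} [TopologicalSpace M] [ChartedSpace E M] (U : Set M) : SmoothFun E U :=
  ⟨U.indicator fun _ ↦ 1,
    by classical exact ⟨contMDiffOn_const.congr fun x hx ↦ indicator_of_mem hx _,
      fun x hx ↦ indicator_of_notMem hx _⟩⟩

/-- A first order operator of the form `symOp` that is a multiple of the identity has no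
first order part. -/
lemma eq_zero_of_symOp_eq_smul [T2Space M] (hU : IsOpen U) {A : Covector E M} {ξ : VField E M}
    {χ : M → ℝ} {ε : ℝ} {c : ℂ} {X : Module.End ℂ (SmoothFun E U)}
    (hX : IsGivenBy X (symOp ε A ξ χ)) (h : X = c • 1) {p : M} (hp : p ∈ U) : ξ p = 0 := by
  -- On a function with value `0` and differential `l` at `p`, all zeroth order terms drop out and
  -- the equation reads `l(ξ) = 0`. Linear forms separate points.
  have hl : ∀ l : E →L[ℝ] ℝ, l (chartDeriv p p (ξ p)) = 0 := fun l ↦ by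
    obtain ⟨φ, h0, h1⟩ := exists_smoothFun_fderiv hU hp l
    have h2 := hX φ p hp
    have h3 : (X φ : M → ℂ) p = c * (φ : M → ℂ) p := by rw [h]; rfl
    rw [h3, symOp, shiftedDeriv, h1, h0] at h2
    simpa using h2.symm
  have h0 : (chartDeriv p p (ξ p) : E) = 0 := by
    by_contra hne
    obtain ⟨l, -, hl'⟩ := exists_dual_vector ℝ _ (norm_ne_zero_iff.2 hne)
    rw [hl l] at hl'
    exact hne (norm_eq_zero.1 (by exact_mod_cast hl'.symm))
  -- The centre of the chart is renamed so that the base point can be transported independently of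
  -- it.
  obtain ⟨q, hq⟩ : ∃ q, q = p := ⟨p, rfl⟩
  have hv : ∀ x (hx : param E q (extChartAt 𝓘(ℝ, E) q q) = x) (v : TangentSpace 𝓘(ℝ, E) x),
      (chartDeriv q x v : E) = 0 → v = 0 := by
    rintro _ rfl v hv
    rw [← paramDeriv_chartDeriv (self_mem_dom q) v]
    exact (congrArg (paramDeriv q _) hv).trans (map_zero _)
  exact hv p (by rw [param_self, hq]) _ (by rw [hq]; exact h0)

end TestFunctions

variable {E : Type*} [NormedAddCommGroup E] [NormedSpace ℝ E] [FiniteDimensional ℝ E]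
  {M : Type*} [TopologicalSpace M] [ChartedSpace E M] [IsManifold 𝓘(ℝ, E) ∞ M] {U : Set M}
  {EG : Type*} [NormedAddCommGroup EG] [NormedSpace ℝ EG] [FiniteDimensional ℝ EG]
  {G : Type*} [TopologicalSpace G] [ChartedSpace EG G] [Group G] [LieGroup 𝓘(ℝ, EG) ∞ G]
  [MulAction G M] {ι : Type*} [Fintype ι] {e : Basis ι ℝ (GroupLieAlgebra 𝓘(ℝ, EG) G)}
  {F : Bilin E M} {A : Covector E M} {χ : ι → M → ℝ}

/-- The symmetry operators as a linear function of the element of the Lie algebra. -/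
lemma exists_symOp_linear
    (hsmooth : ContMDiff (𝓘(ℝ, EG).prod 𝓘(ℝ, E)) 𝓘(ℝ, E) ∞ (fun p : G × M ↦ p.1 • p.2))
    (hU : IsOpen U) (hA : IsPotentialOn F A U)
    (hχ : ∀ a, IsMomentOn F (generator (e a)) (χ a) U) (ε : ℝ) :
    ∃ X : GroupLieAlgebra 𝓘(ℝ, EG) G →ₗ[ℝ] Module.End ℂ (SmoothFun E U),
      ∀ v, IsGivenBy (X v) (symOp ε A (generator v) (moment e χ v)) := by
  choose X hX using fun v : GroupLieAlgebra 𝓘(ℝ, EG) G ↦ exists_symOp hU hA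
    (fun p y hy ↦ contDiffAt_coordVec_generator hsmooth v hy) (isMomentOn_moment hU hχ v) ε
  refine ⟨{ toFun := X, map_add' := fun v w ↦ ?_, map_smul' := fun c v ↦ ?_ }, hX⟩
  · refine LinearMap.ext fun φ ↦ smoothFun_ext fun x hx ↦ ?_
    change (X (v + w) φ : M → ℂ) x = (X v φ : M → ℂ) x + (X w φ : M → ℂ) x
    rw [hX _ φ x hx, hX _ φ x hx, hX _ φ x hx]
    simp only [symOp, shiftedDeriv, generator_add, moment_add, map_add]
    push_cast
    ring
  · refine LinearMap.ext fun φ ↦ smoothFun_ext fun x hx ↦ ?_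
    change (X (c • v) φ : M → ℂ) x = c • (X v φ : M → ℂ) x
    rw [hX _ φ x hx, hX _ φ x hx]
    simp only [symOp, shiftedDeriv, generator_smul, moment_smul, map_smul, Complex.real_smul,
      smul_eq_mul]
    push_cast
    ring

/-- The two terms close separately: the `F` part by `cyclic_generator_eq_zero`, the moment part by
the Jacobi identity. The moment equation plays no role here. -/
lemma cocycleCochain_mem_twoCocycle
    (hsmooth : ContMDiff (𝓘(ℝ, EG).prod 𝓘(ℝ, E)) 𝓘(ℝ, E) ∞ (fun p : G × M ↦ p.1 • p.2))
    (hF : IsClosedTwoForm F) (hFinv : ∀ h : G, F.InvariantUnder (fun x : M ↦ h • x)) (x : M) :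
    cocycleCochain e hF χ x ∈ LieModule.Cohomology.twoCocycle ℝ (GroupLieAlgebra 𝓘(ℝ, EG) G)
      (TrivialLieModule ℝ (GroupLieAlgebra 𝓘(ℝ, EG) G) ℝ) := by
  rw [LieModule.Cohomology.mem_twoCocycle_iff_of_trivial]
  intro u v w
  change (TrivialLieModule.equiv ℝ (GroupLieAlgebra 𝓘(ℝ, EG) G) ℝ).symm
      (cocycleFun e F χ u ⁅v, w⁆ x)
    = (TrivialLieModule.equiv ℝ (GroupLieAlgebra 𝓘(ℝ, EG) G) ℝ).symm
        (cocycleFun e F χ ⁅u, v⁆ w x)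
      + (TrivialLieModule.equiv ℝ (GroupLieAlgebra 𝓘(ℝ, EG) G) ℝ).symm
        (cocycleFun e F χ v ⁅u, w⁆ x)
  rw [← map_add]
  congr 1
  have h1 := cyclic_generator_eq_zero hsmooth hF hFinv u v w x
  have h2 : ∀ a b, F x a b = -F x b a := hF.neg_swap x
  have h3 : (generator ⁅w, u⁆ : VField E M) x = -generator ⁅u, w⁆ x := by
    rw [← lie_skew, ← neg_one_smul ℝ ⁅u, w⁆, generator_smul, neg_one_smul]
  rw [h3, map_neg, neg_apply, h2 (generator ⁅u, w⁆ x), h2 (generator ⁅v, w⁆ x)] at h1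
  simp only [cocycleFun, leibniz_lie u v w, moment_add]
  linarith

end KGF

/-! ### Homomorphisms out of a one-dimensional central extension -/

namespace LieAlgebra

section CentralExtension

variable {R L A : Type*} [CommRing R] [LieRing L] [LieAlgebra R L] [LieRing A] [LieAlgebra R A]
  (Ω : LieModule.Cohomology.twoCocycle R L (TrivialLieModule R L R)) (X : L →ₗ[R] A) (Z : A)

/-- A linear map that is a homomorphism up to a cocycle, as a homomorphism on the central
extension. -/
def centralExtensionHom (hZ : ∀ v, ⁅X v, Z⁆ = 0)
    (h : ∀ v w, ⁅X v, X w⁆ = X ⁅v, w⁆ + TrivialLieModule.equiv R L R (Ω.1 v w) • Z) :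
    ofTwoCocycle Ω →ₗ⁅R⁆ A where
  toFun z := X ((ofProd Ω).symm z).1 + TrivialLieModule.equiv R L R ((ofProd Ω).symm z).2 • Z
  map_add' z z' := by
    rw [of_symm_add, Prod.fst_add, Prod.snd_add, map_add, map_add, add_smul]
    abel
  map_smul' c z := by
    rw [of_symm_smul, Prod.smul_fst, Prod.smul_snd, map_smul, map_smul, smul_assoc, smul_add]
    rfl
  map_lie' {z z'} := by
    have hZ' : ∀ v, ⁅Z, X v⁆ = 0 := fun v ↦ by rw [← lie_skew, hZ, neg_zero]
    rw [bracket_ofTwoCocycle, Equiv.symm_apply_apply]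
    simp only [trivial_lie_zero, add_zero, sub_zero, add_lie, lie_add, lie_smul, smul_lie, hZ, hZ',
      lie_self, smul_zero, h]
    rfl

variable {Ω X Z} {hZ : ∀ v, ⁅X v, Z⁆ = 0}
  {h : ∀ v w, ⁅X v, X w⁆ = X ⁅v, w⁆ + TrivialLieModule.equiv R L R (Ω.1 v w) • Z}

lemma centralExtensionHom_ofProd (v : L) (r : TrivialLieModule R L R) :
    centralExtensionHom Ω X Z hZ h (ofProd Ω (v, r)) = X v + TrivialLieModule.equiv R L R r • Z :=
  rfl

lemma range_centralExtensionHom {ι : Type*} [Fintype ι] (e : Module.Basis ι R L) :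
    (centralExtensionHom Ω X Z hZ h).range.toSubmodule
      = Submodule.span R (insert Z (Set.range fun a ↦ X (e a))) := by
  refine le_antisymm ?_ (Submodule.span_le.2 ?_)
  · rintro _ ⟨z, rfl⟩
    obtain ⟨⟨v, r⟩, rfl⟩ := (ofProd Ω).surjective z
    change X v + TrivialLieModule.equiv R L R r • Z ∈ _
    refine Submodule.add_mem _ ?_
      (Submodule.smul_mem _ _ (Submodule.subset_span (Set.mem_insert _ _)))
    rw [← e.sum_repr v, map_sum]
    refine Submodule.sum_mem _ fun a _ ↦ ?_
    rw [map_smul]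
    exact Submodule.smul_mem _ _
      (Submodule.subset_span (Set.mem_insert_of_mem _ (Set.mem_range_self a)))
  · rintro _ (rfl | ⟨a, rfl⟩)
    · refine ⟨ofProd Ω (0, (TrivialLieModule.equiv R L R).symm 1), ?_⟩
      change centralExtensionHom Ω X _ hZ h _ = _
      rw [centralExtensionHom_ofProd, map_zero, zero_add, LinearEquiv.apply_symm_apply, one_smul]
    · refine ⟨ofProd Ω (e a, 0), ?_⟩
      change centralExtensionHom Ω X Z hZ h _ = _
      rw [centralExtensionHom_ofProd, map_zero, zero_smul, add_zero]

/-- A kernel element `(v, r)` satisfies `X v = -r Z`. So it is enough that `X v` is a multiple of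
`Z` only for `v = 0`, and that `Z` has no torsion. -/
lemma injective_centralExtensionHom (hX : ∀ v (c : R), X v = c • Z → v = 0)
    (hZ0 : ∀ c : R, c • Z = 0 → c = 0) : Function.Injective (centralExtensionHom Ω X Z hZ h) := by
  refine (injective_iff_map_eq_zero _).2 fun z hz ↦ ?_
  obtain ⟨⟨v, r⟩, rfl⟩ := (ofProd Ω).surjective z
  rw [centralExtensionHom_ofProd] at hz
  have hv : v = 0 := hX v (-TrivialLieModule.equiv R L R r) (by
    rw [neg_smul]; exact eq_neg_of_add_eq_zero_left hz)
  rw [hv, map_zero, zero_add] at hz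
  have hr := (LinearEquiv.map_eq_zero_iff _).1 (hZ0 _ hz)
  rw [hv, hr]
  rfl

end CentralExtension

end LieAlgebra

end

/-! ### The theorem -/

open KGF in
theorem theorem1
    {E : Type*} [NormedAddCommGroup E] [NormedSpace ℝ E] [FiniteDimensional ℝ E]
    {M : Type*} [TopologicalSpace M] [T2Space M] [SecondCountableTopology M] [ConnectedSpace M]
    [ChartedSpace E M] [IsManifold 𝓘(ℝ, E) ∞ M]
    (g : PseudoRiemannianMetric E M)
    {EG : Type*} [NormedAddCommGroup EG] [NormedSpace ℝ EG] [FiniteDimensional ℝ EG]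
    {G : Type*} [TopologicalSpace G] [ChartedSpace EG G] [Group G] [LieGroup 𝓘(ℝ, EG) ∞ G]
    [MulAction G M]
    (hsmooth : ContMDiff (𝓘(ℝ, EG).prod 𝓘(ℝ, E)) 𝓘(ℝ, E) ∞ (fun p : G × M ↦ p.1 • p.2))
    (hmotion : ∀ h : G, g.val.InvariantUnder (fun x : M ↦ h • x))
    (F : Bilin E M) (hF : IsClosedTwoForm F)
    (hFinv : ∀ h : G, F.InvariantUnder (fun x : M ↦ h • x))
    {ι : Type*} [Fintype ι] (e : Module.Basis ι ℝ (GroupLieAlgebra 𝓘(ℝ, EG) G))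
    (m ε : ℝ) (hm : 0 < m) :
    -- potentials and the functions `χ_a` exist near every point
    (∀ p : M, ∃ U : Set M, IsOpen U ∧ IsConnected U ∧ p ∈ U ∧
      (∃ A : Covector E M, IsPotentialOn F A U) ∧
      ∃ χ : ι → M → ℝ, ∀ a, IsMomentOn F (generator (e a)) (χ a) U) ∧
    -- and wherever they exist:
    ∀ (U : Set M) (A : Covector E M) (χ : ι → M → ℝ), IsOpen U → IsConnected U →
      IsPotentialOn F A U → (∀ a, IsMomentOn F (generator (e a)) (χ a) U) →
      ∃ (H : Module.End ℂ (SmoothFun E U)) (X₀ : Module.End ℂ (SmoothFun E U))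
        (X : ι → Module.End ℂ (SmoothFun E U)),
        IsGivenBy H (kgf g m ε A) ∧
        IsGivenBy X₀ (fun φ x ↦ Complex.I * (ε : ℂ) * φ x) ∧
        (∀ a, IsGivenBy (X a) (symOp ε A (generator (e a)) (χ a))) ∧
        -- symmetry operators
        ⁅H, X₀⁆ = 0 ∧ (∀ a, ⁅H, X a⁆ = 0) ∧
        -- the expression `F(ξ_a, ξ_b) - C_{ab}^c χ_c` is constant and is a 2-cocycle
        ∃ Ω : LieModule.Cohomology.twoCocycle ℝ (GroupLieAlgebra 𝓘(ℝ, EG) G)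
            (TrivialLieModule ℝ (GroupLieAlgebra 𝓘(ℝ, EG) G) ℝ),
          (∀ a b, ∀ x ∈ U,
            F x (generator (e a) x) (generator (e b) x) - ∑ c, e.repr ⁅e a, e b⁆ c * χ c x
              = TrivialLieModule.equiv ℝ (GroupLieAlgebra 𝓘(ℝ, EG) G) ℝ (Ω.1 (e a) (e b))) ∧
          -- the span of the operators is the central extension defined by this cocycle
          ∃ Φ : LieAlgebra.ofTwoCocycle Ω →ₗ⁅ℝ⁆ Module.End ℂ (SmoothFun E U),
            Φ (LieAlgebra.ofProd Ω
              (0, (TrivialLieModule.equiv ℝ (GroupLieAlgebra 𝓘(ℝ, EG) G) ℝ).symm 1)) = X₀ ∧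
            (∀ a, Φ (LieAlgebra.ofProd Ω (e a, 0)) = X a) ∧
            Φ.range.toSubmodule = Submodule.span ℝ (insert X₀ (Set.range X)) ∧
            (ε ≠ 0 → DiscreteTopology (MulAction.toPermHom G M).ker →
              Function.Injective Φ) := by
  refine ⟨fun p ↦ ?_, fun U A χ hU hUc hA hχ ↦ ?_⟩
  · exact exists_potential_moment hF (fun a ↦ generator (e a)) p
      (fun a y hy ↦ contDiffAt_coordVec_generator hsmooth (e a) hy)
      (fun a y hy v w ↦ lieBilin_generator hsmooth hF.smooth hFinv (e a) hy v w)
  obtain ⟨x₀, hx₀⟩ := hUc.nonempty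
  have hgen := fun (v : GroupLieAlgebra 𝓘(ℝ, EG) G) (p : M) (y : E) (hy : y ∈ dom E p) ↦
    contDiffAt_coordVec_generator (E := E) hsmooth v hy
  have hkill := fun (v : GroupLieAlgebra 𝓘(ℝ, EG) G) (p : M) (y : E) (hy : y ∈ dom E p) ↦
    lieBilin_generator hsmooth g.smooth hmotion v hy
  obtain ⟨H, hH⟩ := exists_kgf hU hA g m ε
  obtain ⟨X, hX⟩ := exists_symOp_linear hsmooth hU hA hχ ε
  let X₀ : Module.End ℂ (SmoothFun E U) := (Complex.I * (ε : ℂ)) • 1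
  have hcentral : ∀ T : Module.End ℂ (SmoothFun E U), ⁅T, X₀⁆ = 0 := lie_smul_one _
  -- The cocycle is the expression evaluated at an arbitrary base point of `U`; `hΩ` records that
  -- the point does not matter.
  let Ω : LieModule.Cohomology.twoCocycle ℝ (GroupLieAlgebra 𝓘(ℝ, EG) G)
      (TrivialLieModule ℝ (GroupLieAlgebra 𝓘(ℝ, EG) G) ℝ) :=
    ⟨cocycleCochain e hF χ x₀, cocycleCochain_mem_twoCocycle hsmooth hF hFinv x₀⟩
  have hΩ : ∀ v w, ∀ x ∈ U, cocycleFun e F χ v w x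
      = TrivialLieModule.equiv ℝ (GroupLieAlgebra 𝓘(ℝ, EG) G) ℝ (Ω.1 v w) := fun v w x hx ↦
    cocycleFun_eq hsmooth hF hFinv hU hUc.isPreconnected hχ v w hx hx₀
  have hbr : ∀ v w, ⁅X v, X w⁆ = X ⁅v, w⁆
      + TrivialLieModule.equiv ℝ (GroupLieAlgebra 𝓘(ℝ, EG) G) ℝ (Ω.1 v w) • X₀ := fun v w ↦ by
    refine LinearMap.ext fun φ ↦ smoothFun_ext fun x hx ↦ ?_
    rw [symOp_commutator hU hA (hgen v) (isMomentOn_moment hU hχ v) (hgen w)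
      (isMomentOn_moment hU hχ w) ε (fun p y hy ↦ coordVec_generator_lie hsmooth v w hy)
      (χζ := moment e χ ⁅v, w⁆) (hX v) (hX w) φ hx]
    change _ = (X ⁅v, w⁆ φ : M → ℂ) x
      + TrivialLieModule.equiv ℝ (GroupLieAlgebra 𝓘(ℝ, EG) G) ℝ (Ω.1 v w)
        • (Complex.I * (ε : ℂ) * (φ : M → ℂ) x)
    rw [hX _ φ x hx, ← hΩ v w x hx, Complex.real_smul]
    rfl
  refine ⟨H, X₀, fun a ↦ X (e a), hH, isGivenBy_const _, fun a ↦ ?_, hcentral H, fun a ↦ ?_, Ω,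
    fun a b x hx ↦ hΩ (e a) (e b) x hx,
    LieAlgebra.centralExtensionHom Ω X X₀ (fun v ↦ hcentral _) hbr, ?_, fun a ↦ ?_,
    LieAlgebra.range_centralExtensionHom e, fun hε hker ↦ ?_⟩
  · rw [show χ a = moment e χ (e a) from (funext (moment_basis e χ a)).symm]
    exact hX (e a)
  · exact kgf_symOp_comm hU hA (hgen (e a)) (isMomentOn_moment hU hχ (e a)) g m ε
      (fun p y hy v w ↦ hkill (e a) p y hy v w) hH (hX (e a))
  · rw [LieAlgebra.centralExtensionHom_ofProd, map_zero, zero_add, LinearEquiv.apply_symm_apply,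
      one_smul]
  · rw [LieAlgebra.centralExtensionHom_ofProd, map_zero, zero_smul, add_zero]
  · refine LieAlgebra.injective_centralExtensionHom (fun v c hv ↦ ?_) fun c hc ↦ ?_
    -- A multiple of `X₀` is a scalar operator, so `ξ_v` vanishes on `U`, then on `M` by unique
    -- continuation, and discreteness gives `v = 0`.
    · have h0 : X v = ((c : ℂ) * (Complex.I * (ε : ℂ))) • 1 := by
        rw [hv, mul_smul]
        rfl
      exact eq_zero_of_generator_eq_zero hsmooth hker fun x ↦ killing_eq_zero_of_isOpen g (hgen v)
        (fun p y hy u w ↦ hkill v p y hy u w) hU hUc.nonempty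
        (fun p hp ↦ eq_zero_of_symOp_eq_smul hU (hX v) h0 hp) x
    -- Evaluation on the constant function `1` gives `c · iε = 0`; here `ε ≠ 0` enters.
    · have h1 : ((c • X₀) (smoothFunOne E U) : M → ℂ) x₀ = 0 := by rw [hc]; rfl
      have h2 : (smoothFunOne E U : M → ℂ) x₀ = 1 := Set.indicator_of_mem hx₀ fun _ ↦ (1 : ℂ)
      change c • (Complex.I * (ε : ℂ) * (smoothFunOne E U : M → ℂ) x₀) = 0 at h1
      rw [h2, Complex.real_smul] at h1
      simpa [hε] using h1
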